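/- **Setting (dimensionless).** Let $a_1=\tfrac12(1,\sqrt3)$, $a_2=\tfrac12(-1,\sqrt3)$, $b_1=\tfrac{4\pi}{\sqrt3}(\tfrac{\sqrt3}2,\tfrac12)$, $b_2=\tfrac{4\pi}{\sqrt3}(-\tfrac{\sqrt3}2,\tfrac12)$, $\tau^A=0$, $\tau^B=(0,\tfrac1{\sqrt3})$, $\kappa=(\tfrac{4\pi}3,0)$, and let $R(\zeta)$ be the counterclockwise rotation by $\zeta$. For a twist angle $\theta>0$ and an interlayer displacement $\mathfrak d\in\mathbb R^2$ put $R_1=R(-\tfrac\theta2)$, $R_2=R(\tfrac\theta2)$ and, for layers $i\in\{1,2\}$, $a_{i,j}=R_ia_j$, $b_{i,j}=R_ib_j$, $\kappa_i=R_i\kappa$, $\Lambda_i=\mathbb Za_{i,1}+\mathbb Za_{i,2}$, $\tau_1^\sigma=R_1(\tau^\sigma-\tfrac{\mathfrak d}2)$, $\tau_2^\sigma=R_2(\tau^\sigma+\tfrac{\mathfrak d}2)$ for $\sigma\in\{A,B\}$. Let $\mathcal H=\ell^2(\mathbb Z^2;\mathbb C^2)\oplus\ell^2(\mathbb Z^2;\mathbb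 C^2)$, with elements $\psi=(\psi^\sigma_{R_i})_{i,\,R_i\in\Lambda_i,\,\sigma}$ and the norm $\|\psi\|_{\mathcal H}^2=\sum_{i,R_i,\sigma}|\psi^\sigma_{R_i}|^2$. The tight-binding Hamiltonian $H$ of twisted bilayer graphene with hopping function $h(r;\ell)=h^\sharp(\sqrt{|r|^2+\ell^2})$, $h^\sharp$ real-valued, is $$(H\psi)_{R_i}=-\tfrac2{\sqrt3}\begin{pmatrix}\psi^B_{R_i}+\psi^B_{R_i-a_{i,1}}+\psi^B_{R_i-a_{i,2}}\\ \psi^A_{R_i}+\psi^A_{R_i+a_{i,1}}+\psi^A_{R_i+a_{i,2}}\end{pmatrix}+\Big(\tfrac{\sqrt3}2\sum_{R_j\in\Lambda_j}\sum_{\sigma'\in\{A,B\}}h(R_i+\tau_i^\sigma-R_j-\tau_j^{\sigma'};\ell)\,\psi^{\sigma'}_{R_j}\Big)_{\sigma=A,B},\qquad j\neq i.$$ **Hypotheses on $h$.** Let $\hat h(\xi;\ell)=\int_{\mathbb R^2}e^{-i\xi\cdot r}h(r;\ell)\,dr$ (real and radial in $\xi$). There are constants $C_1,C_2,C_3,D_1,D_2,\ell_0>0$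 with $1\le D_1/D_2<2$ such that $h^\sharp$ is continuous on $[\ell_0,\infty)$ and, for every $\ell\ge\ell_0$, the function $h(\cdot;\ell)$ is integrable, $\hat h(\kappa;\ell)\ge C_1e^{-D_1\ell|\kappa|}$, and for all $\xi,\xi'\in\mathbb R^2$ $$|\hat h(\xi;\ell)|\le C_2e^{-D_2\ell|\xi|},\qquad |\hat h(\xi;\ell)-\hat h(\xi';\ell)|\le C_3e^{-D_2\ell\,d(0,[\xi,\xi'])}|\xi-\xi'|,$$ where $d(0,[\xi,\xi'])$ is the distance from the origin to the segment $[\xi,\xi']$. **Bistritzer–MacDonald (BM) model.** Let $\mathfrak s_1=\kappa_1-\kappa_2$, $\mathfrak s_2=\mathfrak s_1-b_{2,2}+b_{1,2}$, $\mathfrak s_3=\mathfrak s_1+b_{2,1}-b_{1,1}$, $T_1^{\sigma\sigma'}=1$, $T_2^{\sigma\sigma'}=e^{i[b_{1,2}\cdot\tau_1^\sigma-b_{2,2}\cdot\tau_2^{\sigma'}]}$, $T_3^{\sigma\sigma'}=e^{i[-b_{1,1}\cdot\tau_1^\sigma+b_{2,1}\cdot\tau_2^{\sigma'}]}$, $T_\theta(r)=\sum_{n=1}^3T_ne^{-i\mathfrak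 s_n\cdot r}$ and, for $\lambda_0,\gamma>0$, with Pauli matrices $\vec\sigma=(\sigma_1,\sigma_2)$, $$H_{\rm BM}=\begin{pmatrix}\vec\sigma\cdot(-i\nabla_X)&\mathcal T(X)\\ \mathcal T^\dagger(X)&\vec\sigma\cdot(-i\nabla_X)\end{pmatrix},\qquad \mathcal T(X)=\lambda_0T_\theta(X/\gamma).$$ **Statement.** Let $h$ be as above and let $\lambda_0,\lambda_1>0$. There are constants $\gamma_0,C,c>0$, depending only on $\hat h$ (including the constants in its hypotheses), $\lambda_0$ and $\lambda_1$, such that the following holds for all $0<\gamma\le\gamma_0$, all $\ell\ge\ell_0$ with $\hat h(\kappa;\ell)=\lambda_0\gamma$, all $0<\theta\le\lambda_1\gamma$, all $\mathfrak d\in\mathbb R^2$ and all $f_0=(f_{1,0}^A,f_{1,0}^B,f_{2,0}^A,f_{2,0}^B)\in H^8(\mathbb R^2;\mathbb C^4)$. If $f=f(X,T)=(f_1^A,f_1^B,f_2^A,f_2^B)$ is a classical solution, for $T\ge0$, of $$i\partial_Tf=H_{\rm BM}f,\qquad f(\cdot,0)=f_0,$$ if $\Psi$ is the wave packet $$(\Psi_i)^\sigma_{R_i}(\tau)=\gamma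 f_i^\sigma\big(\gamma(R_i+\tau_i^\sigma),\gamma\tau\big)e^{i\kappa_i\cdot(R_i+\tau_i^\sigma)},$$ and if $r(\tau)=-(i\partial_\tau-H)\Psi(\tau)$ is its residual, then for all $\tau\ge0$ $$\|r(\tau)\|_{\mathcal H}\le C\gamma^{1+c}\,\|f(\cdot,\gamma\tau)\|_{H^8(\mathbb R^2;\mathbb C^4)},$$ where the right-hand side is $+\infty$ if $f(\cdot,\gamma\tau)\notin H^8(\mathbb R^2;\mathbb C^4)$. -/

import Mathlib

open MeasureTheory FourierTransform
open scoped ENNReal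

noncomputable section

namespace TBG

/-! Conventions. All quantities are dimensionless (monolayer lattice constant, Dirac velocity and
reduced Planck constant equal to one). The layers `1`, `2` are the indices `0`, `1` of `Fin 2`, and so
are the sublattices `A`, `B`. -/

/-- The Euclidean plane. -/
abbrev Plane : Type := EuclideanSpace ℝ (Fin 2)

/-- Counterclockwise rotation of the plane by the angle `ζ`. -/
def rot (ζ : ℝ) (v : Plane) : Plane :=
  !₂[Real.cos ζ * v 0 - Real.sin ζ * v 1, Real.sin ζ * v 0 + Real.cos ζ * v 1]

/-- The scalar `exp (i x)` for real `x`. -/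
def phase (x : ℝ) : ℂ := Complex.exp (Complex.I * (x : ℂ))

/-! ### The monolayer -/

/-- Lattice vectors `a₁ = (1/2, √3/2)`, `a₂ = (-1/2, √3/2)`. -/
def latticeVec : Fin 2 → Plane :=
  ![!₂[1 / 2, Real.sqrt 3 / 2], !₂[-(1 / 2), Real.sqrt 3 / 2]]

/-- Reciprocal lattice vectors `b₁ = (4π/√3) (√3/2, 1/2)`, `b₂ = (4π/√3) (-√3/2, 1/2)`,
which satisfy `bᵢ · aⱼ = 2π δᵢⱼ`. -/
def recipVec : Fin 2 → Plane :=
  ![(4 * Real.pi / Real.sqrt 3) • !₂[Real.sqrt 3 / 2, 1 / 2],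
    (4 * Real.pi / Real.sqrt 3) • !₂[-(Real.sqrt 3 / 2), 1 / 2]]

/-- Positions of the two atoms of a cell: `τ^A = 0`, `τ^B = (0, 1/√3)`. -/
def siteShift : Fin 2 → Plane := ![0, !₂[0, 1 / Real.sqrt 3]]

/-- The Dirac point `κ = (4π/3, 0)`. -/
def kappa : Plane := !₂[4 * Real.pi / 3, 0]

/-! ### The twisted bilayer -/

/-- `-1` for layer 1 and `+1` for layer 2. -/
def layerSign : Fin 2 → ℝ := ![-1, 1]

/-- The layer other than the given one. -/
def otherLayer : Fin 2 → Fin 2 := ![1, 0]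

/-- Rotation of layer `i` : by `-θ/2` for layer 1 and by `θ/2` for layer 2. -/
def layerRot (θ : ℝ) (i : Fin 2) (v : Plane) : Plane := rot (layerSign i * (θ / 2)) v

/-- Site shift of sublattice `σ` in layer `i`, for the interlayer displacement `d`:
`R(∓θ/2) (τ^σ ∓ d/2)`. -/
def layerShift (θ : ℝ) (d : Plane) (i σ : Fin 2) : Plane :=
  layerRot θ i (siteShift σ + (layerSign i / 2) • d)

/-- The Dirac point `κᵢ` of layer `i`. -/
def layerKappa (θ : ℝ) (i : Fin 2) : Plane := layerRot θ i kappa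

/-- The reciprocal lattice vector `b_{i,j}` of layer `i`. -/
def layerRecip (θ : ℝ) (i j : Fin 2) : Plane := layerRot θ i (recipVec j)

/-- The position `Rᵢ + τᵢ^σ` of the atom of sublattice `σ` in the cell
`Rᵢ = m₁ a_{i,1} + m₂ a_{i,2}` of layer `i`. -/
def sitePos (θ : ℝ) (d : Plane) (i σ : Fin 2) (m : ℤ × ℤ) : Plane :=
  ((m.1 : ℝ) • layerRot θ i (latticeVec 0) + (m.2 : ℝ) • layerRot θ i (latticeVec 1))
    + layerShift θ d i σ

/-- Wave functions `ψ i σ m` on the bilayer: layer `i`, sublattice `σ`, cell `m`. -/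
abbrev WaveFunction : Type := Fin 2 → Fin 2 → ℤ × ℤ → ℂ

/-- The norm of the Hilbert space `ℓ²(ℤ²; ℂ²) ⊕ ℓ²(ℤ²; ℂ²)`, equal to `∞` outside of that space. -/
def stateNorm (φ : WaveFunction) : ℝ≥0∞ :=
  (∑ i, ∑ σ, ∑' m, ‖φ i σ m‖ₑ ^ 2) ^ (1 / 2 : ℝ)

/-- The interlayer hopping function `h(r; ℓ) = h♯(√(|r|² + ℓ²))`. -/
def hop (hs : ℝ → ℝ) (r : Plane) (l : ℝ) : ℝ := hs (Real.sqrt (‖r‖ ^ 2 + l ^ 2))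

/-- The intralayer (nearest-neighbour graphene) Hamiltonian `-(2/√3) (…)`, the same in both
layers. -/
def intraHam (φ : Fin 2 → ℤ × ℤ → ℂ) : Fin 2 → ℤ × ℤ → ℂ :=
  ![fun m => -((2 / Real.sqrt 3 : ℝ) : ℂ) * (φ 1 m + φ 1 (m - (1, 0)) + φ 1 (m - (0, 1))),
    fun m => -((2 / Real.sqrt 3 : ℝ) : ℂ) * (φ 0 m + φ 0 (m + (1, 0)) + φ 0 (m + (0, 1)))]

/-- The interlayer Hamiltonian: the component in layer `i` of its action on `ψ`. As `h` is real and
radial, the block of layers `2`, `1` is the adjoint of the block of layers `1`, `2`. -/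
def interHam (hs : ℝ → ℝ) (l θ : ℝ) (d : Plane) (ψ : WaveFunction) (i σ : Fin 2) (m : ℤ × ℤ) : ℂ :=
  ((Real.sqrt 3 / 2 : ℝ) : ℂ) * ∑' m' : ℤ × ℤ, ∑ σ' : Fin 2,
    ((hop hs (sitePos θ d i σ m - sitePos θ d (otherLayer i) σ' m') l : ℝ) : ℂ)
      * ψ (otherLayer i) σ' m'

/-- The tight-binding Hamiltonian of twisted bilayer graphene. -/
def hamiltonian (hs : ℝ → ℝ) (l θ : ℝ) (d : Plane) (ψ : WaveFunction) : WaveFunction :=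
  fun i σ m => intraHam (ψ i) σ m + interHam hs l θ d ψ i σ m

/-! ### The Fourier transform of the hopping function -/

/-- `∫ e^{-i ξ·r} h(r; ℓ) dr`. -/
def hopFourier (hs : ℝ → ℝ) (ξ : Plane) (l : ℝ) : ℂ :=
  ∫ r : Plane, phase (-inner ℝ ξ r) * ((hop hs r l : ℝ) : ℂ)

/-- The Fourier transform `ĥ(ξ; ℓ)` as a real number. -/
def hHat (hs : ℝ → ℝ) (ξ : Plane) (l : ℝ) : ℝ := (hopFourier hs ξ l).re

/-- The Fourier transform of the (real and even) hopping function is real, so that `hHat` is the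
Fourier transform. -/
theorem ofReal_hHat (hs : ℝ → ℝ) (ξ : Plane) (l : ℝ) :
    ((hHat hs ξ l : ℝ) : ℂ) = hopFourier hs ξ l := by
  unfold hHat
  rw [← Complex.conj_eq_iff_re]
  unfold hopFourier
  rw [← integral_conj, ← integral_neg_eq_self]
  refine integral_congr_ae (Filter.Eventually.of_forall fun r => ?_)
  simp only [map_mul, map_neg, phase, ← Complex.exp_conj, Complex.conj_I, Complex.conj_ofReal, hop,
    norm_neg, inner_neg_right, Complex.ofReal_neg]
  ring_nf

/-- Assumptions on the interlayer hopping function `h(r; ℓ) = h♯(√(|r|² + ℓ²))`: it is continuous and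
integrable for `ℓ ≥ ℓ₀`; its Fourier transform satisfies, for `ℓ ≥ ℓ₀`, an exponential upper
bound, a lower bound at the Dirac momentum, with rates such that `1 ≤ D₁ / D₂ < 2`, and a Lipschitz
bound with an exponentially decaying constant. -/
structure HoppingAssumption (hs : ℝ → ℝ) (C₁ C₂ C₃ D₁ D₂ l₀ : ℝ) : Prop where
  C₁_pos : 0 < C₁
  C₂_pos : 0 < C₂
  C₃_pos : 0 < C₃
  D₁_pos : 0 < D₁
  D₂_pos : 0 < D₂
  l₀_pos : 0 < l₀
  continuousOn : ContinuousOn hs (Set.Ici l₀)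
  integrable : ∀ l, l₀ ≤ l → Integrable (fun r : Plane => hop hs r l)
  lower : ∀ l, l₀ ≤ l → C₁ * Real.exp (-(D₁ * l * ‖kappa‖)) ≤ hHat hs kappa l
  upper : ∀ l, l₀ ≤ l → ∀ ξ : Plane, |hHat hs ξ l| ≤ C₂ * Real.exp (-(D₂ * l * ‖ξ‖))
  one_le_ratio : 1 ≤ D₁ / D₂
  ratio_lt_two : D₁ / D₂ < 2
  lipschitz : ∀ l, l₀ ≤ l → ∀ ξ ξ' : Plane, |hHat hs ξ l - hHat hs ξ' l| ≤
    C₃ * Real.exp (-(D₂ * l * Metric.infDist 0 (segment ℝ ξ ξ'))) * ‖ξ - ξ'‖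

/-! ### The moiré potential and the Bistritzer-MacDonald Hamiltonian -/

/-- The momentum hops `𝔰₁`, `𝔰₂`, `𝔰₃`. -/
def momentumHop (θ : ℝ) : Fin 3 → Plane :=
  ![layerKappa θ 0 - layerKappa θ 1,
    layerKappa θ 0 - layerKappa θ 1 - layerRecip θ 1 1 + layerRecip θ 0 1,
    layerKappa θ 0 - layerKappa θ 1 + layerRecip θ 1 0 - layerRecip θ 0 0]

/-- The hopping matrices `T₁`, `T₂`, `T₃`. -/
def hopMatrix (θ : ℝ) (d : Plane) : Fin 3 → Matrix (Fin 2) (Fin 2) ℂ :=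
  ![Matrix.of fun _ _ => 1,
    Matrix.of fun σ σ' => phase
      (inner ℝ (layerRecip θ 0 1) (layerShift θ d 0 σ)
        - inner ℝ (layerRecip θ 1 1) (layerShift θ d 1 σ')),
    Matrix.of fun σ σ' => phase
      (-inner ℝ (layerRecip θ 0 0) (layerShift θ d 0 σ)
        + inner ℝ (layerRecip θ 1 0) (layerShift θ d 1 σ'))]

/-- The moiré potential `T_θ(r) = ∑ⱼ Tⱼ e^{-i 𝔰ⱼ·r}`. -/
def moirePotential (θ : ℝ) (d r : Plane) : Matrix (Fin 2) (Fin 2) ℂ :=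
  ∑ j, phase (-inner ℝ (momentumHop θ j) r) • hopMatrix θ d j

/-- The scaled moiré potential `𝒯(X) = λ₀ T_θ(X / γ)`. -/
def scaledMoire (lam₀ γ θ : ℝ) (d X : Plane) : Matrix (Fin 2) (Fin 2) ℂ :=
  ((lam₀ : ℝ) : ℂ) • moirePotential θ d (γ⁻¹ • X)

/-- The Pauli matrices `σ₁`, `σ₂`. -/
def pauli : Fin 2 → Matrix (Fin 2) (Fin 2) ℂ :=
  ![!![0, 1; 1, 0], !![0, -Complex.I; Complex.I, 0]]

/-- Envelopes `f i σ X` : layer `i`, sublattice `σ`, position `X`. -/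
abbrev Envelope : Type := Fin 2 → Fin 2 → Plane → ℂ

/-- Partial derivative in the `a`-th coordinate. -/
def partialDeriv (a : Fin 2) (u : Plane → ℂ) (X : Plane) : ℂ :=
  fderiv ℝ u X (EuclideanSpace.single a 1)

/-- The Dirac operator `σ · (-i ∇)`. -/
def diracOp (u : Fin 2 → Plane → ℂ) (σ : Fin 2) (X : Plane) : ℂ :=
  ∑ a, ∑ σ', pauli a σ σ' * (-Complex.I * partialDeriv a (u σ') X)

/-- The interlayer part of the Bistritzer-MacDonald Hamiltonian: `𝒯` from layer 2 to layer 1 and its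
conjugate transpose from layer 1 to layer 2. -/
def bmCoupling (lam₀ γ θ : ℝ) (d X : Plane) : Fin 2 → Matrix (Fin 2) (Fin 2) ℂ :=
  ![scaledMoire lam₀ γ θ d X, (scaledMoire lam₀ γ θ d X).conjTranspose]

/-- The scaled Bistritzer-MacDonald Hamiltonian. -/
def bmHamiltonian (lam₀ γ θ : ℝ) (d : Plane) (g : Envelope) : Envelope :=
  fun i σ X => diracOp (g i) σ X
    + ∑ σ', bmCoupling lam₀ γ θ d X i σ σ' * g (otherLayer i) σ' X

/-- `f` is a (classical) solution, for times `T ≥ 0`, of `i ∂_T f = H_BM f`, `f(0) = f₀`; the time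
derivative at `T = 0` is one-sided. -/
structure IsBMSolution (lam₀ γ θ : ℝ) (d : Plane) (f₀ : Envelope) (f : ℝ → Envelope) : Prop where
  init : f 0 = f₀
  differentiable_space : ∀ T, 0 ≤ T → ∀ i σ, Differentiable ℝ (f T i σ)
  differentiable_time : ∀ T, 0 ≤ T → ∀ i σ X,
    DifferentiableWithinAt ℝ (fun t => f t i σ X) (Set.Ici 0) T
  equation : ∀ T, 0 ≤ T → ∀ i σ X,
    Complex.I * derivWithin (fun t => f t i σ X) (Set.Ici 0) T
      = bmHamiltonian lam₀ γ θ d (f T) i σ X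

/-! ### Sobolev norms -/

open Classical in
/-- The Sobolev norm `‖u‖_{H^s(ℝ²)} = (∫ (1 + |ξ|²)^s |û(ξ)|² dξ / (2π)²)^{1/2}` (with
`û(ξ) = ∫ e^{-i ξ·x} u(x) dx`, extended to `L²`), equal to `∞` outside of `H^s`. It is written in
the variable `η = ξ / 2π`, as Mathlib's Fourier transform on `L²` is normalized with
`e^{-2π i η·x}`. -/
def sobolevNorm (s : ℝ) (u : Plane → ℂ) : ℝ≥0∞ :=
  if hu : MemLp u 2 volume then
    (∫⁻ η : Plane, ENNReal.ofReal ((1 + (2 * Real.pi * ‖η‖) ^ 2) ^ s)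
      * ‖(𝓕 (hu.toLp u) : Lp ℂ 2 (volume : Measure Plane)) η‖ₑ ^ 2) ^ (1 / 2 : ℝ)
  else ⊤

/-- The norm of `H^s(ℝ²; ℂ⁴)`. -/
def envelopeNorm (s : ℝ) (g : Envelope) : ℝ≥0∞ :=
  (∑ i, ∑ σ, sobolevNorm s (g i σ) ^ 2) ^ (1 / 2 : ℝ)

/-! ### The wave packet and its residual -/

/-- The wave packet
`Ψᵢ^σ(τ)_R = γ fᵢ^σ(γ (R + τᵢ^σ), γ τ) e^{i κᵢ·(R + τᵢ^σ)}`. -/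
def wavePacket (γ θ : ℝ) (d : Plane) (f : ℝ → Envelope) (τ : ℝ) : WaveFunction :=
  fun i σ m => (γ : ℂ) * f (γ * τ) i σ (γ • sitePos θ d i σ m)
    * phase (inner ℝ (layerKappa θ i) (sitePos θ d i σ m))

/-- The residual `r = -(i ∂_τ - H) Ψ`, for times `τ ≥ 0`. -/
def residual (hs : ℝ → ℝ) (l γ θ : ℝ) (d : Plane) (f : ℝ → Envelope) (τ : ℝ) : WaveFunction :=
  fun i σ m =>
    -(Complex.I * derivWithin (fun t => wavePacket γ θ d f t i σ m) (Set.Ici 0) τ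
      - hamiltonian hs l θ d (wavePacket γ θ d f τ) i σ m)

end TBG

end

open MeasureTheory FourierTransform
open scoped ENNReal

noncomputable section

namespace TBG

open Set ComplexConjugate

/-! The residual is a sum of Fourier integrals with explicit symbols, so it suffices to bound the
symbols and then to bound lattice samples of Fourier integrals in ℓ². At a fixed time let U be the
Fourier transform of the envelope. The packet at a site p is γ e^{iκ_i·p} times the integral `synth
γ U p`, a superposition of plane waves of momentum κ_i + γξ with ξ = 2πη.

Intralayer part (`norm_intraSymbol_sub_le`, `IsFourierRep.intra_eq`). Hopping to the three
neighbours multiplies U by a trigonometric symbol. At the Dirac point its constant term is a sum of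
the three cube roots of unity, hence zero. Its linear term is the Dirac operator, rotated by half
the twist angle. The Taylor remainder and the rotation cost O(γ²), because θ ≤ λ₁γ.

Interlayer part (`HoppingAssumption.exists_hasSum_hop`, `HoppingAssumption.inter_eq`). Poisson
summation turns the sum over the other layer j into a sum over its reciprocal lattice vectors G,
with symbols ĥ(κ_j + G + γξ). Since |κ_j + G|² = |κ|²(1 + 3N) with an integer N ≥ 0, exactly three
momenta have norm |κ| and the others have norm at least 2|κ|. Freezing ĥ at its value λ₀γ on the
three smallest momenta gives the moiré potential exactly (`bmCoupling_mul_phase`). What remains is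
bounded in `HoppingAssumption.exists_symbol_bound`. The lower bound for ĥ(κ) makes e^{-D₁ℓ|κ|} at
most a multiple of γ, so the far momenta contribute about γ^{2D₂/D₁} and the Lipschitz error is
about γ^{1+D₂/D₁}. Both are small against γ because D₁ < 2D₂. Where |γξ| is not small compared with
|κ_j + G|, powers of γ are bought with powers of ξ, that is, with derivatives of the envelope. The
rate obtained is c = D₂/D₁ - 1/2.

From symbols to ℓ² (`tsum_fourier_sitePos_sq_le`, `SobolevSymbol.tsum_tsum_synth_le`). Lattice
samples of a Fourier integral are the Fourier coefficients of the periodized integrand. Parseval and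
a weighted Cauchy-Schwarz inequality bound them by an H² norm, with a Jacobian of order γ⁻² that the
amplitude γ of the packet cancels. The symbol bounds grow like (1 + |ξ|²)², which costs four more
derivatives, so H⁸ is more than enough. -/

/-! ### Fourier series on the unit cell -/

abbrev Coord : Type := Fin 2 → ℝ

abbrev CellIndex : Type := Fin 2 → ℤ

/-- The base point `(0 : Coord)` is kept visible so that this is literally the set onto which
`UnitAddTorus.measurableEquivPiIoc 0` maps. -/
def unitCell : Set Coord := {x | ∀ i, x i ∈ Ioc ((0 : Coord) i) ((0 : Coord) i + 1)}

def ofIndex (n : CellIndex) : Coord := fun i => (n i : ℝ)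

theorem measurableSet_unitCell : MeasurableSet unitCell :=
  MeasurableSet.univ_pi' (fun _ => measurableSet_Ioc)

local instance : MeasureSpace UnitAddCircle := ⟨AddCircle.haarAddCircle⟩

/-- The representative in the unit cell of a point of the torus. -/
def cellRep (y : UnitAddTorus (Fin 2)) : Coord :=
  (UnitAddTorus.measurableEquivPiIoc (0 : Coord) y).1

theorem measurable_cellRep : Measurable cellRep :=
  measurable_subtype_coe.comp (UnitAddTorus.measurableEquivPiIoc (0 : Coord)).measurable

theorem measurePreserving_cellRep :
    MeasurePreserving cellRep volume (volume.restrict unitCell) := by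
  refine ⟨measurable_cellRep, ?_⟩
  have h := (UnitAddTorus.measurePreserving_equivPiIoc (0 : Coord)).map_eq
  have h2 : cellRep = Subtype.val ∘ (UnitAddTorus.measurableEquivPiIoc (0 : Coord)) := rfl
  rw [h2, ← Measure.map_map measurable_subtype_coe (MeasurableEquiv.measurable _), h]
  exact map_comap_subtype_coe measurableSet_unitCell volume

theorem mFourier_coe (n : CellIndex) (x : Coord) :
    UnitAddTorus.mFourier n (fun i => (x i : UnitAddCircle))
      = phase (2 * Real.pi * ∑ i, n i * x i) := by
  simp only [UnitAddTorus.mFourier, ContinuousMap.coe_mk, fourier_coe_apply, phase,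
    ← Complex.exp_sum]
  congr 1
  push_cast
  rw [Finset.mul_sum, Finset.mul_sum]
  refine Finset.sum_congr rfl fun i _ => ?_
  ring

/-- The Fourier coefficients of a function on the unit cell. -/
def cellCoeff (f : Coord → ℂ) (n : CellIndex) : ℂ :=
  ∫ x in unitCell, phase (2 * Real.pi * ∑ i, n i * x i) * f x

/-- Parseval on the torus, transported along `cellRep`. The kernel of `cellCoeff` is e^{+2πi n·x},
so its index is opposite to that of `mFourierCoeff`; the sum is reindexed by n ↦ -n. -/
theorem hasSum_cellCoeff_mul {f g : Coord → ℂ} (hf : MemLp f 2 (volume.restrict unitCell))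
    (hg : MemLp g 2 (volume.restrict unitCell)) :
    HasSum (fun n => conj (cellCoeff f n) * cellCoeff g n)
      (∫ x in unitCell, conj (f x) * g x) := by
  have key : ∀ {u : Coord → ℂ} (hu : MemLp u 2 (volume.restrict unitCell)) (n : CellIndex),
      UnitAddTorus.mFourierCoeff ((hu.comp_measurePreserving measurePreserving_cellRep).toLp) n
        = cellCoeff u (-n) := by
    intro u hu n
    rw [UnitAddTorus.mFourierCoeff, cellCoeff,
      integral_congr_ae (ae_eq_rfl.smul
        (hu.comp_measurePreserving measurePreserving_cellRep).coeFn_toLp)]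
    have h1 := UnitAddTorus.integral_preimage
      (fun y => UnitAddTorus.mFourier (-n) y • u (cellRep y)) (0 : Coord)
    refine h1.trans (setIntegral_congr_fun measurableSet_unitCell ?_)
    intro x hx
    have : cellRep (fun i => (x i : UnitAddCircle)) = x :=
      congrArg Subtype.val
        ((UnitAddTorus.measurableEquivPiIoc (0 : Coord)).apply_symm_apply ⟨x, hx⟩)
    simp only [this, mFourier_coe, smul_eq_mul]
  have h := UnitAddTorus.hasSum_prod_mFourierCoeff
    ((hf.comp_measurePreserving measurePreserving_cellRep).toLp)
    ((hg.comp_measurePreserving measurePreserving_cellRep).toLp)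
  simp only [key hf, key hg] at h
  have h2 := (Equiv.neg CellIndex).hasSum_iff.mpr h
  simp only [Function.comp_def, Equiv.neg_apply, neg_neg] at h2
  convert h2 using 1
  have hf' := (hf.comp_measurePreserving measurePreserving_cellRep).coeFn_toLp
  have hg' := (hg.comp_measurePreserving measurePreserving_cellRep).coeFn_toLp
  have h3 := (measurePreserving_cellRep.map_eq ▸
    integral_map measurable_cellRep.aemeasurable (f := fun x => conj (f x) * g x)
    (measurePreserving_cellRep.map_eq.symm ▸
      ((Complex.continuous_conj.comp_aestronglyMeasurable hf.1).mul hg.1)) :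
    ∫ x in unitCell, conj (f x) * g x = ∫ y, conj (f (cellRep y)) * g (cellRep y))
  rw [h3]
  refine integral_congr_ae ?_
  filter_upwards [hf', hg'] with y h1 h2
  exact (congrArg₂ (fun a b => conj a * b) h1 h2).symm

/-! ### Tiling of the plane and periodization -/

theorem iUnion_translate_unitCell :
    ⋃ n : CellIndex, (fun x => x + ofIndex n) ⁻¹' unitCell = univ := by
  refine eq_univ_of_forall fun x => mem_iUnion.mpr ⟨fun i => 1 - ⌈x i⌉, fun i => ?_⟩
  have h1 := Int.le_ceil (x i)
  have h2 := Int.ceil_lt_add_one (x i)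
  simp only [ofIndex, Pi.add_apply, Pi.zero_apply, mem_Ioc]
  push_cast
  constructor <;> linarith

theorem pairwise_disjoint_translate_unitCell :
    Pairwise (Function.onFun Disjoint
      fun n : CellIndex => (fun x => x + ofIndex n) ⁻¹' unitCell) := by
  intro n m hnm
  refine Set.disjoint_left.mpr fun x hx hy => hnm (funext fun i => ?_)
  have h1 := hx i
  have h2 := hy i
  simp only [ofIndex, Pi.add_apply, Pi.zero_apply, mem_Ioc] at h1 h2
  have h3 : (n i : ℝ) < m i + 1 := by linarith [h1.2, h2.1]
  have h4 : (m i : ℝ) < n i + 1 := by linarith [h1.1, h2.2]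
  have h5 : n i < m i + 1 := by exact_mod_cast h3
  have h6 : m i < n i + 1 := by exact_mod_cast h4
  omega

theorem measurableSet_translate_unitCell (n : CellIndex) :
    MeasurableSet ((fun x => x + ofIndex n) ⁻¹' unitCell) :=
  measurable_add_const _ measurableSet_unitCell

theorem lintegral_eq_tsum_unitCell (G : Coord → ℝ≥0∞) :
    ∫⁻ x, G x = ∑' n : CellIndex, ∫⁻ x in unitCell, G (x + ofIndex n) := by
  rw [← setLIntegral_univ, ← iUnion_translate_unitCell,
    lintegral_iUnion measurableSet_translate_unitCell pairwise_disjoint_translate_unitCell,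
    -- The preimage of the cell under x ↦ x + n is the cell translated by -n, whence the change of
    -- sign of the index.
    ← (Equiv.neg CellIndex).tsum_eq]
  refine tsum_congr fun n => ?_
  have h : ∀ x, x + ofIndex n + ofIndex (-n) = x := by
    intro x; ext i; simp [ofIndex]
  have := (measurePreserving_add_right (volume : Measure Coord)
    (ofIndex n)).setLIntegral_comp_preimage_emb (measurableEmbedding_addRight _) G
    ((fun x => x + ofIndex (-n)) ⁻¹' unitCell)
  simp only [Equiv.neg_apply]
  rw [← this, ← preimage_comp]
  simp only [Function.comp_def, h]
  rfl

/-- The periodization of a function on the plane. -/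
def periodize (F : Coord → ℂ) (x : Coord) : ℂ := ∑' n : CellIndex, F (x + ofIndex n)

theorem aestronglyMeasurable_translate {F : Coord → ℂ} (hF : AEStronglyMeasurable F) (v : Coord) :
    AEStronglyMeasurable (fun x => F (x + v)) :=
  hF.comp_measurePreserving (measurePreserving_add_right (volume : Measure Coord) v)

theorem lintegral_unitCell_tsum {F : Coord → ℂ} (hF : AEStronglyMeasurable F) :
    ∫⁻ x in unitCell, ∑' n : CellIndex, ‖F (x + ofIndex n)‖ₑ = ∫⁻ x, ‖F x‖ₑ := by
  rw [lintegral_eq_tsum_unitCell, lintegral_tsum]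
  exact fun n => (aestronglyMeasurable_translate hF _).enorm.restrict

theorem integral_unitCell_periodize {F : Coord → ℂ} (hF : Integrable F) :
    ∫ x in unitCell, periodize F x = ∫ x, F x := by
  have h0 := lintegral_unitCell_tsum hF.1
  have h1 : ∑' n : CellIndex, ∫⁻ x in unitCell, ‖F (x + ofIndex n)‖ₑ ≠ ∞ := by
    rw [← lintegral_eq_tsum_unitCell (fun x => ‖F x‖ₑ)]
    exact hF.2.ne
  unfold periodize
  rw [integral_tsum (fun n => (aestronglyMeasurable_translate hF.1 _).restrict) h1,
    ← setIntegral_univ (f := F), ← iUnion_translate_unitCell,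
    integral_iUnion measurableSet_translate_unitCell pairwise_disjoint_translate_unitCell
      hF.integrableOn, ← (Equiv.neg CellIndex).tsum_eq]
  refine tsum_congr fun n => ?_
  have h : ∀ x, x + ofIndex n + ofIndex (-n) = x := by
    intro x; ext i; simp [ofIndex]
  have := (measurePreserving_add_right (volume : Measure Coord)
    (ofIndex n)).setIntegral_preimage_emb (measurableEmbedding_addRight _)
      (fun x => F (x + ofIndex (-n))) unitCell
  simp only [Equiv.neg_apply]
  simp only [h] at this
  rw [this]

/-! ### Weighted Cauchy-Schwarz and square integrability of periodizations -/

/-- Hölder for the counting measure, after writing G = a^{1/2} · (a^{-1/2} G). It serves twice: for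
periodizations and for the sum over reciprocal lattice vectors. -/
theorem tsum_sq_le {ι : Type*} (a G : ι → ℝ≥0∞) (h0 : ∀ i, a i ≠ 0) (ht : ∀ i, a i ≠ ∞) :
    (∑' i, G i) ^ 2 ≤ (∑' i, a i) * ∑' i, (a i)⁻¹ * G i ^ 2 := by
  let _ : MeasurableSpace ι := ⊤
  have h := ENNReal.lintegral_mul_le_Lp_mul_Lq (Measure.count : Measure ι)
    Real.HolderConjugate.two_two (f := fun i => a i ^ (1 / 2 : ℝ))
    (g := fun i => (a i)⁻¹ ^ (1 / 2 : ℝ) * G i) measurable_from_top.aemeasurable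
      measurable_from_top.aemeasurable
  simp only [lintegral_count, Pi.mul_apply] at h
  have e1 : ∀ i, a i ^ (1 / 2 : ℝ) * ((a i)⁻¹ ^ (1 / 2 : ℝ) * G i) = G i := by
    intro i
    rw [← mul_assoc, ← ENNReal.mul_rpow_of_nonneg _ _ (by norm_num),
      ENNReal.mul_inv_cancel (h0 i) (ht i), ENNReal.one_rpow, one_mul]
  have e2 : ∀ i, (a i ^ (1 / 2 : ℝ)) ^ (2 : ℝ) = a i := by
    intro i; rw [← ENNReal.rpow_mul]; norm_num
  have e3 : ∀ i, ((a i)⁻¹ ^ (1 / 2 : ℝ) * G i) ^ (2 : ℝ) = (a i)⁻¹ * G i ^ 2 := by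
    intro i
    rw [ENNReal.mul_rpow_of_nonneg _ _ (by norm_num), ← ENNReal.rpow_mul]
    norm_num
  simp only [e1, e2, e3] at h
  calc (∑' i, G i) ^ 2 ≤ _ := pow_le_pow_left' h 2
    _ = _ := by
      rw [mul_pow, ← ENNReal.rpow_natCast, ← ENNReal.rpow_mul, ← ENNReal.rpow_natCast,
        ← ENNReal.rpow_mul]
      norm_num

/-- The summable sequence `1 / ((1 + n₁²) (1 + n₂²))`. -/
def decay (n : CellIndex) : ℝ := ((1 + (n 0 : ℝ) ^ 2) * (1 + (n 1 : ℝ) ^ 2))⁻¹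

theorem decay_pos (n : CellIndex) : 0 < decay n := by unfold decay; positivity

theorem summable_inv_one_add_sq : Summable fun n : ℤ => (1 + (n : ℝ) ^ 2)⁻¹ := by
  have h : Summable fun n : ℤ => 1 / (n : ℝ) ^ 2 := Real.summable_one_div_int_pow.mpr one_lt_two
  refine Summable.of_norm_bounded_eventually h ?_
  rw [Filter.eventually_cofinite]
  refine (Set.finite_singleton (0 : ℤ)).subset fun n hn => ?_
  by_contra h0
  have : (0 : ℝ) < (n : ℝ) ^ 2 := by
    have : (n : ℝ) ≠ 0 := by exact_mod_cast h0
    positivity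
  refine hn ?_
  rw [Real.norm_of_nonneg (by positivity), ← one_div]
  exact one_div_le_one_div_of_le this (by linarith)

theorem summable_decay : Summable decay := by
  have h := summable_inv_one_add_sq.mul_of_nonneg summable_inv_one_add_sq
    (fun _ => by positivity) (fun _ => by positivity)
  rw [← (finTwoArrowEquiv ℤ).summable_iff] at h
  refine h.congr fun n => ?_
  simp [decay, mul_comm]

/-- The sum of `decay`, as an extended nonnegative real. -/
def decaySum : ℝ≥0∞ := ∑' n, ENNReal.ofReal (decay n)

theorem decaySum_ne_top : decaySum ≠ ∞ := summable_decay.tsum_ofReal_ne_top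

/-- The weight `(1 + x₁²) (1 + x₂²)`. -/
def weight (x : Coord) : ℝ := (1 + x 0 ^ 2) * (1 + x 1 ^ 2)

theorem weight_pos (x : Coord) : 0 < weight x := by unfold weight; positivity

theorem continuous_weight : Continuous weight := by unfold weight; fun_prop

theorem inv_weight_le {x : Coord} (hx : x ∈ unitCell) (n : CellIndex) :
    (weight (x + ofIndex n))⁻¹ ≤ 9 * decay n := by
  -- As 0 < x ≤ 1, n² ≤ 2(x + n)² + 2; the product of the two coordinates gives the constant 9.
  have key : ∀ i, 1 + (n i : ℝ) ^ 2 ≤ 3 * (1 + (x i + n i) ^ 2) := by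
    intro i
    have h := hx i
    simp only [Pi.zero_apply, mem_Ioc] at h
    nlinarith [sq_nonneg (2 * x i + n i), sq_nonneg (x i + n i)]
  have h2 : (1 + (n 0 : ℝ) ^ 2) * (1 + (n 1 : ℝ) ^ 2) ≤ 9 * weight (x + ofIndex n) := by
    have := mul_le_mul (key 0) (key 1) (by positivity) (by positivity)
    simp only [weight, ofIndex, Pi.add_apply]
    linarith
  rw [decay, ← div_eq_mul_inv, ← inv_div]
  refine inv_anti₀ (by positivity) ?_
  rw [div_le_iff₀ (by norm_num)]
  linarith

theorem tsum_sq_le_weight {x : Coord} (hx : x ∈ unitCell) (G : CellIndex → ℝ≥0∞) :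
    (∑' n, G n) ^ 2 ≤
      (9 * decaySum) * ∑' n, ENNReal.ofReal (weight (x + ofIndex n)) * G n ^ 2 := by
  refine (tsum_sq_le (fun n => (ENNReal.ofReal (weight (x + ofIndex n)))⁻¹) G
    (fun n => by simp) (fun n => by simp [weight_pos])).trans ?_
  simp only [inv_inv]
  gcongr
  rw [decaySum, ← ENNReal.tsum_mul_left]
  refine ENNReal.tsum_le_tsum fun n => ?_
  rw [← ENNReal.ofReal_inv_of_pos (weight_pos _), show (9 : ℝ≥0∞) = ENNReal.ofReal 9 by simp,
    ← ENNReal.ofReal_mul (by norm_num)]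
  exact ENNReal.ofReal_le_ofReal (inv_weight_le hx n)

theorem volume_unitCell : volume unitCell = 1 := by
  have : unitCell = Set.pi univ fun _ : Fin 2 => Ioc (0 : ℝ) 1 := by
    ext x; simp [unitCell]
  rw [this, Real.volume_pi_Ioc]
  simp

/-- The reciprocal weights are summable over the translates of a point, uniformly in the cell, so
Cauchy-Schwarz followed by unfolding the cell integral controls even the sum of absolute values. -/
theorem lintegral_tsum_sq_le {F : Coord → ℂ} (hF : AEStronglyMeasurable F) :
    ∫⁻ x in unitCell, (∑' n : CellIndex, ‖F (x + ofIndex n)‖ₑ) ^ 2 ≤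
      (9 * decaySum) * ∫⁻ x, ENNReal.ofReal (weight x) * ‖F x‖ₑ ^ 2 := by
  have hm : ∀ n : CellIndex, AEMeasurable
      (fun x => ENNReal.ofReal (weight (x + ofIndex n)) * ‖F (x + ofIndex n)‖ₑ ^ 2) volume :=
    fun n => ((continuous_weight.measurable.comp (measurable_add_const _)).ennreal_ofReal.aemeasurable.mul
      ((aestronglyMeasurable_translate hF _).enorm.pow_const 2))
  rw [lintegral_eq_tsum_unitCell, ← lintegral_tsum fun n => (hm n).restrict,
    ← lintegral_const_mul'' _ (AEMeasurable.tsum fun n => (hm n).restrict)]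
  exact setLIntegral_mono' measurableSet_unitCell fun x hx => tsum_sq_le_weight hx _

/-- A measurable function on the plane with finite weighted `L²` norm. -/
structure WeightedL2 (F : Coord → ℂ) : Prop where
  aestronglyMeasurable : AEStronglyMeasurable F
  lt_top : ∫⁻ x, ENNReal.ofReal (weight x) * ‖F x‖ₑ ^ 2 < ∞

theorem WeightedL2.lintegral_tsum_sq_lt_top {F : Coord → ℂ} (hF : WeightedL2 F) :
    ∫⁻ x in unitCell, (∑' n : CellIndex, ‖F (x + ofIndex n)‖ₑ) ^ 2 < ∞ :=
  (lintegral_tsum_sq_le hF.1).trans_lt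
    (ENNReal.mul_lt_top (ENNReal.mul_lt_top (by simp) decaySum_ne_top.lt_top) hF.2)

theorem lintegral_mul_unitCell_le {f g : Coord → ℝ≥0∞}
    (hf : AEMeasurable f (volume.restrict unitCell)) (hg : AEMeasurable g (volume.restrict unitCell))
    (hf2 : ∫⁻ x in unitCell, f x ^ 2 < ∞) (hg2 : ∫⁻ x in unitCell, g x ^ 2 < ∞) :
    ∫⁻ x in unitCell, f x * g x < ∞ := by
  refine (ENNReal.lintegral_mul_le_Lp_mul_Lq _ Real.HolderConjugate.two_two hf hg).trans_lt ?_
  refine ENNReal.mul_lt_top ?_ ?_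
  · exact ENNReal.rpow_lt_top_of_nonneg (by norm_num) (by simpa using hf2.ne)
  · exact ENNReal.rpow_lt_top_of_nonneg (by norm_num) (by simpa using hg2.ne)

theorem aemeasurable_tsum_enorm {F : Coord → ℂ} (hF : AEStronglyMeasurable F) :
    AEMeasurable (fun x => ∑' n : CellIndex, ‖F (x + ofIndex n)‖ₑ) (volume.restrict unitCell) :=
  AEMeasurable.tsum fun _ => (aestronglyMeasurable_translate hF _).enorm.restrict

theorem WeightedL2.integrable {F : Coord → ℂ} (hF : WeightedL2 F) : Integrable F := by
  refine ⟨hF.1, ?_⟩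
  rw [HasFiniteIntegral, ← lintegral_unitCell_tsum hF.1]
  have := lintegral_mul_unitCell_le (aemeasurable_tsum_enorm hF.1) (g := fun _ => 1)
    aemeasurable_const hF.lintegral_tsum_sq_lt_top (by simp [volume_unitCell])
  simpa using this

/-- For a translation-invariant property, countably many translates of the null set in the cell
cover all exceptions. -/
theorem ae_of_ae_unitCell {p : Coord → Prop} (hp : ∀ x (n : CellIndex), p (x + ofIndex n) → p x)
    (h : ∀ᵐ x ∂(volume.restrict unitCell), p x) : ∀ᵐ x, p x := by
  rw [← Measure.restrict_univ (μ := volume), ← iUnion_translate_unitCell,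
    ae_restrict_iUnion_iff]
  intro n
  have := ((measurePreserving_add_right (volume : Measure Coord) (ofIndex n)).restrict_preimage
    measurableSet_unitCell).quasiMeasurePreserving.ae h
  filter_upwards [this] with x hx using hp x n hx

theorem add_ofIndex_add (x : Coord) (n k : CellIndex) :
    x + ofIndex n + ofIndex k = x + ofIndex (n + k) := by
  ext i; simp [ofIndex, add_assoc]

theorem tsum_translate {α : Type*} [AddCommMonoid α] [TopologicalSpace α] (G : Coord → α)
    (x : Coord) (k : CellIndex) :
    ∑' n : CellIndex, G (x + ofIndex k + ofIndex n) = ∑' n : CellIndex, G (x + ofIndex n) := by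
  simp only [add_ofIndex_add]
  exact (Equiv.addLeft k).tsum_eq (fun n => G (x + ofIndex n))

theorem periodize_add (F : Coord → ℂ) (x : Coord) (k : CellIndex) :
    periodize F (x + ofIndex k) = periodize F x := tsum_translate F x k

theorem WeightedL2.ae_tsum_lt_top {F : Coord → ℂ} (hF : WeightedL2 F) :
    ∀ᵐ x, ∑' n : CellIndex, ‖F (x + ofIndex n)‖ₑ < ∞ := by
  refine ae_of_ae_unitCell (fun x n h => ?_) (ae_lt_top' (aemeasurable_tsum_enorm hF.1) ?_)
  · rwa [tsum_translate (fun x => ‖F x‖ₑ)] at h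
  · rw [lintegral_unitCell_tsum hF.1]
    exact hF.integrable.2.ne

theorem WeightedL2.ae_summable {F : Coord → ℂ} (hF : WeightedL2 F) :
    ∀ᵐ x, Summable fun n : CellIndex => ‖F (x + ofIndex n)‖ := by
  filter_upwards [hF.ae_tsum_lt_top] with x hx
  have := ENNReal.summable_toReal hx.ne
  simpa using this

theorem enorm_periodize_le (F : Coord → ℂ) (x : Coord) :
    ‖periodize F x‖ₑ ≤ ∑' n : CellIndex, ‖F (x + ofIndex n)‖ₑ := enorm_tsum_le_tsum_enorm

theorem WeightedL2.aestronglyMeasurable_periodize {F : Coord → ℂ} (hF : WeightedL2 F) :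
    AEStronglyMeasurable (periodize F) := by
  refine aestronglyMeasurable_of_tendsto_ae (Filter.atTop : Filter (Finset CellIndex))
    (f := fun s x => ∑ n ∈ s, F (x + ofIndex n)) (fun s => ?_) ?_
  · exact Finset.aestronglyMeasurable_fun_sum s
      fun n _ => aestronglyMeasurable_translate hF.1 _
  · filter_upwards [hF.ae_summable] with x hx
    exact hx.of_norm.hasSum

theorem WeightedL2.memLp_periodize {F : Coord → ℂ} (hF : WeightedL2 F) :
    MemLp (periodize F) 2 (volume.restrict unitCell) := by
  refine ⟨hF.aestronglyMeasurable_periodize.restrict, ?_⟩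
  rw [eLpNorm_lt_top_iff_lintegral_rpow_enorm_lt_top (by simp) (by simp)]
  refine lt_of_le_of_lt (lintegral_mono fun x => ?_) hF.lintegral_tsum_sq_lt_top
  simp only [ENNReal.toReal_ofNat, ENNReal.rpow_ofNat]
  gcongr
  exact enorm_periodize_le F x

/-! ### Fourier coefficients of periodizations and Poisson summation -/

theorem norm_phase (x : ℝ) : ‖phase x‖ = 1 := by
  rw [phase, mul_comm, Complex.norm_exp_ofReal_mul_I]

theorem enorm_phase (x : ℝ) : ‖phase x‖ₑ = 1 := by
  rw [← ofReal_norm, norm_phase, ENNReal.ofReal_one]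

theorem phase_add (x y : ℝ) : phase (x + y) = phase x * phase y := by
  rw [phase, phase, phase, ← Complex.exp_add]; push_cast; ring_nf

theorem conj_phase (x : ℝ) : conj (phase x) = phase (-x) := by
  simp [phase, ← Complex.exp_conj]

theorem continuous_phase : Continuous phase := by unfold phase; fun_prop

theorem phase_int_mul_two_pi (n : ℤ) : phase (2 * Real.pi * n) = 1 := by
  rw [phase, Complex.exp_eq_one_iff]
  exact ⟨n, by push_cast; ring⟩

/-- The Fourier coefficient `∫ e^{2π i m·x} F(x) dx`. -/
def planeCoeff (F : Coord → ℂ) (m : CellIndex) : ℂ :=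
  ∫ x : Coord, phase (2 * Real.pi * ∑ i, m i * x i) * F x

theorem cellCoeff_periodize {F : Coord → ℂ} (hF : Integrable F) (m : CellIndex) :
    cellCoeff (periodize F) m = planeCoeff F m := by
  have hm : AEStronglyMeasurable (fun x : Coord => phase (2 * Real.pi * ∑ i, m i * x i)) :=
    Continuous.aestronglyMeasurable (continuous_phase.comp (by fun_prop))
  rw [planeCoeff, ← integral_unitCell_periodize
    (hF.bdd_mul (c := 1) hm (Filter.Eventually.of_forall fun x => (norm_phase _).le)), cellCoeff]
  congr 1
  funext x
  rw [periodize, periodize, ← tsum_mul_left]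
  refine tsum_congr fun n => ?_
  congr 1
  have : 2 * Real.pi * ∑ i, m i * (x + ofIndex n) i
      = 2 * Real.pi * ∑ i, m i * x i + 2 * Real.pi * ((∑ i, m i * n i : ℤ) : ℝ) := by
    simp only [ofIndex, Pi.add_apply]
    push_cast
    rw [← mul_add, ← Finset.sum_add_distrib]
    congr 1
    exact Finset.sum_congr rfl fun i _ => by ring
  rw [this, phase_add, phase_int_mul_two_pi, mul_one]

theorem cellCoeff_conj (f : Coord → ℂ) (m : CellIndex) :
    cellCoeff (fun x => conj (f x)) m = conj (cellCoeff f (-m)) := by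
  rw [cellCoeff, cellCoeff, ← integral_conj]
  congr 1
  funext x
  rw [map_mul, conj_phase]
  simp only [Pi.neg_apply, Int.cast_neg, neg_mul, Finset.sum_neg_distrib, mul_neg, neg_neg]

theorem decaySum_ne_zero : decaySum ≠ 0 := by
  intro h
  have := ENNReal.tsum_eq_zero.mp h 0
  rw [ENNReal.ofReal_eq_zero] at this
  exact absurd (decay_pos 0) (not_lt.mpr this)

/-- Parseval for the periodization, whose Fourier coefficients are the integrals over the whole
plane. If the weighted norm is infinite the bound is trivial, so measurability is the only
requirement. -/
theorem tsum_planeCoeff_sq_le {F : Coord → ℂ} (hF : AEStronglyMeasurable F) :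
    ∑' m, ‖planeCoeff F m‖ₑ ^ 2 ≤
      (9 * decaySum) * ∫⁻ x, ENNReal.ofReal (weight x) * ‖F x‖ₑ ^ 2 := by
  by_cases h : ∫⁻ x, ENNReal.ofReal (weight x) * ‖F x‖ₑ ^ 2 < ∞
  swap
  · rw [not_lt_top_iff.mp h, ENNReal.mul_top (mul_ne_zero (by simp) decaySum_ne_zero)]
    exact le_top
  have hW : WeightedL2 F := ⟨hF, h⟩
  have hL := hW.memLp_periodize
  have hs := hasSum_cellCoeff_mul hL hL
  simp only [cellCoeff_periodize hW.integrable, RCLike.conj_mul] at hs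
  have hs2 : HasSum (fun m => ‖planeCoeff F m‖ ^ 2) (∫ x in unitCell, ‖periodize F x‖ ^ 2) := by
    have : (∫ x in unitCell, ((‖periodize F x‖ : ℂ) ^ 2))
        = ((∫ x in unitCell, ‖periodize F x‖ ^ 2 : ℝ) : ℂ) := by
      rw [← integral_complex_ofReal]; simp
    rw [← Complex.hasSum_ofReal]
    push_cast
    rw [← this]
    exact hs
  have e1 : ∀ m, ‖planeCoeff F m‖ₑ ^ 2 = ENNReal.ofReal (‖planeCoeff F m‖ ^ 2) := by
    intro m; rw [ENNReal.ofReal_pow (norm_nonneg _), ofReal_norm]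
  simp only [e1]
  rw [← ENNReal.ofReal_tsum_of_nonneg (fun _ => by positivity) hs2.summable, hs2.tsum_eq,
    ofReal_integral_eq_lintegral_ofReal hL.norm.integrable_sq
      (Filter.Eventually.of_forall fun x => by positivity)]
  refine le_trans (lintegral_mono fun x => ?_) (lintegral_tsum_sq_le hF)
  rw [ENNReal.ofReal_pow (norm_nonneg _), ofReal_norm]
  gcongr
  exact enorm_periodize_le F x

/-- Poisson summation, in the form of Parseval's identity for the periodizations. -/
theorem exists_hasSum_planeCoeff_mul {P Q : Coord → ℂ} (hP : WeightedL2 P) (hQ : WeightedL2 Q) :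
    ∃ S : ℂ, HasSum (fun m => planeCoeff P (-m) * planeCoeff Q m) S ∧
      HasSum (fun n : CellIndex => ∫ x, P (x + ofIndex n) * Q x) S := by
  refine ⟨∫ x in unitCell, periodize P x * periodize Q x, ?_, ?_⟩
  -- Conjugating P makes Parseval's sesquilinear identity bilinear; this is the origin of the index
  -- -m on P.
  · have hPc : MemLp (fun x => conj (periodize P x)) 2 (volume.restrict unitCell) :=
      hP.memLp_periodize.star
    have h := hasSum_cellCoeff_mul hPc hQ.memLp_periodize
    simpa only [cellCoeff_conj, Complex.conj_conj, cellCoeff_periodize hP.integrable,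
      cellCoeff_periodize hQ.integrable] using h
  have hfin : ∫⁻ x, (∑' n : CellIndex, ‖P (x + ofIndex n)‖ₑ) * ‖Q x‖ₑ < ∞ := by
    have h1 := lintegral_mul_unitCell_le (aemeasurable_tsum_enorm hP.1)
      (aemeasurable_tsum_enorm hQ.1) hP.lintegral_tsum_sq_lt_top hQ.lintegral_tsum_sq_lt_top
    refine lt_of_le_of_lt (le_of_eq ?_) h1
    rw [lintegral_eq_tsum_unitCell, ← lintegral_tsum]
    · simp only [tsum_translate (fun x => ‖P x‖ₑ), ENNReal.tsum_mul_left]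
    · intro n
      simp only [tsum_translate (fun x => ‖P x‖ₑ)]
      exact (aemeasurable_tsum_enorm hP.1).mul
        (aestronglyMeasurable_translate hQ.1 _).enorm.restrict
  have hmeas : ∀ n : CellIndex, AEStronglyMeasurable (fun x => P (x + ofIndex n) * Q x) :=
    fun n => (aestronglyMeasurable_translate hP.1 _).mul hQ.1
  have hfin2 : ∑' n : CellIndex, ∫⁻ x, ‖P (x + ofIndex n) * Q x‖ₑ < ∞ := by
    rw [← lintegral_tsum fun n => (hmeas n).enorm]
    simpa only [enorm_mul, ENNReal.tsum_mul_right] using hfin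
  have hint : Integrable fun x => periodize P x * Q x := by
    refine ⟨hP.aestronglyMeasurable_periodize.mul hQ.1, lt_of_le_of_lt ?_ hfin⟩
    refine lintegral_mono fun x => ?_
    rw [enorm_mul]
    gcongr
    exact enorm_periodize_le P x
  -- Only Q is unfolded: the periodization of P is invariant under integer translations and passes
  -- through the sum.
  have e1 : ∫ x in unitCell, periodize P x * periodize Q x = ∫ x, periodize P x * Q x := by
    rw [← integral_unitCell_periodize hint]
    congr 1
    funext x
    simp only [periodize, ← tsum_mul_left]
    refine tsum_congr fun n => ?_
    exact congrArg (· * _) (periodize_add P x n).symm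
  have e2 : ∫ x, periodize P x * Q x = ∫ x, ∑' n : CellIndex, P (x + ofIndex n) * Q x := by
    simp only [periodize, tsum_mul_right]
  rw [e1, e2, integral_tsum hmeas hfin2.ne]
  refine Summable.hasSum (Summable.of_norm ?_)
  refine Summable.of_nonneg_of_le (fun _ => norm_nonneg _) (fun n => ?_)
    (ENNReal.summable_toReal hfin2.ne)
  have hn : ∫⁻ x, ‖P (x + ofIndex n) * Q x‖ₑ ≠ ∞ := ENNReal.ne_top_of_tsum_ne_top hfin2.ne n
  rw [← toReal_enorm]
  exact ENNReal.toReal_mono hn (enorm_integral_le_lintegral_enorm _)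

/-! ### Geometry of the layers, dual coordinates and sampling on a lattice -/

theorem inner_plane (u v : Plane) : inner ℝ u v = u 0 * v 0 + u 1 * v 1 := by
  simp [PiLp.inner_apply, Fin.sum_univ_two, mul_comm]

theorem norm_sq_plane (u : Plane) : ‖u‖ ^ 2 = u 0 ^ 2 + u 1 ^ 2 := by
  rw [← real_inner_self_eq_norm_sq, inner_plane]; ring

theorem rot_apply_zero (ζ : ℝ) (v : Plane) :
    rot ζ v 0 = Real.cos ζ * v 0 - Real.sin ζ * v 1 := rfl

theorem rot_apply_one (ζ : ℝ) (v : Plane) :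
    rot ζ v 1 = Real.sin ζ * v 0 + Real.cos ζ * v 1 := rfl

theorem inner_rot_rot (ζ : ℝ) (u v : Plane) : inner ℝ (rot ζ u) (rot ζ v) = inner ℝ u v := by
  simp only [inner_plane, rot_apply_zero, rot_apply_one]
  linear_combination (u 0 * v 0 + u 1 * v 1) * Real.sin_sq_add_cos_sq ζ

theorem norm_rot (ζ : ℝ) (u : Plane) : ‖rot ζ u‖ = ‖u‖ := by
  rw [@norm_eq_sqrt_real_inner _ _ _ (rot ζ u), inner_rot_rot, ← norm_eq_sqrt_real_inner]

theorem rot_add (ζ : ℝ) (u v : Plane) : rot ζ (u + v) = rot ζ u + rot ζ v := by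
  ext j; fin_cases j <;> simp [rot] <;> ring

theorem rot_smul (ζ c : ℝ) (u : Plane) : rot ζ (c • u) = c • rot ζ u := by
  ext j; fin_cases j <;> simp [rot] <;> ring

theorem inner_layerRot (θ : ℝ) (i : Fin 2) (u v : Plane) :
    inner ℝ (layerRot θ i u) (layerRot θ i v) = inner ℝ u v := inner_rot_rot _ u v

theorem norm_layerRot (θ : ℝ) (i : Fin 2) (u : Plane) : ‖layerRot θ i u‖ = ‖u‖ := norm_rot _ u

theorem layerRot_add (θ : ℝ) (i : Fin 2) (u v : Plane) :
    layerRot θ i (u + v) = layerRot θ i u + layerRot θ i v := rot_add _ u v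

theorem layerRot_smul (θ : ℝ) (i : Fin 2) (c : ℝ) (u : Plane) :
    layerRot θ i (c • u) = c • layerRot θ i u := rot_smul _ c u

theorem inner_recipVec_latticeVec (j k : Fin 2) :
    inner ℝ (recipVec j) (latticeVec k) = if j = k then 2 * Real.pi else 0 := by
  have h3 : Real.sqrt 3 ≠ 0 := by positivity
  fin_cases j <;> fin_cases k <;> simp [inner_plane, recipVec, latticeVec] <;> field_simp <;> ring

theorem norm_latticeVec (j : Fin 2) : ‖latticeVec j‖ = 1 := by
  have h : ‖latticeVec j‖ ^ 2 = 1 := by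
    rw [norm_sq_plane]
    have h3 := Real.sq_sqrt (show (0 : ℝ) ≤ 3 by norm_num)
    fin_cases j <;> simp [latticeVec, div_pow, h3] <;> norm_num
  nlinarith [norm_nonneg (latticeVec j)]

/-- Coordinates of the momentum `γ η` dual to the lattice of layer `i`. -/
def freq (γ θ : ℝ) (i : Fin 2) (η : Plane) : Coord :=
  fun j => γ * inner ℝ (layerRot θ i (latticeVec j)) η

/-- The inverse of `freq`. -/
def invFreq (γ θ : ℝ) (i : Fin 2) (x : Coord) : Plane :=
  (γ⁻¹ * (2 * Real.pi)⁻¹) • (x 0 • layerRecip θ i 0 + x 1 • layerRecip θ i 1)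

theorem inner_layerRecip_layerRot (θ : ℝ) (i j k : Fin 2) :
    inner ℝ (layerRecip θ i j) (layerRot θ i (latticeVec k)) = if j = k then 2 * Real.pi else 0 := by
  rw [layerRecip, inner_layerRot, inner_recipVec_latticeVec]

theorem freq_invFreq {γ : ℝ} (hγ : γ ≠ 0) (θ : ℝ) (i : Fin 2) (x : Coord) :
    freq γ θ i (invFreq γ θ i x) = x := by
  funext j
  have := Real.pi_ne_zero
  rw [freq, real_inner_comm, invFreq, inner_smul_left, inner_add_left, inner_smul_left,
    inner_smul_left, inner_layerRecip_layerRot, inner_layerRecip_layerRot]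
  fin_cases j <;> simp <;> field_simp

theorem freq_add (γ θ : ℝ) (i : Fin 2) (u v : Plane) :
    freq γ θ i (u + v) = freq γ θ i u + freq γ θ i v := by
  funext j; simp [freq, inner_add_right, mul_add]

theorem freq_smul (γ θ : ℝ) (i : Fin 2) (c : ℝ) (u : Plane) :
    freq γ θ i (c • u) = c • freq γ θ i u := by
  funext j; simp [freq, inner_smul_right]; ring

/-- `freq` as a linear equivalence. -/
def freqEquiv {γ : ℝ} (hγ : γ ≠ 0) (θ : ℝ) (i : Fin 2) : Plane ≃ₗ[ℝ] Coord :=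
  LinearEquiv.ofBijective
    ({ toFun := freq γ θ i, map_add' := freq_add γ θ i, map_smul' := freq_smul γ θ i } :
      Plane →ₗ[ℝ] Coord) (by
    have hs : Function.Surjective
        ({ toFun := freq γ θ i, map_add' := freq_add γ θ i, map_smul' := freq_smul γ θ i } :
          Plane →ₗ[ℝ] Coord) := fun x => ⟨invFreq γ θ i x, freq_invFreq hγ θ i x⟩
    exact ⟨(LinearMap.injective_iff_surjective_of_finrank_eq_finrank (by simp)).mpr hs, hs⟩)

theorem invFreq_freq {γ : ℝ} (hγ : γ ≠ 0) (θ : ℝ) (i : Fin 2) (η : Plane) :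
    invFreq γ θ i (freq γ θ i η) = η :=
  (freqEquiv hγ θ i).injective (freq_invFreq hγ θ i _)

theorem measurableEmbedding_freq {γ : ℝ} (hγ : γ ≠ 0) (θ : ℝ) (i : Fin 2) :
    MeasurableEmbedding (freq γ θ i) :=
  (freqEquiv hγ θ i).toContinuousLinearEquiv.toHomeomorph.measurableEmbedding

theorem continuous_invFreq (γ θ : ℝ) (i : Fin 2) : Continuous (invFreq γ θ i) := by
  unfold invFreq; fun_prop

/-- The determinant is γ² times the area √3/2 of a cell, whatever the rotation. -/
theorem map_freq_volume {γ : ℝ} (hγ : γ ≠ 0) (θ : ℝ) (i : Fin 2) :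
    (volume : Measure Plane).map (freq γ θ i) = ENNReal.ofReal (2 / (Real.sqrt 3 * γ ^ 2)) • volume := by
  let M : Matrix (Fin 2) (Fin 2) ℝ :=
    Matrix.of fun j k => γ * layerRot θ i (latticeVec j) k
  have hM : M.det = γ ^ 2 * (Real.sqrt 3 / 2) := by
    rw [Matrix.det_fin_two]
    simp only [M, Matrix.of_apply, layerRot, rot_apply_zero, rot_apply_one, latticeVec]
    simp
    linear_combination (γ ^ 2 * (Real.sqrt 3 / 2)) * Real.sin_sq_add_cos_sq (layerSign i * (θ / 2))
  have h3 : (0 : ℝ) < Real.sqrt 3 := by positivity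
  have hM0 : M.det ≠ 0 := by rw [hM]; positivity
  have hf : freq γ θ i = Matrix.toLin' M ∘ (WithLp.ofLp : Plane → Coord) := by
    funext η j
    simp [freq, inner_plane, M, Matrix.mulVec, dotProduct, Fin.sum_univ_two]
    ring
  rw [hf, ← Measure.map_map (by fun_prop) (PiLp.volume_preserving_ofLp (Fin 2)).measurable,
    (PiLp.volume_preserving_ofLp (Fin 2)).map_eq, Real.map_matrix_volume_pi_eq_smul_volume_pi hM0, hM]
  congr 2
  rw [abs_of_nonneg (by positivity)]
  field_simp

theorem lintegral_freq {γ : ℝ} (hγ : γ ≠ 0) (θ : ℝ) (i : Fin 2) (F : Plane → ℝ≥0∞) :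
    ∫⁻ η, F η = ENNReal.ofReal (2 / (Real.sqrt 3 * γ ^ 2)) * ∫⁻ x, F (invFreq γ θ i x) := by
  have h := (measurableEmbedding_freq hγ θ i).lintegral_map (μ := volume)
    (fun x => F (invFreq γ θ i x))
  rw [map_freq_volume hγ, lintegral_smul_measure] at h
  simp only [invFreq_freq hγ] at h
  rw [← h, smul_eq_mul]

theorem integral_freq {γ : ℝ} (hγ : γ ≠ 0) (θ : ℝ) (i : Fin 2) (F : Plane → ℂ) :
    ∫ η, F η = ((2 / (Real.sqrt 3 * γ ^ 2) : ℝ) : ℂ) * ∫ x, F (invFreq γ θ i x) := by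
  have h := (measurableEmbedding_freq hγ θ i).integral_map (μ := volume)
    (fun x => F (invFreq γ θ i x))
  rw [map_freq_volume hγ, integral_smul_measure] at h
  simp only [invFreq_freq hγ] at h
  rw [← h, ENNReal.toReal_ofReal (by positivity), Complex.real_smul]

theorem aestronglyMeasurable_comp_invFreq {γ : ℝ} (hγ : γ ≠ 0) (θ : ℝ) (i : Fin 2) {F : Plane → ℂ}
    (hF : AEStronglyMeasurable F) : AEStronglyMeasurable fun x => F (invFreq γ θ i x) := by
  have h3 : (0 : ℝ) < Real.sqrt 3 := by positivity
  have h : AEStronglyMeasurable (fun x => F (invFreq γ θ i x))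
      ((volume : Measure Plane).map (freq γ θ i)) := by
    rw [(measurableEmbedding_freq hγ θ i).aestronglyMeasurable_map_iff]
    simpa only [Function.comp_def, invFreq_freq hγ] using hF
  rw [map_freq_volume hγ] at h
  refine h.mono_ac (Measure.absolutelyContinuous_smul ?_)
  rw [Ne, ENNReal.ofReal_eq_zero, not_le]
  positivity

/-- Lattice vectors have length one, so each dual coordinate is at most |γ||η|. The bound does not
involve γ, which makes the sampling estimate uniform up to its Jacobian. -/
theorem weight_freq_le {γ : ℝ} (hγ : |γ| ≤ 1) (θ : ℝ) (i : Fin 2) (η : Plane) :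
    weight (freq γ θ i η) ≤ (1 + (2 * Real.pi * ‖η‖) ^ 2) ^ 2 := by
  have key : ∀ j, 1 + freq γ θ i η j ^ 2 ≤ 1 + (2 * Real.pi * ‖η‖) ^ 2 := by
    intro j
    have h1 : |freq γ θ i η j| ≤ 2 * Real.pi * ‖η‖ := by
      rw [freq, abs_mul]
      have h2 := abs_real_inner_le_norm (layerRot θ i (latticeVec j)) η
      rw [norm_layerRot, norm_latticeVec, one_mul] at h2
      have h3 := mul_le_mul hγ h2 (abs_nonneg _) zero_le_one
      nlinarith [Real.pi_gt_three, norm_nonneg η]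
    rw [← sq_abs (freq γ θ i η j)]
    gcongr
  rw [weight, sq (1 + _)]
  exact mul_le_mul (key 0) (key 1) (by positivity) (by positivity)

/-- The Sobolev weight of order `s`, in the variable `η = ξ / 2π`. -/
def sobolevWeight (s : ℝ) (η : Plane) : ℝ≥0∞ :=
  ENNReal.ofReal ((1 + (2 * Real.pi * ‖η‖) ^ 2) ^ s)

theorem sitePos_eq (θ : ℝ) (d : Plane) (i σ : Fin 2) (m : ℤ × ℤ) :
    sitePos θ d i σ m = ((m.1 : ℝ) • layerRot θ i (latticeVec 0)
      + (m.2 : ℝ) • layerRot θ i (latticeVec 1)) + layerShift θ d i σ := rfl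

/-- In dual coordinates a plane wave at a site is an integer character of the cell index times a
phase independent of the cell: sampling a Fourier integral at the sites is taking `planeCoeff`. -/
theorem inner_sitePos {γ : ℝ} (hγ : γ ≠ 0) (θ : ℝ) (d : Plane) (i σ : Fin 2) (m : CellIndex)
    (x : Coord) :
    γ * inner ℝ (invFreq γ θ i x) (sitePos θ d i σ (finTwoArrowEquiv ℤ m))
      = ∑ j, m j * x j + γ * inner ℝ (invFreq γ θ i x) (layerShift θ d i σ) := by
  have h : ∀ j, γ * inner ℝ (invFreq γ θ i x) (layerRot θ i (latticeVec j)) = x j := by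
    intro j
    rw [real_inner_comm]
    exact congrFun (freq_invFreq hγ θ i x) j
  rw [sitePos_eq, inner_add_right, inner_add_right, inner_smul_right, inner_smul_right,
    Fin.sum_univ_two, ← h 0, ← h 1]
  simp [finTwoArrowEquiv]
  ring

/-- Uniform bound of the values of a Fourier integral on a lattice, by a Sobolev norm. -/
theorem tsum_fourier_sitePos_sq_le {γ : ℝ} (h0 : 0 < γ) (h1 : γ ≤ 1) (θ : ℝ) (d : Plane)
    (i σ : Fin 2) {F : Plane → ℂ} (hF : AEStronglyMeasurable F) :
    ∑' m, ‖∫ η, phase (2 * Real.pi * (γ * inner ℝ η (sitePos θ d i σ m))) * F η‖ₑ ^ 2 ≤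
      ENNReal.ofReal (2 / (Real.sqrt 3 * γ ^ 2)) * (9 * decaySum)
        * ∫⁻ η, sobolevWeight 2 η * ‖F η‖ₑ ^ 2 := by
  have h3 : (0 : ℝ) < Real.sqrt 3 := by positivity
  set J : ℝ := 2 / (Real.sqrt 3 * γ ^ 2) with hJ
  have hJ0 : 0 ≤ J := by positivity
  let G : Coord → ℂ := fun x =>
    phase (2 * Real.pi * (γ * inner ℝ (invFreq γ θ i x) (layerShift θ d i σ))) * F (invFreq γ θ i x)
  have hG : AEStronglyMeasurable G := by
    refine AEStronglyMeasurable.mul (Continuous.aestronglyMeasurable ?_)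
      (aestronglyMeasurable_comp_invFreq h0.ne' θ i hF)
    have := continuous_invFreq γ θ i
    exact continuous_phase.comp (by fun_prop)
  have e1 : ∀ m : CellIndex, ∫ η, phase (2 * Real.pi *
      (γ * inner ℝ η (sitePos θ d i σ (finTwoArrowEquiv ℤ m)))) * F η = (J : ℂ) * planeCoeff G m := by
    intro m
    rw [integral_freq h0.ne' θ i, planeCoeff]
    congr 2
    funext x
    rw [inner_sitePos h0.ne', mul_add, phase_add, mul_assoc]
  have e2 : ∫⁻ x, ENNReal.ofReal (weight x) * ‖G x‖ₑ ^ 2 * ENNReal.ofReal J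
      ≤ ∫⁻ η, sobolevWeight 2 η * ‖F η‖ₑ ^ 2 := by
    rw [lintegral_mul_const' _ _ ENNReal.ofReal_ne_top, lintegral_freq h0.ne' θ i, mul_comm]
    gcongr with x
    · rw [sobolevWeight]
      refine ENNReal.ofReal_le_ofReal ?_
      have := weight_freq_le (abs_le.mpr ⟨by linarith, h1⟩) θ i (invFreq γ θ i x)
      rw [freq_invFreq h0.ne'] at this
      exact_mod_cast this
    · simp [G, enorm_phase]
  rw [← (finTwoArrowEquiv ℤ).tsum_eq]
  simp only [e1, enorm_mul, mul_pow, ENNReal.tsum_mul_left]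
  have hJe : ‖(J : ℂ)‖ₑ = ‖J‖ₑ := by simp [← ofReal_norm]
  rw [hJe, ← Real.enorm_eq_ofReal hJ0]
  calc _ ≤ ‖J‖ₑ ^ 2 * ((9 * decaySum) * ∫⁻ x, ENNReal.ofReal (weight x) * ‖G x‖ₑ ^ 2) := by
        gcongr; exact tsum_planeCoeff_sq_le hG
    -- Of the two Jacobian factors, one is absorbed by the change of variables back to η and one
    -- remains in the bound.
    _ = ‖J‖ₑ * (9 * decaySum) *
        ∫⁻ x, ENNReal.ofReal (weight x) * ‖G x‖ₑ ^ 2 * ENNReal.ofReal J := by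
        rw [lintegral_mul_const' _ _ ENNReal.ofReal_ne_top, Real.enorm_eq_ofReal hJ0]; ring
    _ ≤ _ := by gcongr

/-! ### The hopping function and its Fourier transform -/

/-- One term of the exponential series at a(1 + t) already bounds the exponential from below. -/
theorem exp_neg_le_inv_pow {a t : ℝ} (ha : 0 < a) (ht : 0 ≤ t) (N : ℕ) :
    Real.exp (-(a * t)) ≤ Real.exp a * N.factorial / a ^ N * ((1 + t) ^ N)⁻¹ := by
  have h := Real.pow_div_factorial_le_exp (a * (1 + t)) (by positivity) N
  have h2 : Real.exp (-(a * t)) = Real.exp a * (Real.exp (a * (1 + t)))⁻¹ := by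
    rw [← Real.exp_neg, ← Real.exp_add]; ring_nf
  have h3 : (0 : ℝ) < N.factorial := by exact_mod_cast N.factorial_pos
  rw [h2, mul_div_assoc, mul_assoc]
  gcongr
  have h4 : (N.factorial : ℝ) / a ^ N * ((1 + t) ^ N)⁻¹ = ((a * (1 + t)) ^ N / N.factorial)⁻¹ := by
    rw [mul_pow, inv_div]
    field_simp
  rw [h4]
  exact inv_anti₀ (by positivity) h

theorem continuous_hop {hs : ℝ → ℝ} {l₀ l : ℝ} (hc : ContinuousOn hs (Ici l₀)) 
    (hl : l₀ ≤ l) : Continuous fun r : Plane => hop hs r l := by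
  refine hc.comp_continuous (by fun_prop) fun r => ?_
  refine hl.trans (Real.le_sqrt_of_sq_le ?_)
  nlinarith [sq_nonneg ‖r‖]

theorem fourier_hop (hs : ℝ → ℝ) (l : ℝ) (η : Plane) :
    𝓕 (fun r : Plane => ((hop hs r l : ℝ) : ℂ)) η = ((hHat hs ((2 * Real.pi) • η) l : ℝ) : ℂ) := by
  rw [ofReal_hHat, hopFourier, Real.fourier_eq']
  congr 1
  funext r
  rw [smul_eq_mul, phase, inner_smul_left, real_inner_comm]
  congr 2
  push_cast
  simp
  ring

theorem lintegral_weight_invFreq_lt_top {γ : ℝ} (hγ : γ ≠ 0) (θ : ℝ) (j : Fin 2) {F : Plane → ℂ}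
    (hF : ∫⁻ η, ENNReal.ofReal (weight (freq γ θ j η)) * ‖F η‖ₑ ^ 2 ≠ ∞) :
    ∫⁻ x, ENNReal.ofReal (weight x) * ‖F (invFreq γ θ j x)‖ₑ ^ 2 < ∞ := by
  have h3 : (0 : ℝ) < Real.sqrt 3 := by positivity
  rw [lintegral_freq hγ θ j] at hF
  simp only [freq_invFreq hγ] at hF
  refine ENNReal.lt_top_of_mul_ne_top_right hF ?_
  rw [Ne, ENNReal.ofReal_eq_zero, not_le]
  positivity

section Hopping

variable {hs : ℝ → ℝ} {C₁ C₂ C₃ D₁ D₂ l₀ : ℝ}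

theorem HoppingAssumption.continuous_hHat (hh : HoppingAssumption hs C₁ C₂ C₃ D₁ D₂ l₀) {l : ℝ}
    (hl : l₀ ≤ l) : Continuous fun ξ => hHat hs ξ l := by
  have h1 : Continuous (𝓕 (fun r : Plane => ((hop hs r l : ℝ) : ℂ))) :=
    VectorFourier.fourierIntegral_continuous Real.continuous_fourierChar
      (by exact continuous_inner) (hh.integrable l hl).ofReal
  have h2 : (fun ξ => hHat hs ξ l)
      = fun ξ => (𝓕 (fun r : Plane => ((hop hs r l : ℝ) : ℂ)) ((2 * Real.pi)⁻¹ • ξ)).re := by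
    funext ξ
    rw [fourier_hop, Complex.ofReal_re, smul_inv_smul₀ (by positivity)]
  rw [h2]
  exact Complex.continuous_re.comp (h1.comp (by fun_prop))

/-- A qualitative bound: K depends on ℓ and q, and serves only to make integrals finite, never in
the final estimate. -/
theorem HoppingAssumption.abs_hHat_add_le (hh : HoppingAssumption hs C₁ C₂ C₃ D₁ D₂ l₀) {l : ℝ}
    (hl : l₀ ≤ l) (q : Plane) (N : ℕ) : ∃ K : ℝ, 0 ≤ K ∧ ∀ η : Plane,
      |hHat hs (q + (2 * Real.pi) • η) l| ≤ K * ((1 + 2 * Real.pi * ‖η‖) ^ N)⁻¹ := by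
  have ha : 0 < D₂ * l := mul_pos hh.D₂_pos (hh.l₀_pos.trans_le hl)
  have hC := hh.C₂_pos
  refine ⟨C₂ * Real.exp (D₂ * l * ‖q‖) * (Real.exp (D₂ * l) * N.factorial / (D₂ * l) ^ N),
    by positivity, fun η => (hh.upper l hl _).trans ?_⟩
  have h1 := exp_neg_le_inv_pow ha (t := 2 * Real.pi * ‖η‖) (by positivity) N
  have h2 : 2 * Real.pi * ‖η‖ ≤ ‖q + (2 * Real.pi) • η‖ + ‖q‖ := by
    have := norm_sub_le (q + (2 * Real.pi) • η) q
    rw [add_sub_cancel_left, norm_smul, Real.norm_of_nonneg (by positivity)] at this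
    exact this
  rw [mul_assoc C₂, mul_assoc C₂]
  refine mul_le_mul_of_nonneg_left ?_ hC.le
  calc _ ≤ Real.exp (D₂ * l * ‖q‖ + -(D₂ * l * (2 * Real.pi * ‖η‖))) := by
        rw [Real.exp_le_exp]; nlinarith
    _ ≤ _ := by rw [Real.exp_add, mul_assoc (Real.exp (D₂ * l * ‖q‖))]; gcongr

theorem integrable_inv_one_add_pow {N : ℕ} (hN : 2 < N) :
    Integrable fun η : Plane => ((1 + 2 * Real.pi * ‖η‖) ^ N)⁻¹ := by
  have h := integrable_one_add_norm (E := Plane) (μ := volume) (r := N)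
    (by rw [finrank_euclideanSpace_fin]; exact_mod_cast hN)
  refine h.mono' (Continuous.aestronglyMeasurable ?_) (Filter.Eventually.of_forall fun η => ?_)
  · refine Continuous.inv₀ (by fun_prop) fun η => ?_
    have := Real.pi_pos
    positivity
  · have := Real.pi_gt_three
    rw [Real.rpow_neg (by positivity), Real.rpow_natCast, Real.norm_of_nonneg (by positivity)]
    refine inv_anti₀ (by positivity) (pow_le_pow_left₀ (by positivity) ?_ _)
    nlinarith [norm_nonneg η]

theorem HoppingAssumption.integrable_hHat (hh : HoppingAssumption hs C₁ C₂ C₃ D₁ D₂ l₀) {l : ℝ}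
    (hl : l₀ ≤ l) : Integrable fun η : Plane => ((hHat hs ((2 * Real.pi) • η) l : ℝ) : ℂ) := by
  obtain ⟨K, -, hK⟩ := hh.abs_hHat_add_le hl 0 3
  refine ((integrable_inv_one_add_pow (N := 3) (by norm_num)).const_mul K).mono'
    (Continuous.aestronglyMeasurable ?_) (Filter.Eventually.of_forall fun η => ?_)
  · exact Complex.continuous_ofReal.comp ((hh.continuous_hHat hl).comp (by fun_prop))
  · have := hK η
    rwa [zero_add, ← Real.norm_eq_abs, ← Complex.norm_real] at this

/-- Fourier inversion for the hopping function, with a shift of the momentum variable. -/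
theorem HoppingAssumption.hop_eq_integral (hh : HoppingAssumption hs C₁ C₂ C₃ D₁ D₂ l₀) {l : ℝ}
    (hl : l₀ ≤ l) (q r : Plane) : ((hop hs r l : ℝ) : ℂ) = phase (inner ℝ q r) *
      ∫ η : Plane, phase (2 * Real.pi * inner ℝ η r) * ((hHat hs (q + (2 * Real.pi) • η) l : ℝ) : ℂ) := by
  have hc := continuous_hop hh.continuousOn hl
  have h1 := Continuous.fourierInv_fourier_eq (f := fun r : Plane => ((hop hs r l : ℝ) : ℂ))
    (Complex.continuous_ofReal.comp hc) (hh.integrable l hl).ofReal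
    (by simpa only [funext (fourier_hop hs l)] using hh.integrable_hHat hl)
  have h2 := congrFun h1 r
  rw [funext (fourier_hop hs l), Real.fourierInv_eq'] at h2
  rw [← h2, ← integral_add_right_eq_self _ ((2 * Real.pi)⁻¹ • q), ← integral_const_mul]
  congr 1
  funext η
  rw [smul_eq_mul, ← mul_assoc, ← phase_add, phase, smul_add, smul_inv_smul₀ (by positivity),
    add_comm q]
  congr 2
  rw [inner_add_left, inner_smul_left, mul_add]
  simp
  have : (Real.pi : ℂ) ≠ 0 := by exact_mod_cast Real.pi_ne_zero
  field_simp
  ring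

theorem HoppingAssumption.weightedL2_hHat (hh : HoppingAssumption hs C₁ C₂ C₃ D₁ D₂ l₀) {l : ℝ}
    (hl : l₀ ≤ l) (q v : Plane) (θ : ℝ) (j : Fin 2) :
    WeightedL2 fun x => phase (2 * Real.pi * inner ℝ (invFreq 1 θ j x) v)
      * ((hHat hs (q + (2 * Real.pi) • invFreq 1 θ j x) l : ℝ) : ℂ) := by
  have hm : Continuous fun η : Plane => phase (2 * Real.pi * inner ℝ η v)
      * ((hHat hs (q + (2 * Real.pi) • η) l : ℝ) : ℂ) :=
    (continuous_phase.comp (by fun_prop)).mul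
      (Complex.continuous_ofReal.comp ((hh.continuous_hHat hl).comp (by fun_prop)))
  refine ⟨(hm.comp (continuous_invFreq 1 θ j)).aestronglyMeasurable, ?_⟩
  obtain ⟨K, hK0, hK⟩ := hh.abs_hHat_add_le hl q 4
  refine lintegral_weight_invFreq_lt_top one_ne_zero θ j (F := fun η => phase (2 * Real.pi *
    inner ℝ η v) * ((hHat hs (q + (2 * Real.pi) • η) l : ℝ) : ℂ)) ?_
  have hint := (integrable_inv_one_add_pow (N := 4) (by norm_num)).const_mul (K ^ 2)
  refine ne_top_of_le_ne_top hint.2.ne (lintegral_mono fun η => ?_)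
  rw [enorm_mul, enorm_phase, one_mul]
  have e : ‖((hHat hs (q + (2 * Real.pi) • η) l : ℝ) : ℂ)‖ₑ
      = ENNReal.ofReal |hHat hs (q + (2 * Real.pi) • η) l| := by
    rw [← ofReal_norm, Complex.norm_real, Real.norm_eq_abs]
  rw [e, ← ENNReal.ofReal_pow (abs_nonneg _), ← ENNReal.ofReal_mul (weight_pos _).le,
    Real.enorm_eq_ofReal (by positivity)]
  refine ENNReal.ofReal_le_ofReal ?_
  have hw := weight_freq_le (γ := 1) (by simp) θ j η
  set t := 2 * Real.pi * ‖η‖ with ht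
  have ht0 : 0 ≤ t := by positivity
  calc weight (freq 1 θ j η) * |hHat hs (q + (2 * Real.pi) • η) l| ^ 2
      ≤ (1 + t) ^ 4 * (K * ((1 + t) ^ 4)⁻¹) ^ 2 := by
        gcongr
        · refine hw.trans ?_
          rw [show (1 + t) ^ 4 = ((1 + t) ^ 2) ^ 2 by ring]
          gcongr
          nlinarith
        · exact hK η
    _ = K ^ 2 * ((1 + t) ^ 4)⁻¹ := by field_simp

end Hopping

/-! ### Poisson summation for the interlayer coupling -/

/-- The reciprocal lattice vector `n₁ b_{j,1} + n₂ b_{j,2}` of layer `j`. -/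
def layerRecipSum (θ : ℝ) (j : Fin 2) (n : CellIndex) : Plane :=
  (n 0 : ℝ) • layerRecip θ j 0 + (n 1 : ℝ) • layerRecip θ j 1

/-- The hopping function uses dual coordinates at scale 1 and the envelope at scale γ. On common
coordinates, an integer shift is a reciprocal lattice vector in the argument of ĥ, while η is scaled
by γ. -/
theorem two_pi_invFreq_add (γ θ : ℝ) (hγ : γ ≠ 0) (j : Fin 2) (η : Plane) (n : CellIndex) :
    (2 * Real.pi) • invFreq 1 θ j (freq γ θ j η + ofIndex n)
      = (2 * Real.pi * γ) • η + layerRecipSum θ j n := by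
  have h : invFreq 1 θ j (freq γ θ j η) = γ • η := by
    conv_rhs => rw [← invFreq_freq hγ θ j η]
    simp only [invFreq, smul_smul]
    congr 1
    field_simp
  have h2 : invFreq 1 θ j (freq γ θ j η + ofIndex n) = invFreq 1 θ j (freq γ θ j η)
      + (2 * Real.pi)⁻¹ • layerRecipSum θ j n := by
    simp only [invFreq, layerRecipSum, ofIndex, Pi.add_apply]
    module
  rw [h2, h, smul_add, smul_inv_smul₀ (by positivity), smul_smul]

theorem weightedL2_of_sobolev {γ : ℝ} (h0 : 0 < γ) (h1 : γ ≤ 1) (θ : ℝ) (v : Plane)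
    (j : Fin 2) {U : Plane → ℂ} (hU : AEStronglyMeasurable U)
    (hU2 : ∫⁻ η, sobolevWeight 2 η * ‖U η‖ₑ ^ 2 < ∞) :
    WeightedL2 fun x => phase (2 * Real.pi * (γ * inner ℝ (invFreq γ θ j x) v))
      * U (invFreq γ θ j x) := by
  have hc := continuous_invFreq γ θ j
  refine ⟨AEStronglyMeasurable.mul (continuous_phase.comp (by fun_prop)).aestronglyMeasurable
    (aestronglyMeasurable_comp_invFreq h0.ne' θ j hU), ?_⟩
  refine lintegral_weight_invFreq_lt_top h0.ne' θ j (F := fun η => phase (2 * Real.pi *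
    (γ * inner ℝ η v)) * U η) ?_
  refine ne_top_of_le_ne_top hU2.ne (lintegral_mono fun η => ?_)
  rw [enorm_mul, enorm_phase, one_mul, sobolevWeight]
  gcongr
  exact_mod_cast weight_freq_le (abs_le.mpr ⟨by linarith, h1⟩) θ j η

/-- Poisson summation for the interlayer coupling of a wave packet with momentum `q`. -/
theorem HoppingAssumption.exists_hasSum_hop {hs : ℝ → ℝ} {C₁ C₂ C₃ D₁ D₂ l₀ : ℝ}
    (hh : HoppingAssumption hs C₁ C₂ C₃ D₁ D₂ l₀) {l : ℝ} (hl : l₀ ≤ l)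
    {γ : ℝ} (h0 : 0 < γ) (h1 : γ ≤ 1) (θ : ℝ) (d : Plane) (j σ : Fin 2)
    {U : Plane → ℂ} (hU : AEStronglyMeasurable U)
    (hU2 : ∫⁻ η, sobolevWeight 2 η * ‖U η‖ₑ ^ 2 < ∞) (p q : Plane) :
    ∃ S : ℂ,
      HasSum (fun m => ((Real.sqrt 3 / 2 : ℝ) : ℂ)
        * (((hop hs (p - sitePos θ d j σ m) l : ℝ) : ℂ) * (phase (inner ℝ q (sitePos θ d j σ m))
          * ∫ η, phase (2 * Real.pi * (γ * inner ℝ η (sitePos θ d j σ m))) * U η))) S ∧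
      HasSum (fun n : CellIndex => phase (inner ℝ q p
          + inner ℝ (layerRecipSum θ j n) (p - layerShift θ d j σ))
        * ∫ η, phase (2 * Real.pi * (γ * inner ℝ η p)) *
          (((hHat hs (q + layerRecipSum θ j n + (2 * Real.pi * γ) • η) l : ℝ) : ℂ) * U η)) S := by
  have h3 : (0 : ℝ) < Real.sqrt 3 := by positivity
  have hP := hh.weightedL2_hHat hl q (p - layerShift θ d j σ) θ j
  have hQ := weightedL2_of_sobolev h0 h1 θ (layerShift θ d j σ) j hU hU2
  -- The coefficients of P are the hopping amplitudes from the sites to p, and those of Q the values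
  -- of the envelope at the sites, each up to phases and Jacobians.
  set P : Coord → ℂ := fun x => phase (2 * Real.pi * inner ℝ (invFreq 1 θ j x)
    (p - layerShift θ d j σ)) * ((hHat hs (q + (2 * Real.pi) • invFreq 1 θ j x) l : ℝ) : ℂ) with hPd
  set Q : Coord → ℂ := fun x => phase (2 * Real.pi * (γ * inner ℝ (invFreq γ θ j x)
    (layerShift θ d j σ))) * U (invFreq γ θ j x) with hQd
  obtain ⟨S, hS1, hS2⟩ := exists_hasSum_planeCoeff_mul hP hQ
  set J : ℂ := ((2 / (Real.sqrt 3 * γ ^ 2) : ℝ) : ℂ) with hJ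
  refine ⟨phase (inner ℝ q p) * J * S, ?_, ?_⟩
  · rw [← (finTwoArrowEquiv ℤ).hasSum_iff]
    refine (hS1.mul_left (phase (inner ℝ q p) * J)).congr_fun fun m => ?_
    have e1 : ((hop hs (p - sitePos θ d j σ (finTwoArrowEquiv ℤ m)) l : ℝ) : ℂ)
        = phase (inner ℝ q (p - sitePos θ d j σ (finTwoArrowEquiv ℤ m)))
          * (((2 / Real.sqrt 3 : ℝ) : ℂ) * planeCoeff P (-m)) := by
      rw [hh.hop_eq_integral hl q, integral_freq one_ne_zero θ j, planeCoeff]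
      simp only [one_pow, mul_one]
      congr 3
      funext x
      rw [hPd, ← mul_assoc, ← phase_add]
      congr 2
      have := inner_sitePos one_ne_zero θ d j σ m x
      simp only [one_mul] at this
      rw [inner_sub_right, inner_sub_right, this]
      simp
      ring
    have e2 : ∫ η, phase (2 * Real.pi * (γ * inner ℝ η (sitePos θ d j σ (finTwoArrowEquiv ℤ m))))
        * U η = J * planeCoeff Q m := by
      rw [integral_freq h0.ne' θ j, planeCoeff]
      congr 2
      funext x
      rw [hQd, inner_sitePos h0.ne', mul_add, phase_add, mul_assoc]
    have e3 : phase (inner ℝ q p) = phase (inner ℝ q (p - sitePos θ d j σ (finTwoArrowEquiv ℤ m)))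
        * phase (inner ℝ q (sitePos θ d j σ (finTwoArrowEquiv ℤ m))) := by
      rw [← phase_add, ← inner_add_right, sub_add_cancel]
    -- The prefactor √3/2 of the interlayer Hamiltonian is the cell area; it cancels the Jacobian of
    -- the hopping integral.
    have e4 : ((Real.sqrt 3 / 2 : ℝ) : ℂ) * ((2 / Real.sqrt 3 : ℝ) : ℂ) = 1 := by
      rw [← Complex.ofReal_mul]
      norm_cast
      field_simp
    simp only [Function.comp_apply]
    rw [e1, e2, e3]
    linear_combination (phase (inner ℝ q (p - sitePos θ d j σ (finTwoArrowEquiv ℤ m)))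
        * phase (inner ℝ q (sitePos θ d j σ (finTwoArrowEquiv ℤ m))) * J * planeCoeff P (-m)
        * planeCoeff Q m) * e4
  · refine (hS2.mul_left (phase (inner ℝ q p) * J)).congr_fun fun n => ?_
    have e1 := integral_freq h0.ne' θ j (fun η => P (freq γ θ j η + ofIndex n) * Q (freq γ θ j η))
    simp only [freq_invFreq h0.ne'] at e1
    rw [mul_assoc (phase (inner ℝ q p)), ← e1, phase_add, mul_assoc (phase (inner ℝ q p)), ← integral_const_mul]
    congr 2
    funext η
    have e2 : (2 * Real.pi) * inner ℝ (invFreq 1 θ j (freq γ θ j η + ofIndex n))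
        (p - layerShift θ d j σ) = 2 * Real.pi * γ * inner ℝ η (p - layerShift θ d j σ)
          + inner ℝ (layerRecipSum θ j n) (p - layerShift θ d j σ) := by
      have := congrArg (fun v => inner ℝ v (p - layerShift θ d j σ))
        (two_pi_invFreq_add γ θ h0.ne' j η n)
      simpa only [inner_smul_left, inner_add_left, RCLike.conj_to_real] using this
    have e3 : phase (2 * Real.pi * (γ * inner ℝ η p))
        = phase (2 * Real.pi * γ * inner ℝ η (p - layerShift θ d j σ))
          * phase (2 * Real.pi * (γ * inner ℝ η (layerShift θ d j σ))) := by
      rw [← phase_add, inner_sub_right]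
      ring_nf
    simp only [hPd, hQd]
    rw [e2, two_pi_invFreq_add γ θ h0.ne', invFreq_freq h0.ne', phase_add, e3,
      add_comm ((2 * Real.pi * γ) • η), ← add_assoc]
    ring

/-! ### Sobolev estimates and pointwise Fourier inversion -/

theorem sobolevWeight_two (η : Plane) :
    sobolevWeight 2 η = ENNReal.ofReal ((1 + (2 * Real.pi * ‖η‖) ^ 2) ^ 2) := by
  rw [sobolevWeight, ← Real.rpow_natCast]
  norm_num

theorem sobolevWeight_mono {s t : ℝ} (h : s ≤ t) (η : Plane) :
    sobolevWeight s η ≤ sobolevWeight t η :=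
  ENNReal.ofReal_le_ofReal (Real.rpow_le_rpow_of_exponent_le (by nlinarith [sq_nonneg (2 * Real.pi * ‖η‖)]) h)

theorem integrable_of_sobolev {F : Plane → ℂ} (hF : AEStronglyMeasurable F)
    (h : ∫⁻ η, sobolevWeight 2 η * ‖F η‖ₑ ^ 2 < ∞) : Integrable F := by
  refine ⟨hF, ?_⟩
  have hint := (integrable_inv_one_add_pow (N := 4) (by norm_num)).const_mul 4
  refine lt_of_le_of_lt (b := ∫⁻ η, ‖4 * ((1 + 2 * Real.pi * ‖η‖) ^ 4)⁻¹‖ₑ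
    + sobolevWeight 2 η * ‖F η‖ₑ ^ 2) (lintegral_mono fun η => ?_) ?_
  · rw [sobolevWeight_two, ← ofReal_norm (F η), ← ENNReal.ofReal_pow (norm_nonneg _),
      ← ENNReal.ofReal_mul (by positivity), Real.enorm_eq_ofReal (by positivity),
      ← ENNReal.ofReal_add (by positivity) (by positivity)]
    refine ENNReal.ofReal_le_ofReal ?_
    set t := 2 * Real.pi * ‖η‖ with ht
    have ht0 : 0 ≤ t := by positivity
    set w := (1 + t ^ 2) ^ 2 with hw
    have hw0 : 0 < w := by positivity
    have h1 : w⁻¹ ≤ 4 * ((1 + t) ^ 4)⁻¹ := by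
      rw [← div_eq_mul_inv, ← inv_div]
      refine inv_anti₀ (by positivity) ?_
      rw [div_le_iff₀ (by norm_num), hw, show (1 + t) ^ 4 = ((1 + t) ^ 2) ^ 2 by ring,
        show (1 + t ^ 2) ^ 2 * 4 = (2 * (1 + t ^ 2)) ^ 2 by ring]
      exact pow_le_pow_left₀ (by positivity) (by nlinarith [sq_nonneg (1 - t)]) 2
    -- The arithmetic-geometric mean inequality replaces Cauchy-Schwarz here, since only finiteness
    -- is wanted.
    have h2 : ‖F η‖ ≤ w⁻¹ + w * ‖F η‖ ^ 2 := by
      have h4 : w * w⁻¹ = 1 := mul_inv_cancel₀ hw0.ne'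
      have h5 : 0 < w⁻¹ := by positivity
      have : w⁻¹ + w * ‖F η‖ ^ 2 - ‖F η‖ = w * ((‖F η‖ - w⁻¹ / 2) ^ 2 + 3 / 4 * w⁻¹ ^ 2) := by
        field_simp
        ring
      have h6 : 0 ≤ w * ((‖F η‖ - w⁻¹ / 2) ^ 2 + 3 / 4 * w⁻¹ ^ 2) := by positivity
      linarith
    linarith
  · rw [lintegral_add_left' hint.1.enorm]
    exact ENNReal.add_lt_top.mpr ⟨hint.2, h⟩

/-- The multiplier enters squared: order 2 for the sampling plus order 4 for the symbol makes 6, and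
8 leaves room. -/
theorem lintegral_sobolev_mul_le {U M : Plane → ℂ} {K : ℝ}
    (hM : ∀ η, ‖M η‖ ≤ K * (1 + (2 * Real.pi * ‖η‖) ^ 2) ^ 2) :
    ∫⁻ η, sobolevWeight 2 η * ‖M η * U η‖ₑ ^ 2 ≤
      ENNReal.ofReal K ^ 2 * ∫⁻ η, sobolevWeight 8 η * ‖U η‖ₑ ^ 2 := by
  rw [← lintegral_const_mul' _ _ (by simp)]
  refine lintegral_mono fun η => ?_
  have hK : 0 ≤ K := by
    have := (norm_nonneg _).trans (hM 0)
    simpa using this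
  set w : ℝ := 1 + (2 * Real.pi * ‖η‖) ^ 2 with hw
  have hw1 : 1 ≤ w := by nlinarith [sq_nonneg (2 * Real.pi * ‖η‖)]
  have hw0 : 0 ≤ w := by linarith
  calc sobolevWeight 2 η * ‖M η * U η‖ₑ ^ 2
      ≤ ENNReal.ofReal (w ^ 2) * (ENNReal.ofReal (K * w ^ 2) * ‖U η‖ₑ) ^ 2 := by
        rw [sobolevWeight_two, enorm_mul, ← ofReal_norm (M η)]
        gcongr
        exact hM η
    _ = ENNReal.ofReal K ^ 2 * (ENNReal.ofReal (w ^ 6) * ‖U η‖ₑ ^ 2) := by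
        rw [ENNReal.ofReal_mul hK, mul_pow, mul_pow, ENNReal.ofReal_pow hw0, ENNReal.ofReal_pow hw0]
        ring
    _ ≤ _ := by
        gcongr
        rw [sobolevWeight, show (8 : ℝ) = ((8 : ℕ) : ℝ) by norm_num, Real.rpow_natCast]
        exact ENNReal.ofReal_le_ofReal (pow_le_pow_right₀ hw1 (by norm_num))

theorem fourierInv_eq_integral_phase (U : Plane → ℂ) (X : Plane) :
    𝓕⁻ U X = ∫ η, phase (2 * Real.pi * inner ℝ η X) * U η := by
  rw [Real.fourierInv_eq']
  congr 1
  funext η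
  rw [smul_eq_mul, phase]
  congr 2
  push_cast
  ring

theorem integral_schwartz_fourierInv (φ : SchwartzMap Plane ℂ) {U : Plane → ℂ} (hU : Integrable U) :
    ∫ η, (𝓕⁻ φ : SchwartzMap Plane ℂ) η • U η = ∫ X, φ X • 𝓕⁻ U X := by
  have h := VectorFourier.integral_fourierIntegral_smul_eq_flip (e := Real.fourierChar)
    (L := -innerₗ Plane) (μ := volume) (ν := volume) (f := φ) (g := U)
    Real.continuous_fourierChar (by simpa using! continuous_inner.neg) φ.integrable hU
  have hflip : (-innerₗ Plane).flip = -innerₗ Plane := by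
    ext x y; simp [real_inner_comm]
  rw [hflip] at h
  rw [SchwartzMap.fourierInv_coe]
  exact h

/-- Fourier inversion for an `L²` function with integrable Fourier transform. -/
theorem ae_eq_fourierInv (u : Lp ℂ 2 (volume : Measure Plane))
    (hU : Integrable ((𝓕 u : Lp ℂ 2 (volume : Measure Plane)) : Plane → ℂ)) :
    (u : Plane → ℂ) =ᵐ[volume] 𝓕⁻ ((𝓕 u : Lp ℂ 2 (volume : Measure Plane)) : Plane → ℂ) := by
  set U : Lp ℂ 2 (volume : Measure Plane) := 𝓕 u with hUd
  have hcont : Continuous (𝓕⁻ (U : Plane → ℂ)) :=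
    VectorFourier.fourierIntegral_continuous Real.continuous_fourierChar
      (by simpa using! continuous_inner.neg) hU
  have hu : LocallyIntegrable (u : Plane → ℂ) := (Lp.memLp u).locallyIntegrable (by norm_num)
  have key : ∀ φ : SchwartzMap Plane ℂ, ∫ X, φ X • u X = ∫ X, φ X • 𝓕⁻ (U : Plane → ℂ) X := by
    intro φ
    -- On L² the inverse transform agrees with the distributional one, and on an integrable U the
    -- latter is the integral by Fubini; testing against φ compares the two.
    have h1 := congrArg (fun T => T φ) (Lp.fourierInv_toTemperedDistribution_eq U)
    simp only [TemperedDistribution.fourierInv_apply, Lp.toTemperedDistribution_apply] at h1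
    rw [integral_schwartz_fourierInv φ hU, hUd, fourierInv_fourier_eq] at h1
    exact h1.symm
  have h0 := ae_eq_zero_of_integral_contDiff_smul_eq_zero
    (hu.sub hcont.locallyIntegrable) (fun g hg hgs => ?_)
  · filter_upwards [h0] with X hX using sub_eq_zero.mp hX
  have hgc : ContDiff ℝ (⊤ : ℕ∞) fun X => ((g X : ℝ) : ℂ) := Complex.ofRealCLM.contDiff.comp hg
  have hgcs : HasCompactSupport fun X => ((g X : ℝ) : ℂ) := hgs.comp_left Complex.ofReal_zero
  have h := key (hgcs.toSchwartzMap hgc)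
  have i1 : Integrable fun X => g X • u X :=
    hu.integrable_smul_left_of_hasCompactSupport hg.continuous hgs
  have i2 : Integrable fun X => g X • 𝓕⁻ (U : Plane → ℂ) X :=
    hcont.locallyIntegrable.integrable_smul_left_of_hasCompactSupport hg.continuous hgs
  simp only [Pi.sub_apply, smul_sub]
  rw [integral_sub i1 i2, sub_eq_zero]
  simpa using h

theorem partialDeriv_fourierInv {U : Plane → ℂ} (hU : Integrable U)
    (hU1 : Integrable fun η => ‖η‖ * ‖U η‖) (a : Fin 2) (X : Plane) :
    partialDeriv a (𝓕⁻ U) X = ∫ η, phase (2 * Real.pi * inner ℝ η X)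
      * (((2 * Real.pi * η a : ℝ) : ℂ) * Complex.I * U η) := by
  have h := VectorFourier.hasFDerivAt_fourierIntegral (-innerSL ℝ (E := Plane)) hU hU1 X
  have h2 : partialDeriv a (𝓕⁻ U) X = (VectorFourier.fourierIntegral Real.fourierChar volume
      (-innerSL ℝ (E := Plane)).toLinearMap₁₂
      (VectorFourier.fourierSMulRight (-innerSL ℝ (E := Plane)) U) X) (EuclideanSpace.single a 1) :=
    congrArg (fun T : Plane →L[ℝ] ℂ => T (EuclideanSpace.single a 1)) h.fderiv
  have hint : Integrable (VectorFourier.fourierSMulRight (-innerSL ℝ (E := Plane)) U) := by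
    refine (hU1.const_mul (2 * Real.pi * ‖-innerSL ℝ (E := Plane)‖)).mono'
      hU.1.fourierSMulRight (Filter.Eventually.of_forall fun η => ?_)
    rw [← mul_assoc]
    exact VectorFourier.norm_fourierSMulRight_le _ _ _
  rw [h2, Real.fourierIntegral_continuousLinearMap_apply' hint, ← fourierInv_eq_integral_phase]
  refine congrArg (fun F : Plane → ℂ => 𝓕⁻ F X) (funext fun η => ?_)
  have e : innerSL ℝ η (EuclideanSpace.single a (1 : ℝ)) = η a := by
    rw [innerSL_apply_apply]; simp [EuclideanSpace.inner_single_right]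
  rw [VectorFourier.fourierSMulRight_apply]
  simp [e]
  ring

/-- Fourier representation of a differentiable function in `H⁸`. -/
theorem exists_fourier_of_sobolevNorm_lt_top {u : Plane → ℂ} (hd : Differentiable ℝ u)
    (hu : sobolevNorm 8 u < ∞) :
    ∃ U : Plane → ℂ, AEStronglyMeasurable U ∧
      ∫⁻ η, sobolevWeight 8 η * ‖U η‖ₑ ^ 2 = sobolevNorm 8 u ^ 2 ∧
      (∀ X, u X = ∫ η, phase (2 * Real.pi * inner ℝ η X) * U η) ∧
      ∀ a X, partialDeriv a u X = ∫ η, phase (2 * Real.pi * inner ℝ η X)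
        * (((2 * Real.pi * η a : ℝ) : ℂ) * Complex.I * U η) := by
  have hm : MemLp u 2 volume := by
    by_contra h
    rw [sobolevNorm, dif_neg h] at hu
    exact lt_irrefl _ hu
  set U : Lp ℂ 2 (volume : Measure Plane) := 𝓕 (hm.toLp u) with hUd
  have hn : ∫⁻ η, sobolevWeight 8 η * ‖U η‖ₑ ^ 2 = sobolevNorm 8 u ^ 2 := by
    rw [sobolevNorm, dif_pos hm, ← ENNReal.rpow_natCast, ← ENNReal.rpow_mul]
    rw [show (1 / 2 : ℝ) * ((2 : ℕ) : ℝ) = 1 by norm_num, ENNReal.rpow_one]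
    rfl
  have hfin : ∫⁻ η, sobolevWeight 8 η * ‖U η‖ₑ ^ 2 < ∞ := by
    rw [hn]; exact ENNReal.pow_lt_top hu
  have hUm : AEStronglyMeasurable (U : Plane → ℂ) := Lp.aestronglyMeasurable U
  have hU : Integrable (U : Plane → ℂ) := integrable_of_sobolev hUm
    (lt_of_le_of_lt (lintegral_mono fun η => mul_le_mul_left (sobolevWeight_mono (by norm_num) η) _)
      hfin)
  have hU1 : Integrable fun η => ‖η‖ * ‖U η‖ := by
    have h : Integrable fun η => ((‖η‖ : ℝ) : ℂ) * U η := by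
      refine integrable_of_sobolev (AEStronglyMeasurable.mul
        (Continuous.aestronglyMeasurable (by fun_prop)) hUm) ?_
      refine lt_of_le_of_lt (lintegral_sobolev_mul_le (K := 1) fun η => ?_)
        (ENNReal.mul_lt_top (by simp) hfin)
      rw [Complex.norm_real, norm_norm]
      have h3 : ‖η‖ ≤ 2 * Real.pi * ‖η‖ := by
        nlinarith [Real.pi_gt_three, norm_nonneg η]
      nlinarith [sq_nonneg (2 * Real.pi * ‖η‖), sq_nonneg (2 * Real.pi * ‖η‖ - 1),
        sq_nonneg ((2 * Real.pi * ‖η‖) ^ 2)]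
    simpa using h.norm
  have hcont : Continuous (𝓕⁻ (U : Plane → ℂ)) :=
    VectorFourier.fourierIntegral_continuous Real.continuous_fourierChar
      (by simpa using! continuous_inner.neg) hU
  -- The sites form a null set, so equality almost everywhere would not do; continuity of both sides
  -- makes it hold everywhere.
  have heq : u = 𝓕⁻ (U : Plane → ℂ) :=
    (hd.continuous.ae_eq_iff_eq volume hcont).mp
      (hm.coeFn_toLp.symm.trans (ae_eq_fourierInv _ hU))
  refine ⟨U, hUm, hn, fun X => ?_, fun a X => ?_⟩
  · rw [← fourierInv_eq_integral_phase, ← heq]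
  · rw [heq, partialDeriv_fourierInv hU hU1]

/-! ### Momentum shells and the bound of the interlayer symbol -/

/-- The reflection exchanging two vectors of equal norm preserves both Lebesgue measure and the
radial hopping function. -/
theorem hHat_eq_of_norm_eq (hs : ℝ → ℝ) (l : ℝ) {ξ ξ' : Plane} (h : ‖ξ‖ = ‖ξ'‖) :
    hHat hs ξ l = hHat hs ξ' l := by
  have hr : (Submodule.reflection (ℝ ∙ (ξ - ξ'))ᗮ) ξ = ξ' := Submodule.reflection_sub h
  set R : Plane ≃ₗᵢ[ℝ] Plane := Submodule.reflection (ℝ ∙ (ξ - ξ'))ᗮ with hR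
  unfold hHat hopFourier
  congr 1
  rw [← R.measurePreserving.integral_comp R.toHomeomorph.measurableEmbedding
    (fun r => phase (-inner ℝ ξ' r) * ((hop hs r l : ℝ) : ℂ))]
  congr 1
  funext r
  rw [← hr, LinearIsometryEquiv.inner_map_map]
  simp [hop]

theorem norm_kappa : ‖kappa‖ = 4 * Real.pi / 3 := by
  have h : ‖kappa‖ ^ 2 = (4 * Real.pi / 3) ^ 2 := by
    rw [norm_sq_plane]; simp [kappa]
  exact (pow_left_inj₀ (norm_nonneg _) (by positivity) two_ne_zero).mp h

theorem four_le_norm_kappa : 4 ≤ ‖kappa‖ := by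
  rw [norm_kappa]; linarith [Real.pi_gt_three]

/-- Index of the shell of the momentum `κ + n₁ b₁ + n₂ b₂`. -/
def shell (n : CellIndex) : ℤ := n 0 ^ 2 + n 1 ^ 2 - n 0 * n 1 + n 0 - n 1

theorem layerRecipSum_eq (θ : ℝ) (j : Fin 2) (n : CellIndex) :
    layerRecipSum θ j n
      = layerRot θ j ((n 0 : ℝ) • recipVec 0 + (n 1 : ℝ) • recipVec 1) := by
  simp only [layerRecipSum, layerRecip, layerRot_add, layerRot_smul]

/-- The squared norms are quantized, so nothing lies strictly between |κ| and 2|κ|. This gap is what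
the hypothesis D₁/D₂ < 2 is matched to. -/
theorem norm_sq_kappa_add (θ : ℝ) (j : Fin 2) (n : CellIndex) :
    ‖layerKappa θ j + layerRecipSum θ j n‖ ^ 2 = ‖kappa‖ ^ 2 * (1 + 3 * (shell n : ℝ)) := by
  have h3 : Real.sqrt 3 ≠ 0 := by positivity
  have h33 := Real.sq_sqrt (show (0 : ℝ) ≤ 3 by norm_num)
  rw [layerKappa, layerRecipSum_eq, ← layerRot_add, norm_layerRot, norm_kappa, norm_sq_plane]
  simp [kappa, recipVec, shell]
  field_simp
  rw [h33]
  ring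

theorem two_mul_shell (n : CellIndex) :
    2 * (shell n : ℝ) + 1 = ((n 0 : ℝ) - n 1 + 1) ^ 2 + (n 0 : ℝ) ^ 2 + (n 1 : ℝ) ^ 2 := by
  simp only [shell]; push_cast; ring

theorem shell_nonneg (n : CellIndex) : 0 ≤ shell n := by
  have h := two_mul_shell n
  have h2 : (-1 : ℝ) ≤ 2 * (shell n : ℝ) := by
    nlinarith [sq_nonneg ((n 0 : ℝ) - n 1 + 1), sq_nonneg (n 0 : ℝ), sq_nonneg (n 1 : ℝ)]
  have h3 : -1 ≤ 2 * shell n := by exact_mod_cast h2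
  omega

/-- Lets the first-shell bounds carry the same factor `decay n` as the others. -/
theorem one_le_four_mul_decay {n : CellIndex} (hn : shell n = 0) : 1 ≤ 4 * decay n := by
  have h := two_mul_shell n
  rw [hn] at h
  have h0 := sq_nonneg ((n 0 : ℝ) - n 1 + 1)
  have h1 := sq_nonneg (n 0 : ℝ)
  have h2 := sq_nonneg (n 1 : ℝ)
  rw [decay, ← div_eq_mul_inv, le_div_iff₀ (by positivity)]
  push_cast at h
  nlinarith

theorem inv_norm_pow_le_decay (θ : ℝ) (j : Fin 2) {n : CellIndex} (hn : 1 ≤ shell n) :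
    (‖layerKappa θ j + layerRecipSum θ j n‖ ^ 4)⁻¹ ≤ decay n := by
  have h := two_mul_shell n
  have hN : (1 : ℝ) ≤ shell n := by exact_mod_cast hn
  refine inv_anti₀ (by positivity) ?_
  rw [show ‖layerKappa θ j + layerRecipSum θ j n‖ ^ 4
    = (‖layerKappa θ j + layerRecipSum θ j n‖ ^ 2) ^ 2 by ring, norm_sq_kappa_add]
  have h1 : 1 + (n 0 : ℝ) ^ 2 + (n 1 : ℝ) ^ 2 ≤ ‖kappa‖ ^ 2 * (1 + 3 * (shell n : ℝ)) := by
    have := four_le_norm_kappa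
    have h16 : 16 ≤ ‖kappa‖ ^ 2 := by nlinarith
    nlinarith [sq_nonneg ((n 0 : ℝ) - n 1 + 1)]
  refine le_trans ?_ (pow_le_pow_left₀ (by positivity) h1 2)
  nlinarith [sq_nonneg (n 0 : ℝ), sq_nonneg (n 1 : ℝ), mul_nonneg (sq_nonneg (n 0 : ℝ)) (sq_nonneg (n 1 : ℝ)),
    sq_nonneg ((n 0 : ℝ) ^ 2), sq_nonneg ((n 1 : ℝ) ^ 2)]

theorem two_kappa_le_norm (θ : ℝ) (j : Fin 2) {n : CellIndex} (hn : 1 ≤ shell n) :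
    2 * ‖kappa‖ ≤ ‖layerKappa θ j + layerRecipSum θ j n‖ := by
  refine (pow_le_pow_iff_left₀ (by positivity) (norm_nonneg _) two_ne_zero).mp ?_
  rw [norm_sq_kappa_add, mul_pow]
  have hN : (1 : ℝ) ≤ shell n := by exact_mod_cast hn
  nlinarith [sq_nonneg ‖kappa‖]

theorem norm_eq_kappa (θ : ℝ) (j : Fin 2) {n : CellIndex} (hn : shell n = 0) :
    ‖layerKappa θ j + layerRecipSum θ j n‖ = ‖kappa‖ := by
  have h := norm_sq_kappa_add θ j n
  rw [hn] at h
  refine (pow_left_inj₀ (norm_nonneg _) (norm_nonneg _) two_ne_zero).mp ?_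
  simpa using h

section Hopping

variable {hs : ℝ → ℝ} {C₁ C₂ C₃ D₁ D₂ l₀ : ℝ}

/-- Converts decay in ℓ into powers of γ: the lower bound at κ gives e^{-D₁ℓ|κ|} ≤ λ₀γ/C₁, and this
is raised to the power sD₂/D₁. -/
theorem HoppingAssumption.exp_le (hh : HoppingAssumption hs C₁ C₂ C₃ D₁ D₂ l₀) {l : ℝ}
    (hl : l₀ ≤ l) {lam₀ γ : ℝ} (hlam₀ : 0 < lam₀) (hγ : 0 < γ)
    (hk : hHat hs kappa l = lam₀ * γ) {s : ℝ} (hs0 : 0 ≤ s) :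
    Real.exp (-(D₂ * l * (s * ‖kappa‖)))
      ≤ (lam₀ / C₁) ^ (D₂ / D₁ * s) * γ ^ (D₂ / D₁ * s) := by
  have h1 := hh.lower l hl
  have hC := hh.C₁_pos
  have hD1 := hh.D₁_pos
  have hD2 := hh.D₂_pos
  rw [hk] at h1
  have h2 : Real.exp (-(D₁ * l * ‖kappa‖)) ≤ lam₀ / C₁ * γ := by
    rw [div_mul_eq_mul_div, le_div_iff₀ hC]
    linarith
  rw [← Real.mul_rpow (by positivity) hγ.le]
  refine le_trans (le_of_eq ?_) (Real.rpow_le_rpow (Real.exp_nonneg _) h2 (by positivity))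
  rw [← Real.exp_mul]
  congr 1
  field_simp

theorem HoppingAssumption.abs_hHat_le (hh : HoppingAssumption hs C₁ C₂ C₃ D₁ D₂ l₀) {l : ℝ}
    (hl : l₀ ≤ l) (ξ : Plane) : |hHat hs ξ l| ≤ C₂ := by
  refine (hh.upper l hl ξ).trans ?_
  have hD := hh.D₂_pos
  have hl0 := hh.l₀_pos.trans_le hl
  have := Real.exp_le_one_iff.mpr (neg_nonpos.mpr (show 0 ≤ D₂ * l * ‖ξ‖ by positivity))
  nlinarith [hh.C₂_pos]

theorem sub_le_infDist_segment {q v : Plane} : ‖q‖ - ‖v‖ ≤ Metric.infDist 0 (segment ℝ (q + v) q) := by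
  refine (Metric.le_infDist ⟨_, right_mem_segment ℝ (q + v) q⟩).mpr fun x hx => ?_
  obtain ⟨a, b, ha, hb, hab, rfl⟩ := hx
  rw [dist_zero_left]
  have e : a • (q + v) + b • q = q + a • v := by
    rw [smul_add, add_right_comm, ← add_smul, hab, one_smul]
  rw [e]
  have h1 := norm_sub_le (q + a • v) (a • v)
  rw [add_sub_cancel_right, norm_smul, Real.norm_of_nonneg ha] at h1
  nlinarith [norm_nonneg v]

/-- The rate of decay of the residual. -/
def rate (D₁ D₂ : ℝ) : ℝ := D₂ / D₁ - 1 / 2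

/-- Positivity is D₁/D₂ < 2; the upper bound is 1 ≤ D₁/D₂ and lets γ² and γ⁴ be absorbed into
γ^{1+c}. -/
theorem HoppingAssumption.ratio_bounds (hh : HoppingAssumption hs C₁ C₂ C₃ D₁ D₂ l₀) :
    0 < rate D₁ D₂ ∧ rate D₁ D₂ ≤ 1 / 2 := by
  have h1 := hh.one_le_ratio
  have h2 := hh.ratio_lt_two
  have hD1 := hh.D₁_pos
  have hD2 := hh.D₂_pos
  rw [le_div_iff₀ hD2] at h1
  rw [div_lt_iff₀ hD2] at h2
  constructor
  · rw [rate, sub_pos, lt_div_iff₀ hD1]; linarith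
  · rw [rate, sub_le_iff_le_add, div_le_iff₀ hD1]; linarith

set_option maxHeartbeats 1600000 in
/-- Bound of the part of the interlayer symbol that the continuum model neglects. -/
theorem HoppingAssumption.exists_symbol_bound (hh : HoppingAssumption hs C₁ C₂ C₃ D₁ D₂ l₀)
    {lam₀ : ℝ} (hlam₀ : 0 < lam₀) :
    ∃ K : ℝ, 0 ≤ K ∧ ∀ γ l θ : ℝ, 0 < γ → γ ≤ 1 → l₀ ≤ l → hHat hs kappa l = lam₀ * γ →
      ∀ (j : Fin 2) (n : CellIndex) (η : Plane),
        |hHat hs (layerKappa θ j + layerRecipSum θ j n + (2 * Real.pi * γ) • η) l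
          - (if shell n = 0 then lam₀ * γ else 0)|
        ≤ K * γ ^ (1 + rate D₁ D₂) * decay n * (1 + (2 * Real.pi * ‖η‖) ^ 2) ^ 2 := by
  obtain ⟨hc0, hc1⟩ := hh.ratio_bounds
  set c := rate D₁ D₂ with hc
  have hρ : D₂ / D₁ = c + 1 / 2 := by rw [hc, rate]; ring
  set ρ := D₂ / D₁ with hρd
  -- The far shells allow the exponent 2ρ = 1 + 2c. The margin δ will cost 4ρδ, and this choice
  -- makes the cost equal to c.
  set δ := c / (4 * ρ) with hδ
  have hρ0 : 0 < ρ := by linarith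
  have hδ0 : 0 < δ := by positivity
  have hρδ : ρ * δ = c / 4 := by rw [hδ]; field_simp
  have hδ1 : δ ≤ 1 / 4 := by
    rw [hδ, div_le_iff₀ (by positivity)]; linarith
  have hC1 := hh.C₁_pos
  have hC2 := hh.C₂_pos
  have hC3 := hh.C₃_pos
  have hD2 := hh.D₂_pos
  have hl0 := hh.l₀_pos
  -- With ℓ₀ in place of ℓ the constants are uniform in ℓ ≥ ℓ₀.
  set a := D₂ * l₀ * δ with ha
  have ha0 : 0 < a := by positivity
  set K₁ := C₂ * (lam₀ / C₁) ^ (1 + c) * (Real.exp a * (4).factorial / a ^ 4) with hK₁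
  set K₂ := 2 * C₂ * (δ ^ 4)⁻¹ with hK₂
  set K₃ := 4 * C₃ * (lam₀ / C₁) ^ (ρ * (1 - δ)) with hK₃
  have hK₁0 : 0 ≤ K₁ := by positivity
  have hK₂0 : 0 ≤ K₂ := by positivity
  have hK₃0 : 0 ≤ K₃ := by positivity
  refine ⟨K₁ + 4 * K₂ + K₃, by positivity, ?_⟩
  intro γ l θ hγ hγ1 hl hk j n η
  have hl1 : 0 < l := hl0.trans_le hl
  set q := layerKappa θ j + layerRecipSum θ j n with hq
  set v := (2 * Real.pi * γ) • η with hv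
  set t := 2 * Real.pi * ‖η‖ with ht
  have ht0 : 0 ≤ t := by positivity
  have hvn : ‖v‖ = γ * t := by
    rw [hv, norm_smul, Real.norm_of_nonneg (by positivity), ht]; ring
  have hdec := decay_pos n
  set g := γ ^ (1 + c) with hg
  have hg0 : 0 < g := by positivity
  have hγ4 : γ ^ 4 ≤ g := by
    rw [hg, ← Real.rpow_natCast]
    exact Real.rpow_le_rpow_of_exponent_ge hγ hγ1 (by push_cast; linarith)
  have ht4 : t ^ 4 ≤ (1 + t ^ 2) ^ 2 := by nlinarith [sq_nonneg t]
  have ht1 : t ≤ (1 + t ^ 2) ^ 2 := by nlinarith [sq_nonneg (t - 1), sq_nonneg (t ^ 2)]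
  have h1w : 1 ≤ (1 + t ^ 2) ^ 2 := by nlinarith [sq_nonneg t, sq_nonneg (t ^ 2)]
  set w := (1 + t ^ 2) ^ 2 with hw
  have hw0 : 0 < w := by linarith
  have hkap := four_le_norm_kappa
  -- When the envelope momentum v = γξ is comparable to q, the crude bound of ĥ by C₂ suffices: the
  -- fourth power of γ|ξ|/(δ|q|) exceeds 1 and supplies the smallness in γ as well as the decay in
  -- q.
  have large : δ * ‖q‖ < ‖v‖ → 0 < ‖q‖ → 1 ≤ (δ ^ 4)⁻¹ * (‖q‖ ^ 4)⁻¹ * (g * w) := by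
    intro h hq0
    have h1 : (δ * ‖q‖) ^ 4 ≤ g * w := by
      calc (δ * ‖q‖) ^ 4 ≤ (γ * t) ^ 4 := by
            rw [← hvn]; exact pow_le_pow_left₀ (by positivity) h.le 4
        _ = γ ^ 4 * t ^ 4 := by ring
        _ ≤ g * w := by gcongr
    rw [← mul_inv, ← mul_pow, ← div_eq_inv_mul, le_div_iff₀ (by positivity), one_mul]
    exact h1
  rcases (shell_nonneg n).eq_or_lt with hn | hn
  · have hn' := hn.symm
    have hqk : ‖q‖ = ‖kappa‖ := norm_eq_kappa θ j hn'
    have hd4 := one_le_four_mul_decay hn'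
    rw [if_pos hn', ← hk, ← hHat_eq_of_norm_eq hs l hqk]
    by_cases hs : ‖v‖ ≤ δ * ‖q‖
    · have h1 := hh.lipschitz l hl (q + v) q
      rw [add_sub_cancel_left] at h1
      have h2 := sub_le_infDist_segment (q := q) (v := v)
      have h3 : (1 - δ) * ‖kappa‖ ≤ Metric.infDist 0 (segment ℝ (q + v) q) := by
        rw [hqk] at h2 hs; linarith
      have h4 : Real.exp (-(D₂ * l * Metric.infDist 0 (segment ℝ (q + v) q)))
          ≤ (lam₀ / C₁) ^ (ρ * (1 - δ)) * γ ^ (ρ * (1 - δ)) := by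
        refine le_trans ?_ (hh.exp_le hl hlam₀ hγ hk (s := 1 - δ) (by linarith))
        rw [Real.exp_le_exp]
        have : 0 < D₂ * l := by positivity
        nlinarith
      -- The Lipschitz bound supplies the extra factor γ, and ρ(1 - δ) = c + 1/2 - c/4 is at least
      -- c.
      have h5 : γ ^ (ρ * (1 - δ)) * γ ≤ g := by
        rw [hg, add_comm, Real.rpow_add hγ, Real.rpow_one]
        gcongr ?_ * _
        refine Real.rpow_le_rpow_of_exponent_ge hγ hγ1 ?_
        have : ρ * (1 - δ) = ρ - c / 4 := by rw [mul_sub, hρδ, mul_one]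
        rw [this, hρ]; linarith
      calc _ ≤ _ := h1
        _ ≤ C₃ * ((lam₀ / C₁) ^ (ρ * (1 - δ)) * γ ^ (ρ * (1 - δ))) * (γ * t) := by
            rw [hvn]; gcongr
        _ = C₃ * (lam₀ / C₁) ^ (ρ * (1 - δ)) * (γ ^ (ρ * (1 - δ)) * γ) * 1 * t := by ring
        _ ≤ C₃ * (lam₀ / C₁) ^ (ρ * (1 - δ)) * g * (4 * decay n) * w := by gcongr
        _ = K₃ * g * decay n * w := by rw [hK₃]; ring
        _ ≤ _ := by gcongr; linarith
    · have h1 := large (not_le.mp hs) (by rw [hqk]; linarith)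
      have h2 : (‖q‖ ^ 4)⁻¹ ≤ 1 := inv_le_one_of_one_le₀ (one_le_pow₀ (by rw [hqk]; linarith))
      calc _ ≤ |hHat _ (q + v) l| + |hHat _ q l| := abs_sub _ _
        _ ≤ 2 * C₂ * 1 := by linarith [hh.abs_hHat_le hl (q + v), hh.abs_hHat_le hl q]
        _ ≤ 2 * C₂ * ((δ ^ 4)⁻¹ * 1 * (g * w)) * (4 * decay n) := by
            rw [mul_assoc (2 * C₂)]
            gcongr
            refine one_le_mul_of_one_le_of_one_le (h1.trans ?_) hd4
            gcongr
        _ = 4 * K₂ * g * decay n * w := by rw [hK₂]; ring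
        _ ≤ _ := by gcongr; linarith
  · have hn1 : 1 ≤ shell n := hn
    have hq2 := two_kappa_le_norm θ j hn1
    have hq4 := inv_norm_pow_le_decay θ j hn1
    rw [← hq] at hq2 hq4
    have hq0 : 0 < ‖q‖ := by linarith
    rw [if_neg hn.ne', sub_zero]
    by_cases hs : ‖v‖ ≤ δ * ‖q‖
    · have h1 := hh.upper l hl (q + v)
      -- Of |q + v| ≥ (1 - δ)|q|, the portion (1 - 2δ)|q| ≥ 2(1 - 2δ)|κ| yields the power of γ, and
      -- the remaining δ|q| yields summability over n.
      have h2 : 2 * (1 - 2 * δ) * ‖kappa‖ + δ * ‖q‖ ≤ ‖q + v‖ := by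
        have := norm_sub_le (q + v) v
        rw [add_sub_cancel_right] at this
        nlinarith
      have h3 : Real.exp (-(D₂ * l * ‖q + v‖)) ≤ Real.exp (-(D₂ * l * (2 * (1 - 2 * δ) * ‖kappa‖)))
          * Real.exp (-(a * ‖q‖)) := by
        rw [← Real.exp_add, Real.exp_le_exp, ha]
        have h4 : D₂ * l₀ ≤ D₂ * l := by gcongr
        have h5 : 0 ≤ δ * ‖q‖ := by positivity
        have h6 := mul_le_mul_of_nonneg_right h4 h5
        have h7 := mul_le_mul_of_nonneg_left h2 (show 0 ≤ D₂ * l by positivity)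
        nlinarith
      have h4 := hh.exp_le hl hlam₀ hγ hk (s := 2 * (1 - 2 * δ)) (by linarith)
      have h5 : ρ * (2 * (1 - 2 * δ)) = 1 + c := by
        have : ρ * (2 * (1 - 2 * δ)) = 2 * ρ - 4 * (ρ * δ) := by ring
        rw [this, hρδ, hρ]; ring
      rw [← hρd, h5] at h4
      have h6 := exp_neg_le_inv_pow ha0 hq0.le 4
      have h7 : ((1 + ‖q‖) ^ 4)⁻¹ ≤ decay n := by
        refine le_trans (inv_anti₀ (by positivity) ?_) hq4
        gcongr; linarith
      calc _ ≤ _ := h1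
        _ ≤ C₂ * (((lam₀ / C₁) ^ (1 + c) * g) * (Real.exp a * (4).factorial / a ^ 4 * decay n)) := by
            refine mul_le_mul_of_nonneg_left (h3.trans ?_) hC2.le
            refine mul_le_mul h4 (h6.trans ?_) (Real.exp_nonneg _) (by positivity)
            gcongr
        _ = K₁ * g * decay n * 1 := by rw [hK₁]; ring
        _ ≤ _ := by gcongr; linarith
    · have h1 := large (not_le.mp hs) hq0
      calc _ ≤ C₂ * 1 := by rw [mul_one]; exact hh.abs_hHat_le hl _
        _ ≤ (2 * C₂) * ((δ ^ 4)⁻¹ * decay n * (g * w)) := by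
            have h2 : 1 ≤ (δ ^ 4)⁻¹ * decay n * (g * w) := h1.trans (by gcongr)
            nlinarith
        _ = K₂ * g * decay n * w := by rw [hK₂]; ring
        _ ≤ _ := by gcongr; linarith

end Hopping

/-! ### The intralayer symbol near the Dirac point -/

theorem norm_phase_sub_one_sub_le (x : ℝ) : ‖phase x - 1 - Complex.I * x‖ ≤ 3 * x ^ 2 := by
  by_cases h : |x| ≤ 1
  · have h1 := Complex.norm_exp_sub_one_sub_id_le (x := Complex.I * x) (by simpa using h)
    have h2 : ‖Complex.I * (x : ℂ)‖ ^ 2 = x ^ 2 := by simp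
    rw [h2] at h1
    rw [phase]
    nlinarith [sq_nonneg x]
  · have h1 : ‖phase x - 1 - Complex.I * x‖ ≤ 1 + 1 + |x| := by
      refine (norm_sub_le _ _).trans (add_le_add ((norm_sub_le _ _).trans ?_) ?_)
      · rw [norm_phase, norm_one]
      · simp
    nlinarith [sq_abs x]

theorem norm_phase_sub_one_le (x : ℝ) : ‖phase x - 1‖ ≤ |x| := by
  simpa [phase] using Real.norm_exp_I_mul_ofReal_sub_one_le (x := x)

/-- The vectors from an atom `A` of a monolayer to its nearest neighbours. -/
def neighbor : Fin 3 → Plane :=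
  ![siteShift 1, siteShift 1 - latticeVec 0, siteShift 1 - latticeVec 1]

theorem norm_neighbor_le (k : Fin 3) : ‖neighbor k‖ ≤ 1 := by
  have h : ‖neighbor k‖ ^ 2 ≤ 1 := by
    rw [norm_sq_plane]
    have h3 := Real.sq_sqrt (show (0 : ℝ) ≤ 3 by norm_num)
    have h0 : Real.sqrt 3 ≠ 0 := by positivity
    have h4 : (Real.sqrt 3)⁻¹ = Real.sqrt 3 / 3 := by field_simp; linarith
    have h5 : |Real.sqrt 3 / 3| ≤ 1 := by
      rw [abs_of_nonneg (by positivity)]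
      nlinarith [Real.sqrt_nonneg 3]
    fin_cases k <;> simp [neighbor, siteShift, latticeVec, h4]
    · exact h5
    all_goals nlinarith
  nlinarith [norm_nonneg (neighbor k)]

/-- The symbol of the hopping from `B` to `A` in layer `i`, at the momentum `κᵢ + y`. -/
def intraSymbol (θ : ℝ) (i : Fin 2) (y : Plane) : ℂ :=
  -((2 / Real.sqrt 3 : ℝ) : ℂ)
    * ∑ k, phase (inner ℝ kappa (neighbor k) + inner ℝ y (layerRot θ i (neighbor k)))

theorem phase_kappa_neighbor (k : Fin 3) : phase (inner ℝ kappa (neighbor k))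
    = ![1, -(1 / 2) - Complex.I * ((Real.sqrt 3 / 2 : ℝ) : ℂ),
      -(1 / 2) + Complex.I * ((Real.sqrt 3 / 2 : ℝ) : ℂ)] k := by
  have hc : Real.cos (2 * Real.pi / 3) = -(1 / 2) := by
    rw [show 2 * Real.pi / 3 = Real.pi - Real.pi / 3 by ring, Real.cos_pi_sub, Real.cos_pi_div_three]
  have hsn : Real.sin (2 * Real.pi / 3) = Real.sqrt 3 / 2 := by
    rw [show 2 * Real.pi / 3 = Real.pi - Real.pi / 3 by ring, Real.sin_pi_sub, Real.sin_pi_div_three]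
  have hp : ∀ x : ℝ, phase x = (Real.cos x : ℂ) + Complex.I * (Real.sin x : ℂ) := by
    intro x
    rw [phase, mul_comm Complex.I, Complex.exp_mul_I, Complex.ofReal_cos, Complex.ofReal_sin]
    ring
  fin_cases k
  · have : inner ℝ kappa (neighbor 0) = 0 := by simp [inner_plane, kappa, neighbor, siteShift]
    simp [this, phase]
  · have : inner ℝ kappa (neighbor 1) = -(2 * Real.pi / 3) := by
      simp [inner_plane, kappa, neighbor, siteShift, latticeVec]; ring
    change phase (inner ℝ kappa (neighbor 1)) = _
    rw [this, hp, Real.cos_neg, Real.sin_neg, hc, hsn]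
    simp
    ring
  · have : inner ℝ kappa (neighbor 2) = 2 * Real.pi / 3 := by
      simp [inner_plane, kappa, neighbor, siteShift, latticeVec]; ring
    change phase (inner ℝ kappa (neighbor 2)) = _
    rw [this, hp, hc, hsn]
    simp

/-- The three phases are the cube roots of unity, so the constant term vanishes; the factor 2/√3
normalizes the linear term to Dirac velocity one. -/
theorem sum_phase_kappa_neighbor (z : Plane) :
    -((2 / Real.sqrt 3 : ℝ) : ℂ) * ∑ k, phase (inner ℝ kappa (neighbor k))
      * (1 + Complex.I * ((inner ℝ z (neighbor k) : ℝ) : ℂ)) = z 0 - Complex.I * z 1 := by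
  have h3 : ((Real.sqrt 3 : ℝ) : ℂ) ^ 2 = 3 := by
    rw [← Complex.ofReal_pow, Real.sq_sqrt (by norm_num)]; norm_num
  have h0 : ((Real.sqrt 3 : ℝ) : ℂ) ≠ 0 := by
    intro h; rw [h] at h3; norm_num at h3
  rw [Fin.sum_univ_three, phase_kappa_neighbor, phase_kappa_neighbor, phase_kappa_neighbor]
  simp [inner_plane, neighbor, siteShift, latticeVec]
  field_simp
  ring_nf
  simp only [h3, Complex.I_sq]
  ring

theorem norm_intraSymbol_sub_le (θ : ℝ) (i : Fin 2) (y : Plane) :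
    ‖intraSymbol θ i y - (y 0 - Complex.I * y 1)‖ ≤ 18 * ‖y‖ ^ 2 + |θ| * ‖y‖ := by
  set α := layerSign i * (θ / 2) with hα
  set z : Plane := rot (-α) y with hz
  have hin : ∀ v, inner ℝ y (layerRot θ i v) = inner ℝ z v := by
    intro v
    simp only [layerRot, ← hα, hz, inner_plane, rot_apply_zero, rot_apply_one, Real.cos_neg,
      Real.sin_neg]
    ring
  have hzn : ‖z‖ = ‖y‖ := norm_rot _ _
  -- Rotating the layer only multiplies the linear symbol by a phase, which differs from 1 by at
  -- most |θ|.
  have hz2 : (z 0 : ℂ) - Complex.I * z 1 = phase α * (y 0 - Complex.I * y 1) := by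
    rw [phase, mul_comm Complex.I (α : ℂ), Complex.exp_mul_I, ← Complex.ofReal_cos,
      ← Complex.ofReal_sin, hz, rot_apply_zero, rot_apply_one, Real.cos_neg, Real.sin_neg]
    push_cast
    linear_combination (Complex.sin α * y 1) * Complex.I_sq
  have hyn : ‖(y 0 : ℂ) - Complex.I * y 1‖ = ‖y‖ := by
    refine (pow_left_inj₀ (norm_nonneg _) (norm_nonneg _) two_ne_zero).mp ?_
    rw [norm_sq_plane, Complex.sq_norm, Complex.normSq_apply]
    simp
    ring
  have hα2 : |α| ≤ |θ| := by
    rw [hα, abs_mul, abs_div]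
    have : |layerSign i| = 1 := by fin_cases i <;> simp [layerSign]
    rw [this, one_mul, abs_two]
    linarith [abs_nonneg θ]
  have h1 : ‖intraSymbol θ i y - (z 0 - Complex.I * z 1)‖ ≤ 18 * ‖y‖ ^ 2 := by
    rw [← sum_phase_kappa_neighbor, intraSymbol, ← mul_sub, ← Finset.sum_sub_distrib, norm_mul,
      norm_neg, Complex.norm_real, Real.norm_of_nonneg (by positivity)]
    have h3 : (2 / Real.sqrt 3 : ℝ) ≤ 2 := by
      refine div_le_self (by norm_num) ?_
      rw [Real.one_le_sqrt]; norm_num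
    have h4 : ‖∑ k, (phase (inner ℝ kappa (neighbor k) + inner ℝ y (layerRot θ i (neighbor k)))
        - phase (inner ℝ kappa (neighbor k))
          * (1 + Complex.I * ((inner ℝ z (neighbor k) : ℝ) : ℂ)))‖ ≤ ∑ k : Fin 3, 3 * ‖y‖ ^ 2 := by
      refine norm_sum_le_of_le _ fun k _ => ?_
      rw [phase_add, ← mul_sub, norm_mul, norm_phase, one_mul, hin, ← sub_sub]
      refine (norm_phase_sub_one_sub_le _).trans ?_
      have h5 := abs_real_inner_le_norm z (neighbor k)
      have h6 : |inner ℝ z (neighbor k)| ≤ ‖y‖ := by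
        rw [hzn] at h5
        nlinarith [norm_neighbor_le k, norm_nonneg y]
      rw [← sq_abs (inner ℝ z (neighbor k))]
      gcongr
    simp only [Finset.sum_const, Finset.card_univ, Fintype.card_fin, nsmul_eq_mul] at h4
    calc _ ≤ 2 * (((3 : ℕ) : ℝ) * (3 * ‖y‖ ^ 2)) := by gcongr
      _ = _ := by push_cast; ring
  have h2 : ‖((z 0 : ℂ) - Complex.I * z 1) - (y 0 - Complex.I * y 1)‖ ≤ |θ| * ‖y‖ := by
    rw [hz2, ← sub_one_mul, norm_mul, hyn]
    gcongr
    exact (norm_phase_sub_one_le α).trans hα2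
  have := norm_add_le (intraSymbol θ i y - (z 0 - Complex.I * z 1))
    (((z 0 : ℂ) - Complex.I * z 1) - (y 0 - Complex.I * y 1))
  rw [sub_add_sub_cancel] at this
  linarith

/-! ### The moiré potential as the first shell -/

theorem phase_eq_phase {x y : ℝ} (k : ℤ) (h : x = y + 2 * Real.pi * k) : phase x = phase y := by
  rw [h, phase_add, phase_int_mul_two_pi, mul_one]

theorem inner_layerRecip_sitePos (θ : ℝ) (d : Plane) (i σ k : Fin 2) (m : ℤ × ℤ) :
    inner ℝ (layerRecip θ i k) (sitePos θ d i σ m)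
      = inner ℝ (layerRecip θ i k) (layerShift θ d i σ) + 2 * Real.pi * ((![m.1, m.2] k : ℤ) : ℝ) := by
  rw [sitePos_eq, inner_add_right, inner_add_right, inner_smul_right, inner_smul_right,
    inner_layerRecip_layerRot, inner_layerRecip_layerRot]
  fin_cases k <;> simp <;> ring

/-- The three momenta of smallest norm. -/
def firstShell : Finset CellIndex := {![0, 0], ![0, 1], ![-1, 0]}

theorem mem_firstShell (n : CellIndex) : n ∈ firstShell ↔ shell n = 0 := by
  have hn : n = ![n 0, n 1] := by ext i; fin_cases i <;> rfl
  constructor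
  · intro h
    simp only [firstShell, Finset.mem_insert, Finset.mem_singleton] at h
    rcases h with h | h | h <;> rw [h] <;> rfl
  · intro h
    have h2 : (n 0 - n 1 + 1) ^ 2 + n 0 ^ 2 + n 1 ^ 2 = 1 := by
      have := two_mul_shell n
      rw [h] at this
      have h4 : (((n 0 - n 1 + 1) ^ 2 + n 0 ^ 2 + n 1 ^ 2 : ℤ) : ℝ) = ((1 : ℤ) : ℝ) := by
        push_cast; push_cast at this; linarith
      exact_mod_cast h4
    have a1 : n 0 ≤ 1 := by nlinarith [sq_nonneg (n 0 - n 1 + 1), sq_nonneg (n 1)]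
    have a2 : -1 ≤ n 0 := by nlinarith [sq_nonneg (n 0 - n 1 + 1), sq_nonneg (n 1)]
    have b1 : n 1 ≤ 1 := by nlinarith [sq_nonneg (n 0 - n 1 + 1), sq_nonneg (n 0)]
    have b2 : -1 ≤ n 1 := by nlinarith [sq_nonneg (n 0 - n 1 + 1), sq_nonneg (n 0)]
    rw [hn]
    generalize n 0 = u at *
    generalize n 1 = v at *
    simp only [firstShell, Finset.mem_insert, Finset.mem_singleton]
    interval_cases u <;> interval_cases v <;> simp_all

theorem sum_firstShell {M : Type*} [AddCommMonoid M] (F : CellIndex → M) :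
    ∑ n ∈ firstShell, F n = F ![0, 0] + (F ![0, 1] + F ![-1, 0]) := by
  rw [firstShell, Finset.sum_insert (by decide), Finset.sum_insert (by decide),
    Finset.sum_singleton]

/-- The moiré potential is the first shell of the Fourier expansion of the interlayer coupling. -/
theorem bmCoupling_mul_phase (lam₀ : ℝ) {γ : ℝ} (hγ : γ ≠ 0) (θ : ℝ) (d : Plane) (i σ σ' : Fin 2)
    (m : ℤ × ℤ) :
    bmCoupling lam₀ γ θ d (γ • sitePos θ d i σ m) i σ σ'
        * phase (inner ℝ (layerKappa θ i) (sitePos θ d i σ m))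
      = (lam₀ : ℂ) * ∑ n ∈ firstShell, phase (inner ℝ (layerKappa θ (otherLayer i)) (sitePos θ d i σ m)
          + inner ℝ (layerRecipSum θ (otherLayer i) n)
            (sitePos θ d i σ m - layerShift θ d (otherLayer i) σ')) := by
  have h0 := inner_layerRecip_sitePos θ d i σ 0 m
  have h1 := inner_layerRecip_sitePos θ d i σ 1 m
  simp only [Matrix.cons_val_zero, Matrix.cons_val_one] at h0 h1
  rw [sum_firstShell]
  set p := sitePos θ d i σ m with hp
  fin_cases i
  · simp only [bmCoupling, scaledMoire, moirePotential, Fin.zero_eta, Matrix.cons_val_zero,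
      Matrix.smul_apply, smul_eq_mul, inv_smul_smul₀ hγ, Fin.sum_univ_three, Matrix.add_apply,
      momentumHop, hopMatrix, otherLayer, Matrix.of_apply, Matrix.cons_val_one, Matrix.cons_val,
      layerRecipSum] at h0 h1 ⊢
    rw [mul_assoc, add_mul, add_mul, add_assoc, mul_one, ← phase_add, ← phase_add, ← phase_add,
      ← phase_add, ← phase_add]
    congr 2
    · congr 1
      simp [inner_sub_left]
    · congr 1
      -- At a site of layer i, a reciprocal vector of that same layer sees only the sublattice
      -- shift, modulo 2π. The phases of T₂ and T₃ thus complete those of the momentum hops to the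
      -- reciprocal vectors of the other layer.
      · refine phase_eq_phase (-m.2) ?_
        simp [inner_sub_left, inner_sub_right, inner_add_left, h1]
        ring
      · refine phase_eq_phase m.1 ?_
        simp [inner_sub_left, inner_sub_right, inner_add_left, h0]
        ring
  · simp only [bmCoupling, scaledMoire, moirePotential, Fin.mk_one, Matrix.cons_val_zero,
      Matrix.smul_apply, smul_eq_mul, inv_smul_smul₀ hγ, Fin.sum_univ_three, Matrix.add_apply,
      momentumHop, hopMatrix, otherLayer, Matrix.of_apply, Matrix.cons_val_one, Matrix.cons_val,
      layerRecipSum, Matrix.conjTranspose_apply, RCLike.star_def, map_mul, map_add, conj_phase,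
      Complex.conj_ofReal, map_one] at h0 h1 ⊢
    rw [mul_assoc, add_mul, add_mul, add_assoc, mul_one, ← phase_add, ← phase_add, ← phase_add,
      ← phase_add, ← phase_add]
    congr 2
    · congr 1
      simp [inner_sub_left]
    · congr 1
      · refine phase_eq_phase (-m.2) ?_
        simp [inner_sub_left, inner_sub_right, inner_add_left, h1]
        ring
      · refine phase_eq_phase m.1 ?_
        simp [inner_sub_left, inner_sub_right, inner_add_left, h0]
        ring

/-! ### Wave packets as Fourier integrals and the intralayer residual -/

/-- The Fourier transform of a function in `H⁸`. -/
structure SobolevSymbol (U : Plane → ℂ) : Prop where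
  aestronglyMeasurable : AEStronglyMeasurable U
  lt_top : ∫⁻ η, sobolevWeight 8 η * ‖U η‖ₑ ^ 2 < ∞

theorem SobolevSymbol.integrable_mul {U M : Plane → ℂ} (hU : SobolevSymbol U) (hM : Continuous M)
    {K : ℝ} (hK : ∀ η, ‖M η‖ ≤ K * (1 + (2 * Real.pi * ‖η‖) ^ 2) ^ 2) :
    Integrable fun η => M η * U η :=
  integrable_of_sobolev (hM.aestronglyMeasurable.mul hU.1)
    ((lintegral_sobolev_mul_le hK).trans_lt
      (ENNReal.mul_lt_top (ENNReal.pow_lt_top ENNReal.ofReal_lt_top) hU.2))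

theorem integrable_phase_mul {F : Plane → ℂ} (hF : Integrable F) (γ : ℝ) (p : Plane) :
    Integrable fun η => phase (2 * Real.pi * (γ * inner ℝ η p)) * F η :=
  hF.bdd_mul (c := 1) (continuous_phase.comp (by fun_prop)).aestronglyMeasurable
    (Filter.Eventually.of_forall fun _ => (norm_phase _).le)

/-- The function with Fourier transform `F`, at the point `γ p`. -/
def synth (γ : ℝ) (F : Plane → ℂ) (p : Plane) : ℂ :=
  ∫ η, phase (2 * Real.pi * (γ * inner ℝ η p)) * F η

theorem synth_add {γ : ℝ} {F G : Plane → ℂ} (hF : Integrable F) (hG : Integrable G) (p : Plane) :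
    synth γ (fun η => F η + G η) p = synth γ F p + synth γ G p := by
  simp only [synth, mul_add]
  exact integral_add (integrable_phase_mul hF γ p) (integrable_phase_mul hG γ p)

theorem synth_sub {γ : ℝ} {F G : Plane → ℂ} (hF : Integrable F) (hG : Integrable G) (p : Plane) :
    synth γ (fun η => F η - G η) p = synth γ F p - synth γ G p := by
  simp only [synth, mul_sub]
  exact integral_sub (integrable_phase_mul hF γ p) (integrable_phase_mul hG γ p)

theorem synth_const_mul (γ : ℝ) (c : ℂ) (F : Plane → ℂ) (p : Plane) :
    synth γ (fun η => c * F η) p = c * synth γ F p := by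
  simp only [synth, mul_left_comm _ c]
  exact integral_const_mul _ _

/-- Translating a packet by v multiplies its symbol by the phase of the total momentum κ + γξ along
v, so finite differences become multipliers. -/
theorem synth_translate (γ : ℝ) (U : Plane → ℂ) (p v κ : Plane) :
    phase (inner ℝ κ (p + v)) * synth γ U (p + v) = phase (inner ℝ κ p) *
      synth γ (fun η => phase (inner ℝ κ v + inner ℝ ((2 * Real.pi * γ) • η) v) * U η) p := by
  rw [inner_add_right, phase_add, mul_assoc]
  congr 1
  rw [synth, synth, ← integral_const_mul]
  congr 1
  funext η
  rw [← mul_assoc, ← phase_add, ← mul_assoc (phase _) (phase _) (U η), ← phase_add,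
    inner_add_right, inner_smul_left]
  congr 2
  simp
  ring

theorem SobolevSymbol.integrable {U : Plane → ℂ} (hU : SobolevSymbol U) : Integrable U := by
  have h := hU.integrable_mul (M := fun _ => 1) continuous_const (K := 1) fun η => by
    rw [norm_one]
    nlinarith [sq_nonneg (2 * Real.pi * ‖η‖), sq_nonneg ((2 * Real.pi * ‖η‖) ^ 2)]
  simpa using h

theorem SobolevSymbol.integrable_phase {U : Plane → ℂ} (hU : SobolevSymbol U) {φ : Plane → ℝ}
    (hφ : Continuous φ) : Integrable fun η => phase (φ η) * U η :=
  hU.integrable.bdd_mul (c := 1) (continuous_phase.comp hφ).aestronglyMeasurable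
    (Filter.Eventually.of_forall fun _ => (norm_phase _).le)

theorem SobolevSymbol.integrable_coord {U : Plane → ℂ} (hU : SobolevSymbol U) (a : Fin 2) :
    Integrable fun η => ((2 * Real.pi * η a : ℝ) : ℂ) * U η := by
  refine hU.integrable_mul (K := 1) (Complex.continuous_ofReal.comp (by fun_prop)) fun η => ?_
  rw [Complex.norm_real, norm_mul, Real.norm_of_nonneg (by positivity : 0 ≤ 2 * Real.pi)]
  have h := PiLp.norm_apply_le η a
  have h2 : 2 * Real.pi * ‖η a‖ ≤ 2 * Real.pi * ‖η‖ := by gcongr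
  nlinarith [sq_nonneg (2 * Real.pi * ‖η‖ - 1), sq_nonneg ((2 * Real.pi * ‖η‖) ^ 2)]

theorem sitePos_zero_sub (θ : ℝ) (d : Plane) (i : Fin 2) (m : ℤ × ℤ) :
    sitePos θ d i 1 m = sitePos θ d i 0 m + layerRot θ i (neighbor 0) ∧
    sitePos θ d i 1 (m - (1, 0)) = sitePos θ d i 0 m + layerRot θ i (neighbor 1) ∧
    sitePos θ d i 1 (m - (0, 1)) = sitePos θ d i 0 m + layerRot θ i (neighbor 2) := by
  have hsub : ∀ u v, layerRot θ i (u - v) = layerRot θ i u - layerRot θ i v := by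
    intro u v
    rw [sub_eq_add_neg, ← neg_one_smul ℝ v, layerRot_add, layerRot_smul, neg_one_smul,
      ← sub_eq_add_neg]
  have h0 : siteShift 0 = 0 := rfl
  refine ⟨?_, ?_, ?_⟩ <;> simp [sitePos_eq, layerShift, layerRot_add, neighbor, hsub, h0] <;>
    module

/-- The sum of the phases of the hops to the three neighbours, with orientation `s = ± 1`. -/
def intraHop (θ : ℝ) (i : Fin 2) (γ : ℝ) (s : ℝ) (η : Plane) : ℂ :=
  ∑ k, phase (s * (inner ℝ kappa (neighbor k)
    + inner ℝ ((2 * Real.pi * γ) • η) (layerRot θ i (neighbor k))))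

theorem sum_synth_neighbor (θ : ℝ) (i : Fin 2) (γ s : ℝ) {U : Plane → ℂ} (hU : SobolevSymbol U)
    (p : Plane) :
    ∑ k, phase (inner ℝ (layerKappa θ i) (p + s • layerRot θ i (neighbor k)))
        * synth γ U (p + s • layerRot θ i (neighbor k))
      = phase (inner ℝ (layerKappa θ i) p) * synth γ (fun η => intraHop θ i γ s η * U η) p := by
  have e : (fun η => intraHop θ i γ s η * U η) = fun η =>
      phase (inner ℝ (layerKappa θ i) (s • layerRot θ i (neighbor 0))
        + inner ℝ ((2 * Real.pi * γ) • η) (s • layerRot θ i (neighbor 0))) * U η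
      + phase (inner ℝ (layerKappa θ i) (s • layerRot θ i (neighbor 1))
        + inner ℝ ((2 * Real.pi * γ) • η) (s • layerRot θ i (neighbor 1))) * U η
      + phase (inner ℝ (layerKappa θ i) (s • layerRot θ i (neighbor 2))
        + inner ℝ ((2 * Real.pi * γ) • η) (s • layerRot θ i (neighbor 2))) * U η := by
    funext η
    simp only [intraHop, Fin.sum_univ_three, inner_smul_right, layerKappa, inner_layerRot, mul_add,
      add_mul]
  have hi : ∀ v : Plane, Integrable fun η => phase (inner ℝ (layerKappa θ i) v
      + inner ℝ ((2 * Real.pi * γ) • η) v) * U η := fun v => hU.integrable_phase (by fun_prop)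
  rw [e, synth_add (Integrable.fun_add (hi _) (hi _)) (hi _), synth_add (hi _) (hi _), Fin.sum_univ_three,
    synth_translate, synth_translate, synth_translate]
  ring

/-- The error of the Dirac approximation of the intralayer symbol. -/
def intraError (θ : ℝ) (i σ : Fin 2) (γ : ℝ) (η : Plane) : ℂ :=
  ![intraSymbol θ i ((2 * Real.pi * γ) • η)
      - ((2 * Real.pi * γ * η 0 : ℝ) - Complex.I * (2 * Real.pi * γ * η 1 : ℝ)),
    conj (intraSymbol θ i ((2 * Real.pi * γ) • η)
      - ((2 * Real.pi * γ * η 0 : ℝ) - Complex.I * (2 * Real.pi * γ * η 1 : ℝ)))] σ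

theorem norm_intraError_le (θ : ℝ) (i σ : Fin 2) {γ lam₁ : ℝ} (hγ : 0 < γ) (hθ : 0 < θ)
    (hl : θ ≤ lam₁ * γ) (η : Plane) :
    ‖intraError θ i σ γ η‖ ≤ (18 + lam₁) * γ ^ 2 * (1 + (2 * Real.pi * ‖η‖) ^ 2) ^ 2 := by
  have h := norm_intraSymbol_sub_le θ i ((2 * Real.pi * γ) • η)
  have e : ‖intraError θ i σ γ η‖ = ‖intraSymbol θ i ((2 * Real.pi * γ) • η)
      - ((((2 * Real.pi * γ) • η) 0 : ℝ) - Complex.I * (((2 * Real.pi * γ) • η) 1 : ℝ))‖ := by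
    fin_cases σ
    · rfl
    · exact RCLike.norm_conj _
  rw [e]
  refine h.trans ?_
  rw [norm_smul, Real.norm_of_nonneg (by positivity), abs_of_pos hθ]
  set t := 2 * Real.pi * ‖η‖ with ht
  have ht0 : 0 ≤ t := by positivity
  have e2 : 2 * Real.pi * γ * ‖η‖ = γ * t := by rw [ht]; ring
  have h1 : t ≤ (1 + t ^ 2) ^ 2 := by nlinarith [sq_nonneg (t - 1), sq_nonneg (t ^ 2)]
  have h2 : t ^ 2 ≤ (1 + t ^ 2) ^ 2 := by nlinarith [sq_nonneg t, sq_nonneg (t ^ 2)]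
  have hl1 : 0 ≤ lam₁ := by
    by_contra hneg
    nlinarith
  rw [e2]
  calc 18 * (γ * t) ^ 2 + θ * (γ * t) ≤ 18 * (γ * t) ^ 2 + (lam₁ * γ) * (γ * t) := by gcongr
    _ = 18 * γ ^ 2 * t ^ 2 + lam₁ * γ ^ 2 * t := by ring
    _ ≤ 18 * γ ^ 2 * (1 + t ^ 2) ^ 2 + lam₁ * γ ^ 2 * (1 + t ^ 2) ^ 2 := by gcongr
    _ = _ := by ring

theorem continuous_intraError (θ : ℝ) (i σ : Fin 2) (γ : ℝ) : Continuous (intraError θ i σ γ) := by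
  have h : Continuous fun η : Plane => intraSymbol θ i ((2 * Real.pi * γ) • η)
      - ((2 * Real.pi * γ * η 0 : ℝ) - Complex.I * (2 * Real.pi * γ * η 1 : ℝ)) := by
    unfold intraSymbol
    refine Continuous.sub (continuous_const.mul (continuous_finsetSum _ fun k _ =>
      continuous_phase.comp (by fun_prop))) ?_
    refine Continuous.sub (Complex.continuous_ofReal.comp (by fun_prop)) (continuous_const.mul
      (Complex.continuous_ofReal.comp (by fun_prop)))
  fin_cases σ
  · exact h
  · exact Complex.continuous_conj.comp h

theorem intraError_mul_zero (θ : ℝ) (i : Fin 2) (γ : ℝ) (η : Plane) :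
    intraError θ i 0 γ η = -((2 / Real.sqrt 3 : ℝ) : ℂ) * intraHop θ i γ 1 η
      - ((γ : ℂ) * ((2 * Real.pi * η 0 : ℝ) : ℂ)
        + (-(Complex.I * γ)) * ((2 * Real.pi * η 1 : ℝ) : ℂ)) := by
  simp only [intraError, intraSymbol, intraHop, one_mul, Matrix.cons_val_zero]
  push_cast
  ring

theorem intraError_mul_one (θ : ℝ) (i : Fin 2) (γ : ℝ) (η : Plane) :
    intraError θ i 1 γ η = -((2 / Real.sqrt 3 : ℝ) : ℂ) * intraHop θ i γ (-1) η
      - ((γ : ℂ) * ((2 * Real.pi * η 0 : ℝ) : ℂ)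
        + (Complex.I * γ) * ((2 * Real.pi * η 1 : ℝ) : ℂ)) := by
  simp only [intraError, intraSymbol, intraHop, neg_one_mul, Matrix.cons_val_one, map_sub, map_mul,
    map_neg, map_sum, conj_phase, Complex.conj_ofReal, Complex.conj_I]
  push_cast
  ring

/-- The envelopes `g` are represented by their Fourier transforms `U`. -/
structure IsFourierRep (g : Envelope) (U : Fin 2 → Fin 2 → Plane → ℂ) : Prop where
  symbol : ∀ i σ, SobolevSymbol (U i σ)
  eq : ∀ i σ X, g i σ X = ∫ η, phase (2 * Real.pi * inner ℝ η X) * U i σ η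
  deriv : ∀ i σ a X, partialDeriv a (g i σ) X = ∫ η, phase (2 * Real.pi * inner ℝ η X)
    * (((2 * Real.pi * η a : ℝ) : ℂ) * Complex.I * U i σ η)

theorem IsFourierRep.apply_smul {g : Envelope} {U : Fin 2 → Fin 2 → Plane → ℂ}
    (h : IsFourierRep g U) (i σ : Fin 2) (γ : ℝ) (p : Plane) :
    g i σ (γ • p) = synth γ (U i σ) p := by
  rw [h.eq, synth]; simp only [inner_smul_right]

theorem IsFourierRep.partialDeriv_smul {g : Envelope} {U : Fin 2 → Fin 2 → Plane → ℂ}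
    (h : IsFourierRep g U) (i σ a : Fin 2) (γ : ℝ) (p : Plane) :
    partialDeriv a (g i σ) (γ • p)
      = Complex.I * synth γ (fun η => ((2 * Real.pi * η a : ℝ) : ℂ) * U i σ η) p := by
  rw [h.deriv, ← synth_const_mul, synth]
  simp only [inner_smul_right]
  congr 1
  funext η
  ring

/-- Hopping and the Dirac operator both exchange sublattices, hence the symbol of the opposite
sublattice on the right; `otherLayer` serves there as the swap of the two sublattice indices. -/
theorem IsFourierRep.intra_eq {g : Envelope} {U : Fin 2 → Fin 2 → Plane → ℂ}
    (h : IsFourierRep g U) (γ θ : ℝ) (d : Plane) (i σ : Fin 2) (m : ℤ × ℤ) :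
    intraHam (fun σ m => (γ : ℂ) * g i σ (γ • sitePos θ d i σ m)
        * phase (inner ℝ (layerKappa θ i) (sitePos θ d i σ m))) σ m
      - (γ : ℂ) ^ 2 * diracOp (g i) σ (γ • sitePos θ d i σ m)
        * phase (inner ℝ (layerKappa θ i) (sitePos θ d i σ m))
      = (γ : ℂ) * phase (inner ℝ (layerKappa θ i) (sitePos θ d i σ m))
        * synth γ (fun η => intraError θ i σ γ η * U i (otherLayer σ) η) (sitePos θ d i σ m) := by
  have key : ∀ (s : ℝ) (c : ℂ) (V : Plane → ℂ) (hV : SobolevSymbol V) (p : Plane),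
      synth γ (fun η => (-((2 / Real.sqrt 3 : ℝ) : ℂ) * intraHop θ i γ s η
        - ((γ : ℂ) * ((2 * Real.pi * η 0 : ℝ) : ℂ) + c * ((2 * Real.pi * η 1 : ℝ) : ℂ))) * V η) p
      = -((2 / Real.sqrt 3 : ℝ) : ℂ) * synth γ (fun η => intraHop θ i γ s η * V η) p
        - ((γ : ℂ) * synth γ (fun η => ((2 * Real.pi * η 0 : ℝ) : ℂ) * V η) p
          + c * synth γ (fun η => ((2 * Real.pi * η 1 : ℝ) : ℂ) * V η) p) := by
    intro s c V hV p
    have hi : Integrable fun η => intraHop θ i γ s η * V η := by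
      simp only [intraHop, Finset.sum_mul]
      exact integrable_finsetSum _ fun k _ => hV.integrable_phase (by fun_prop)
    rw [← synth_const_mul, ← synth_const_mul, ← synth_const_mul,
      ← synth_add ((hV.integrable_coord 0).const_mul _) ((hV.integrable_coord 1).const_mul _),
      ← synth_sub (hi.const_mul _)
        (Integrable.fun_add ((hV.integrable_coord 0).const_mul _)
          ((hV.integrable_coord 1).const_mul _))]
    congr 1
    funext η
    ring
  obtain ⟨p0, p1, p2⟩ := sitePos_zero_sub θ d i m
  fin_cases σ
  · have hs := sum_synth_neighbor θ i γ 1 (h.symbol i 1) (sitePos θ d i 0 m)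
    simp only [one_smul, Fin.sum_univ_three, ← p0, ← p1, ← p2] at hs
    simp only [Fin.zero_eta, intraError_mul_zero, otherLayer, Matrix.cons_val_zero]
    rw [key 1 _ _ (h.symbol i 1)]
    simp only [intraHam, diracOp, Matrix.cons_val_zero, Fin.sum_univ_two, pauli, h.apply_smul,
      h.partialDeriv_smul, Matrix.of_apply, Matrix.cons_val', Matrix.cons_val_one,
      Matrix.cons_val_fin_one]
    linear_combination (-((2 / Real.sqrt 3 : ℝ) : ℂ) * γ) * hs + ((γ : ℂ) ^ 2 * phase (inner ℝ (layerKappa θ i) (sitePos θ d i 0 m)) *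
        (synth γ (fun η => ((2 * Real.pi * η 0 : ℝ) : ℂ) * U i 1 η) (sitePos θ d i 0 m)
          - Complex.I * synth γ (fun η => ((2 * Real.pi * η 1 : ℝ) : ℂ) * U i 1 η)
            (sitePos θ d i 0 m))) * Complex.I_sq
  -- Seen from an atom B the neighbours lie in the opposite directions, which is the orientation s =
  -- -1 and the conjugate symbol.
  · have q1 : sitePos θ d i 0 (m + (1, 0)) = sitePos θ d i 1 m - layerRot θ i (neighbor 1) := by
      have := (sitePos_zero_sub θ d i (m + (1, 0))).2.1
      rw [add_sub_cancel_right] at this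
      rw [this, add_sub_cancel_right]
    have q2 : sitePos θ d i 0 (m + (0, 1)) = sitePos θ d i 1 m - layerRot θ i (neighbor 2) := by
      have := (sitePos_zero_sub θ d i (m + (0, 1))).2.2
      rw [add_sub_cancel_right] at this
      rw [this, add_sub_cancel_right]
    have q0 : sitePos θ d i 0 m = sitePos θ d i 1 m - layerRot θ i (neighbor 0) := by
      rw [p0, add_sub_cancel_right]
    have hs := sum_synth_neighbor θ i γ (-1) (h.symbol i 0) (sitePos θ d i 1 m)
    simp only [neg_one_smul, ← sub_eq_add_neg, Fin.sum_univ_three, ← q0, ← q1, ← q2] at hs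
    simp only [Fin.mk_one, intraError_mul_one, otherLayer, Matrix.cons_val_one,
      Matrix.cons_val_fin_one]
    rw [key (-1) _ _ (h.symbol i 0)]
    simp only [intraHam, diracOp, Matrix.cons_val_zero, Fin.sum_univ_two, pauli, h.apply_smul,
      h.partialDeriv_smul, Matrix.of_apply, Matrix.cons_val', Matrix.cons_val_one,
      Matrix.cons_val_fin_one]
    linear_combination (-((2 / Real.sqrt 3 : ℝ) : ℂ) * γ) * hs + ((γ : ℂ) ^ 2 * phase (inner ℝ (layerKappa θ i) (sitePos θ d i 1 m)) *
        (synth γ (fun η => ((2 * Real.pi * η 0 : ℝ) : ℂ) * U i 0 η) (sitePos θ d i 1 m)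
          + Complex.I * synth γ (fun η => ((2 * Real.pi * η 1 : ℝ) : ℂ) * U i 0 η)
            (sitePos θ d i 1 m))) * Complex.I_sq

theorem SobolevSymbol.lt_top_two {U : Plane → ℂ} (hU : SobolevSymbol U) :
    ∫⁻ η, sobolevWeight 2 η * ‖U η‖ₑ ^ 2 < ∞ :=
  lt_of_le_of_lt (lintegral_mono fun η =>
    mul_le_mul_left (sobolevWeight_mono (by norm_num) η) _) hU.lt_top

/-! ### The interlayer residual -/

/-- The error of the continuum approximation of the interlayer symbol. -/
def interError (hs : ℝ → ℝ) (l γ θ lam₀ : ℝ) (j : Fin 2) (n : CellIndex) (η : Plane) : ℝ :=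
  hHat hs (layerKappa θ j + layerRecipSum θ j n + (2 * Real.pi * γ) • η) l
    - if shell n = 0 then lam₀ * γ else 0

/-- The phase of the hop from sublattice `σ'` of layer `j` by the reciprocal lattice vector `n`. -/
def interPhase (θ : ℝ) (d : Plane) (j σ' : Fin 2) (n : CellIndex) (p : Plane) : ℂ :=
  phase (inner ℝ (layerKappa θ j) p + inner ℝ (layerRecipSum θ j n) (p - layerShift θ d j σ'))

theorem norm_interPhase (θ : ℝ) (d : Plane) (j σ' : Fin 2) (n : CellIndex) (p : Plane) :
    ‖interPhase θ d j σ' n p‖ = 1 := norm_phase _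

section Hopping

variable {hs : ℝ → ℝ} {C₁ C₂ C₃ D₁ D₂ l₀ : ℝ}

theorem HoppingAssumption.continuous_interError (hh : HoppingAssumption hs C₁ C₂ C₃ D₁ D₂ l₀)
    {l : ℝ} (hl : l₀ ≤ l) (γ θ lam₀ : ℝ) (j : Fin 2) (n : CellIndex) :
    Continuous fun η => ((interError hs l γ θ lam₀ j n η : ℝ) : ℂ) :=
  Complex.continuous_ofReal.comp
    (((hh.continuous_hHat hl).comp (by fun_prop)).sub continuous_const)

theorem HoppingAssumption.integrable_hHat_mul (hh : HoppingAssumption hs C₁ C₂ C₃ D₁ D₂ l₀)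
    {l : ℝ} (hl : l₀ ≤ l) {U : Plane → ℂ} (hU : SobolevSymbol U) (q : Plane) (c : ℝ) :
    Integrable fun η => ((hHat hs (q + c • η) l : ℝ) : ℂ) * U η := by
  refine hU.integrable_mul (K := C₂)
    (Complex.continuous_ofReal.comp ((hh.continuous_hHat hl).comp (by fun_prop))) fun η => ?_
  rw [Complex.norm_real, Real.norm_eq_abs]
  refine (hh.abs_hHat_le hl _).trans (le_mul_of_one_le_right hh.C₂_pos.le ?_)
  nlinarith [sq_nonneg (2 * Real.pi * ‖η‖), sq_nonneg ((2 * Real.pi * ‖η‖) ^ 2)]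

theorem HoppingAssumption.inter_eq (hh : HoppingAssumption hs C₁ C₂ C₃ D₁ D₂ l₀) {l : ℝ}
    (hl : l₀ ≤ l) {γ : ℝ} (h0 : 0 < γ) (h1 : γ ≤ 1) (lam₀ θ : ℝ) (d : Plane)
    {g : Envelope} {U : Fin 2 → Fin 2 → Plane → ℂ} (h : IsFourierRep g U) (i σ : Fin 2)
    (m : ℤ × ℤ) :
    interHam hs l θ d (fun i σ m => (γ : ℂ) * g i σ (γ • sitePos θ d i σ m)
        * phase (inner ℝ (layerKappa θ i) (sitePos θ d i σ m))) i σ m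
      - (γ : ℂ) ^ 2 * (∑ σ', bmCoupling lam₀ γ θ d (γ • sitePos θ d i σ m) i σ σ'
          * g (otherLayer i) σ' (γ • sitePos θ d i σ m))
        * phase (inner ℝ (layerKappa θ i) (sitePos θ d i σ m))
      = (γ : ℂ) * ∑ σ', ∑' n, interPhase θ d (otherLayer i) σ' n (sitePos θ d i σ m)
          * synth γ (fun η => ((interError hs l γ θ lam₀ (otherLayer i) n η : ℝ) : ℂ)
            * U (otherLayer i) σ' η) (sitePos θ d i σ m) := by
  set j := otherLayer i with hj
  set p := sitePos θ d i σ m with hp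
  choose S hS1 hS2 using fun σ' => hh.exists_hasSum_hop hl h0 h1 θ d j σ'
    (h.symbol j σ').1 (h.symbol j σ').lt_top_two p (layerKappa θ j)
  have e1 : interHam hs l θ d (fun i σ m => (γ : ℂ) * g i σ (γ • sitePos θ d i σ m)
      * phase (inner ℝ (layerKappa θ i) (sitePos θ d i σ m))) i σ m = (γ : ℂ) * ∑ σ', S σ' := by
    rw [interHam, ← (hasSum_sum (s := Finset.univ) fun σ' _ => hS1 σ').tsum_eq, ← tsum_mul_left,
      ← tsum_mul_left]
    refine tsum_congr fun m' => ?_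
    rw [Finset.mul_sum, Finset.mul_sum]
    refine Finset.sum_congr rfl fun σ' _ => ?_
    simp only [h.apply_smul, ← hp, ← hj, synth]
    ring
  -- Subtracting from the Poisson series the finitely supported series with constant symbol λ₀γ on
  -- the first shell leaves exactly `interError` as the symbol of each term.
  have e2 : ∀ σ', HasSum (fun n => interPhase θ d j σ' n p
      * synth γ (fun η => ((interError hs l γ θ lam₀ j n η : ℝ) : ℂ) * U j σ' η) p)
      (S σ' - ∑ n ∈ firstShell, interPhase θ d j σ' n p
        * (((lam₀ * γ : ℝ) : ℂ) * synth γ (U j σ') p)) := by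
    intro σ'
    have h2 : HasSum (fun n => if n ∈ firstShell then interPhase θ d j σ' n p
        * (((lam₀ * γ : ℝ) : ℂ) * synth γ (U j σ') p) else 0) (∑ n ∈ firstShell,
          interPhase θ d j σ' n p * (((lam₀ * γ : ℝ) : ℂ) * synth γ (U j σ') p)) := by
      have := hasSum_sum_of_ne_finset_zero (L := .unconditional _)
        (f := fun n => if n ∈ firstShell then interPhase θ d j σ' n p
          * (((lam₀ * γ : ℝ) : ℂ) * synth γ (U j σ') p) else 0) (s := firstShell)
        fun n hn => if_neg hn
      rwa [Finset.sum_congr rfl fun n hn => if_pos hn] at this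
    refine ((hS2 σ').sub h2).congr_fun fun n => ?_
    have e3 : (if n ∈ firstShell then interPhase θ d j σ' n p
        * (((lam₀ * γ : ℝ) : ℂ) * synth γ (U j σ') p) else 0) = interPhase θ d j σ' n p
          * synth γ (fun η => (((if shell n = 0 then lam₀ * γ else 0 : ℝ)) : ℂ) * U j σ' η) p := by
      rw [synth_const_mul]
      simp only [mem_firstShell]
      split_ifs <;> simp
    rw [e3, interPhase, ← synth, ← mul_sub,
      ← synth_sub (hh.integrable_hHat_mul hl (h.symbol j σ') _ _)
        ((h.symbol j σ').integrable.const_mul _)]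
    simp only [← sub_mul, interError, Complex.ofReal_sub]
  have e4 : ∀ σ', bmCoupling lam₀ γ θ d (γ • p) i σ σ' * g j σ' (γ • p)
      * phase (inner ℝ (layerKappa θ i) p)
      = (lam₀ : ℂ) * ∑ n ∈ firstShell, interPhase θ d j σ' n p * synth γ (U j σ') p := by
    intro σ'
    rw [h.apply_smul, mul_right_comm, bmCoupling_mul_phase lam₀ h0.ne', mul_assoc, Finset.sum_mul]
    rfl
  rw [e1, mul_assoc ((γ : ℂ) ^ 2), Finset.sum_mul]
  simp only [e4, (e2 _).tsum_eq]
  rw [Finset.sum_sub_distrib, mul_sub]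
  congr 1
  rw [Finset.mul_sum, Finset.mul_sum]
  refine Finset.sum_congr rfl fun σ' _ => ?_
  rw [Finset.mul_sum, Finset.mul_sum, Finset.mul_sum]
  refine Finset.sum_congr rfl fun n _ => ?_
  push_cast
  ring

/-- The residual as a sum of Fourier integrals. -/
theorem HoppingAssumption.residual_eq (hh : HoppingAssumption hs C₁ C₂ C₃ D₁ D₂ l₀) {l : ℝ}
    (hl : l₀ ≤ l) {γ : ℝ} (h0 : 0 < γ) (h1 : γ ≤ 1) (lam₀ θ : ℝ) (d : Plane)
    {f₀ : Envelope} {f : ℝ → Envelope} (hf : IsBMSolution lam₀ γ θ d f₀ f) {τ : ℝ} (hτ : 0 ≤ τ)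
    {U : Fin 2 → Fin 2 → Plane → ℂ} (h : IsFourierRep (f (γ * τ)) U) (i σ : Fin 2) (m : ℤ × ℤ) :
    residual hs l γ θ d f τ i σ m
      = (γ : ℂ) * phase (inner ℝ (layerKappa θ i) (sitePos θ d i σ m))
        * synth γ (fun η => intraError θ i σ γ η * U i (otherLayer σ) η) (sitePos θ d i σ m)
      + (γ : ℂ) * ∑ σ', ∑' n, interPhase θ d (otherLayer i) σ' n (sitePos θ d i σ m)
          * synth γ (fun η => ((interError hs l γ θ lam₀ (otherLayer i) n η : ℝ) : ℂ)
            * U (otherLayer i) σ' η) (sitePos θ d i σ m) := by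
  have hT : 0 ≤ γ * τ := by positivity
  have hd : HasDerivWithinAt (fun t => wavePacket γ θ d f t i σ m)
      ((γ : ℂ) * (γ • derivWithin (fun t => f t i σ (γ • sitePos θ d i σ m)) (Ici 0) (γ * τ))
        * phase (inner ℝ (layerKappa θ i) (sitePos θ d i σ m))) (Ici 0) τ := by
    have hg := (hf.differentiable_time (γ * τ) hT i σ (γ • sitePos θ d i σ m)).hasDerivWithinAt
    have hl : HasDerivWithinAt (fun t : ℝ => γ * t) γ (Ici 0) τ := by
      simpa using (hasDerivWithinAt_id τ (Ici (0 : ℝ))).const_mul γ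
    have hc := HasDerivWithinAt.scomp (h := fun t : ℝ => γ * t) (t' := Ici 0) τ hg hl
      fun t ht => mul_nonneg h0.le ht
    exact (hc.const_mul (γ : ℂ)).mul_const _
  rw [residual, hd.derivWithin (uniqueDiffOn_Ici 0 τ hτ), ← h.intra_eq γ θ d i σ m,
    ← hh.inter_eq hl h0 h1 lam₀ θ d h i σ m, hamiltonian]
  have he := hf.equation (γ * τ) hT i σ (γ • sitePos θ d i σ m)
  rw [bmHamiltonian] at he
  simp only [Complex.real_smul]
  have hw : wavePacket γ θ d f τ = fun i σ m => (γ : ℂ) * f (γ * τ) i σ (γ • sitePos θ d i σ m)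
      * phase (inner ℝ (layerKappa θ i) (sitePos θ d i σ m)) := rfl
  rw [hw]
  -- The amplitude and the slow time each contribute a factor γ, so the time derivative cancels γ²
  -- times the Bistritzer-MacDonald Hamiltonian, already subtracted in the two error identities.
  linear_combination (-(γ : ℂ) ^ 2 * phase (inner ℝ (layerKappa θ i) (sitePos θ d i σ m))) * he

end Hopping

/-! ### Estimates in ℓ² and conclusion -/

theorem ofReal_mul_jacobian_le {γ : ℝ} (h0 : 0 < γ) :
    ENNReal.ofReal γ ^ 2 * ENNReal.ofReal (2 / (Real.sqrt 3 * γ ^ 2)) ≤ 2 := by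
  have h3 : (1 : ℝ) ≤ Real.sqrt 3 := by rw [Real.one_le_sqrt]; norm_num
  rw [← ENNReal.ofReal_pow h0.le, ← ENNReal.ofReal_mul (by positivity),
    show (2 : ℝ≥0∞) = ENNReal.ofReal 2 by simp]
  refine ENNReal.ofReal_le_ofReal ?_
  have : γ ^ 2 * (2 / (Real.sqrt 3 * γ ^ 2)) = 2 / Real.sqrt 3 := by field_simp
  rw [this]
  exact div_le_self (by norm_num) h3

theorem SobolevSymbol.tsum_synth_le {U : Plane → ℂ} (hU : SobolevSymbol U) {γ : ℝ} (h0 : 0 < γ)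
    (h1 : γ ≤ 1) (θ : ℝ) (d : Plane) (i σ : Fin 2) {M : Plane → ℂ} (hM : Continuous M) {K : ℝ}
    (hK : ∀ η, ‖M η‖ ≤ K * (1 + (2 * Real.pi * ‖η‖) ^ 2) ^ 2) :
    ∑' m, ‖(γ : ℂ) * synth γ (fun η => M η * U η) (sitePos θ d i σ m)‖ₑ ^ 2
      ≤ 18 * decaySum * ENNReal.ofReal K ^ 2 * ∫⁻ η, sobolevWeight 8 η * ‖U η‖ₑ ^ 2 := by
  have hγ : ‖(γ : ℂ)‖ₑ = ENNReal.ofReal γ := by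
    rw [← ofReal_norm, Complex.norm_real, Real.norm_of_nonneg h0.le]
  simp only [enorm_mul, mul_pow, ENNReal.tsum_mul_left, hγ]
  calc _ ≤ ENNReal.ofReal γ ^ 2 * (ENNReal.ofReal (2 / (Real.sqrt 3 * γ ^ 2)) * (9 * decaySum)
        * (ENNReal.ofReal K ^ 2 * ∫⁻ η, sobolevWeight 8 η * ‖U η‖ₑ ^ 2)) := by
        gcongr
        refine (tsum_fourier_sitePos_sq_le h0 h1 θ d i σ
          (hM.aestronglyMeasurable.mul hU.1)).trans ?_
        gcongr
        exact lintegral_sobolev_mul_le hK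
    _ = (ENNReal.ofReal γ ^ 2 * ENNReal.ofReal (2 / (Real.sqrt 3 * γ ^ 2))) * ((9 * decaySum)
        * (ENNReal.ofReal K ^ 2 * ∫⁻ η, sobolevWeight 8 η * ‖U η‖ₑ ^ 2)) := by ring
    _ ≤ 2 * ((9 * decaySum)
        * (ENNReal.ofReal K ^ 2 * ∫⁻ η, sobolevWeight 8 η * ‖U η‖ₑ ^ 2)) := by
        gcongr; exact ofReal_mul_jacobian_le h0
    _ = _ := by ring

/-- Cauchy-Schwarz over n with weights `decay n`: each term is bounded by the square of its weight,
so dividing by the weight still leaves a summable series. The phases depend on the site and are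
removed before the sum over sites. -/
theorem SobolevSymbol.tsum_tsum_synth_le {U : Plane → ℂ} (hU : SobolevSymbol U) {γ : ℝ}
    (h0 : 0 < γ) (h1 : γ ≤ 1) (θ : ℝ) (d : Plane) (i σ : Fin 2) {M : CellIndex → Plane → ℂ}
    (hM : ∀ n, Continuous (M n)) {K : ℝ} (hK0 : 0 ≤ K)
    (hK : ∀ n η, ‖M n η‖ ≤ K * decay n * (1 + (2 * Real.pi * ‖η‖) ^ 2) ^ 2)
    {φ : CellIndex → Plane → ℂ} (hφ : ∀ n p, ‖φ n p‖ = 1) :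
    ∑' m, ‖(γ : ℂ) * ∑' n, φ n (sitePos θ d i σ m)
        * synth γ (fun η => M n η * U η) (sitePos θ d i σ m)‖ₑ ^ 2
      ≤ 18 * decaySum ^ 3 * ENNReal.ofReal K ^ 2 * ∫⁻ η, sobolevWeight 8 η * ‖U η‖ₑ ^ 2 := by
  set B := ∫⁻ η, sobolevWeight 8 η * ‖U η‖ₑ ^ 2 with hB
  have hd0 : ∀ n, ENNReal.ofReal (decay n) ≠ 0 := fun n => by
    rw [Ne, ENNReal.ofReal_eq_zero, not_le]; exact decay_pos n
  have hφe : ∀ n p, ‖φ n p‖ₑ = 1 := fun n p => by rw [← ofReal_norm, hφ, ENNReal.ofReal_one]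
  have step : ∀ m, ‖(γ : ℂ) * ∑' n, φ n (sitePos θ d i σ m)
        * synth γ (fun η => M n η * U η) (sitePos θ d i σ m)‖ₑ ^ 2
      ≤ decaySum * ∑' n, (ENNReal.ofReal (decay n))⁻¹
        * ‖(γ : ℂ) * synth γ (fun η => M n η * U η) (sitePos θ d i σ m)‖ₑ ^ 2 := by
    intro m
    refine le_trans ?_ (tsum_sq_le (fun n => ENNReal.ofReal (decay n)) _ hd0 (by simp))
    gcongr
    rw [← tsum_mul_left]
    refine enorm_tsum_le_tsum_enorm.trans (ENNReal.tsum_le_tsum fun n => ?_)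
    rw [enorm_mul, enorm_mul, hφe, one_mul, enorm_mul]
  calc _ ≤ ∑' m, decaySum * ∑' n, (ENNReal.ofReal (decay n))⁻¹
        * ‖(γ : ℂ) * synth γ (fun η => M n η * U η) (sitePos θ d i σ m)‖ₑ ^ 2 :=
        ENNReal.tsum_le_tsum step
    _ = decaySum * ∑' n, (ENNReal.ofReal (decay n))⁻¹ * ∑' m,
        ‖(γ : ℂ) * synth γ (fun η => M n η * U η) (sitePos θ d i σ m)‖ₑ ^ 2 := by
        rw [ENNReal.tsum_mul_left, ENNReal.tsum_comm]
        simp only [ENNReal.tsum_mul_left]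
    _ ≤ decaySum * ∑' n, (18 * decaySum * ENNReal.ofReal K ^ 2 * B) * ENNReal.ofReal (decay n) := by
        refine mul_le_mul_right (ENNReal.tsum_le_tsum fun n => ?_) _
        calc _ ≤ (ENNReal.ofReal (decay n))⁻¹ *
              (18 * decaySum * ENNReal.ofReal (K * decay n) ^ 2 * B) := by
              gcongr
              exact hU.tsum_synth_le h0 h1 θ d i σ (hM n) (hK n)
          _ = (18 * decaySum * ENNReal.ofReal K ^ 2 * B) * ENNReal.ofReal (decay n) *
              ((ENNReal.ofReal (decay n))⁻¹ * ENNReal.ofReal (decay n)) := by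
              rw [ENNReal.ofReal_mul hK0]; ring
          _ = _ := by rw [ENNReal.inv_mul_cancel (hd0 n) (by simp), mul_one]
    _ = _ := by
        rw [ENNReal.tsum_mul_left, ← decaySum]; ring

theorem add_sq_le_three_mul (x y z : ℝ≥0∞) : (x + y + z) ^ 2 ≤ 3 * (x ^ 2 + y ^ 2 + z ^ 2) := by
  have h := tsum_sq_le (fun _ : Fin 3 => 1) ![x, y, z] (by simp) (by simp)
  simp only [tsum_fintype, Fin.sum_univ_three] at h
  simp only [Matrix.cons_val_zero, Matrix.cons_val_one, Matrix.cons_val, inv_one, one_mul] at h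
  refine h.trans (le_of_eq ?_)
  norm_num

theorem exists_isFourierRep {g : Envelope} (hd : ∀ i σ, Differentiable ℝ (g i σ))
    (hg : ∀ i σ, sobolevNorm 8 (g i σ) < ∞) :
    ∃ U : Fin 2 → Fin 2 → Plane → ℂ, IsFourierRep g U ∧
      ∀ i σ, ∫⁻ η, sobolevWeight 8 η * ‖U i σ η‖ₑ ^ 2 = sobolevNorm 8 (g i σ) ^ 2 := by
  choose U h1 h2 h3 h4 using fun i σ => exists_fourier_of_sobolevNorm_lt_top (hd i σ) (hg i σ)
  exact ⟨U, ⟨fun i σ => ⟨h1 i σ, by rw [h2]; exact ENNReal.pow_lt_top (hg i σ)⟩, h3, h4⟩, h2⟩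

theorem stateNorm_le_of_sq_le {φ : WaveFunction} {g : Envelope} {c : ℝ≥0∞}
    (h : ∑ i, ∑ σ, ∑' m, ‖φ i σ m‖ₑ ^ 2 ≤ c ^ 2 * ∑ i, ∑ σ, sobolevNorm 8 (g i σ) ^ 2) :
    stateNorm φ ≤ c * envelopeNorm 8 g := by
  rw [stateNorm, envelopeNorm]
  refine (ENNReal.rpow_le_rpow h (by norm_num)).trans (le_of_eq ?_)
  rw [ENNReal.mul_rpow_of_nonneg _ _ (by norm_num), ← ENNReal.rpow_natCast, ← ENNReal.rpow_mul]
  norm_num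

theorem envelopeNorm_eq_top {g : Envelope} {i σ : Fin 2} (h : sobolevNorm 8 (g i σ) = ∞) :
    envelopeNorm 8 g = ∞ := by
  rw [envelopeNorm]
  have : ∑ i, ∑ σ, sobolevNorm 8 (g i σ) ^ 2 = ∞ :=
    ENNReal.sum_eq_top.mpr ⟨i, Finset.mem_univ _,
      ENNReal.sum_eq_top.mpr ⟨σ, Finset.mem_univ _, by rw [h]; simp⟩⟩
  rw [this, ENNReal.top_rpow_of_pos (by norm_num)]

theorem exists_stateNorm_residual_le {hs : ℝ → ℝ} {C₁ C₂ C₃ D₁ D₂ l₀ : ℝ}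
    (hh : HoppingAssumption hs C₁ C₂ C₃ D₁ D₂ l₀) {lam₀ lam₁ : ℝ} (hlam₀ : 0 < lam₀)
    (hlam₁ : 0 < lam₁) :
    ∃ C : ℝ, 0 < C ∧ ∀ γ l θ : ℝ, 0 < γ → γ ≤ 1 → l₀ ≤ l →
      hHat hs kappa l = lam₀ * γ → 0 < θ → θ ≤ lam₁ * γ →
      ∀ (d : Plane) (f₀ : Envelope) (f : ℝ → Envelope), IsBMSolution lam₀ γ θ d f₀ f →
      ∀ τ : ℝ, 0 ≤ τ → stateNorm (residual hs l γ θ d f τ) ≤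
        ENNReal.ofReal (C * γ ^ (1 + rate D₁ D₂)) * envelopeNorm 8 (f (γ * τ)) := by
  obtain ⟨K, hK0, hK⟩ := hh.exists_symbol_bound hlam₀
  set S : ℝ := decaySum.toReal with hS
  have hS0 : 0 ≤ S := ENNReal.toReal_nonneg
  have hSd : decaySum = ENNReal.ofReal S := (ENNReal.ofReal_toReal decaySum_ne_top).symm
  -- Factor 4 for the components of the residual, 3 for the square of a sum of three terms (one
  -- intralayer, two interlayer). The constant 1 + A below stands in for the square root of A, since
  -- A ≤ (1 + A)².
  set A : ℝ := 4 * (3 * (18 * S * (18 + lam₁) ^ 2 + 18 * S ^ 3 * K ^ 2)) with hA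
  have hA0 : 0 ≤ A := by positivity
  refine ⟨1 + A, by positivity, ?_⟩
  intro γ l θ hγ hγ1 hl hk hθ hθ1 d f₀ f hf τ hτ
  set g := γ ^ (1 + rate D₁ D₂) with hg
  have hg0 : 0 < g := by positivity
  by_cases hfin : ∀ i σ, sobolevNorm 8 (f (γ * τ) i σ) < ∞
  swap
  · push Not at hfin
    obtain ⟨i, σ, hi⟩ := hfin
    rw [envelopeNorm_eq_top (top_le_iff.mp hi), ENNReal.mul_top]
    · exact le_top
    · rw [Ne, ENNReal.ofReal_eq_zero, not_le]; positivity
  obtain ⟨U, hU, hUn⟩ := exists_isFourierRep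
    (hf.differentiable_space (γ * τ) (by positivity)) hfin
  refine stateNorm_le_of_sq_le ?_
  set E : ℝ≥0∞ := ∑ i, ∑ σ, sobolevNorm 8 (f (γ * τ) i σ) ^ 2 with hE
  have hγg : γ ^ 2 ≤ g := by
    rw [hg, ← Real.rpow_natCast]
    refine Real.rpow_le_rpow_of_exponent_ge hγ hγ1 ?_
    have := hh.ratio_bounds.2
    push_cast
    linarith
  have hBrow : ∀ i, ∑ σ, ∫⁻ η, sobolevWeight 8 η * ‖U i σ η‖ₑ ^ 2 ≤ E := fun i => by
    simp only [hUn]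
    exact Finset.single_le_sum (f := fun i => ∑ σ, sobolevNorm 8 (f (γ * τ) i σ) ^ 2)
      (fun _ _ => zero_le) (Finset.mem_univ i)
  have hB : ∀ i σ, ∫⁻ η, sobolevWeight 8 η * ‖U i σ η‖ₑ ^ 2 ≤ E := fun i σ =>
    (Finset.single_le_sum (f := fun σ => ∫⁻ η, sobolevWeight 8 η * ‖U i σ η‖ₑ ^ 2)
      (fun _ _ => zero_le) (Finset.mem_univ σ)).trans (hBrow i)
  have hcomp : ∀ i σ, ∑' m, ‖residual hs l γ θ d f τ i σ m‖ₑ ^ 2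
      ≤ 3 * (18 * decaySum * ENNReal.ofReal ((18 + lam₁) * g) ^ 2
        + 18 * decaySum ^ 3 * ENNReal.ofReal (K * g) ^ 2) * E := by
    intro i σ
    have hI := (hU.symbol i (otherLayer σ)).tsum_synth_le hγ hγ1 θ d i σ
      (continuous_intraError θ i σ γ) (K := (18 + lam₁) * g) fun η =>
        (norm_intraError_le θ i σ hγ hθ hθ1 η).trans (by gcongr)
    have hJ := fun σ' => (hU.symbol (otherLayer i) σ').tsum_tsum_synth_le hγ hγ1 θ d i σ
      (M := fun n η => ((interError hs l γ θ lam₀ (otherLayer i) n η : ℝ) : ℂ))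
      (fun n => hh.continuous_interError hl γ θ lam₀ (otherLayer i) n) (K := K * g)
      (by positivity) (fun n η => by
        rw [Complex.norm_real]
        exact hK γ l θ hγ hγ1 hl hk (otherLayer i) n η)
      (φ := interPhase θ d (otherLayer i) σ') (norm_interPhase θ d (otherLayer i) σ')
    calc _ ≤ ∑' m, 3 * (‖(γ : ℂ) * synth γ (fun η => intraError θ i σ γ η * U i (otherLayer σ) η)
          (sitePos θ d i σ m)‖ₑ ^ 2
          + ‖(γ : ℂ) * ∑' n, interPhase θ d (otherLayer i) 0 n (sitePos θ d i σ m)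
            * synth γ (fun η => ((interError hs l γ θ lam₀ (otherLayer i) n η : ℝ) : ℂ)
              * U (otherLayer i) 0 η) (sitePos θ d i σ m)‖ₑ ^ 2
          + ‖(γ : ℂ) * ∑' n, interPhase θ d (otherLayer i) 1 n (sitePos θ d i σ m)
            * synth γ (fun η => ((interError hs l γ θ lam₀ (otherLayer i) n η : ℝ) : ℂ)
              * U (otherLayer i) 1 η) (sitePos θ d i σ m)‖ₑ ^ 2) := by
          refine ENNReal.tsum_le_tsum fun m => ?_
          refine le_trans ?_ (add_sq_le_three_mul _ _ _)
          gcongr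
          rw [hh.residual_eq hl hγ hγ1 lam₀ θ d hf hτ hU, Fin.sum_univ_two, mul_add, ← add_assoc]
          refine (enorm_add_le _ _).trans (add_le_add_left ((enorm_add_le _ _).trans
            (add_le_add_left (le_of_eq ?_) _)) _)
          simp only [enorm_mul, enorm_phase, mul_one]
      _ ≤ 3 * (18 * decaySum * ENNReal.ofReal ((18 + lam₁) * g) ^ 2 * E
          + 18 * decaySum ^ 3 * ENNReal.ofReal (K * g) ^ 2
            * ∑ σ', ∫⁻ η, sobolevWeight 8 η * ‖U (otherLayer i) σ' η‖ₑ ^ 2) := by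
          rw [ENNReal.tsum_mul_left, ENNReal.tsum_add, ENNReal.tsum_add, Fin.sum_univ_two,
            mul_add (18 * decaySum ^ 3 * ENNReal.ofReal (K * g) ^ 2), ← add_assoc]
          refine mul_le_mul_right (add_le_add (add_le_add ?_ ?_) ?_) _
          · exact hI.trans (by gcongr; exact hB _ _)
          · exact hJ 0
          · exact hJ 1
      _ ≤ 3 * (18 * decaySum * ENNReal.ofReal ((18 + lam₁) * g) ^ 2 * E
          + 18 * decaySum ^ 3 * ENNReal.ofReal (K * g) ^ 2 * E) := by
          gcongr; exact hBrow _
      _ = _ := by ring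
  calc _ ≤ ∑ _i : Fin 2, ∑ _σ : Fin 2, 3 * (18 * decaySum * ENNReal.ofReal ((18 + lam₁) * g) ^ 2
        + 18 * decaySum ^ 3 * ENNReal.ofReal (K * g) ^ 2) * E :=
        Finset.sum_le_sum fun i _ => Finset.sum_le_sum fun σ _ => hcomp i σ
    _ = ENNReal.ofReal (A * g ^ 2) * E := by
        simp only [Finset.sum_const, Finset.card_univ, Fintype.card_fin, nsmul_eq_mul]
        have e : ENNReal.ofReal (A * g ^ 2) = 4 * (3 *
            (18 * decaySum * ENNReal.ofReal ((18 + lam₁) * g) ^ 2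
              + 18 * decaySum ^ 3 * ENNReal.ofReal (K * g) ^ 2)) := by
          have e4 : (4 : ℝ≥0∞) = ENNReal.ofReal 4 := by simp
          have e3 : (3 : ℝ≥0∞) = ENNReal.ofReal 3 := by simp
          have e18 : (18 : ℝ≥0∞) = ENNReal.ofReal 18 := by simp
          rw [hSd, e4, e3, e18, ← ENNReal.ofReal_pow hS0, ← ENNReal.ofReal_pow (by positivity),
            ← ENNReal.ofReal_pow (by positivity), ← ENNReal.ofReal_mul (by positivity),
            ← ENNReal.ofReal_mul (by positivity), ← ENNReal.ofReal_mul (by positivity),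
            ← ENNReal.ofReal_mul (by positivity),
            ← ENNReal.ofReal_add (by positivity) (by positivity),
            ← ENNReal.ofReal_mul (by positivity), ← ENNReal.ofReal_mul (by positivity), hA]
          congr 1
          ring
        rw [e]
        push_cast
        ring
    _ ≤ _ := by
        gcongr
        rw [← ENNReal.ofReal_pow (by positivity), mul_pow]
        refine ENNReal.ofReal_le_ofReal ?_
        gcongr
        nlinarith

end TBG

end

theorem mainTheorem3
    (hs : ℝ → ℝ) (C₁ C₂ C₃ D₁ D₂ l₀ : ℝ)
    (hh : TBG.HoppingAssumption hs C₁ C₂ C₃ D₁ D₂ l₀)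
    (lam₀ lam₁ : ℝ) (hlam₀ : 0 < lam₀) (hlam₁ : 0 < lam₁) :
    ∃ γ₀ C c : ℝ, 0 < γ₀ ∧ 0 < C ∧ 0 < c ∧
      ∀ γ l θ : ℝ, 0 < γ → γ ≤ γ₀ → l₀ ≤ l →
        TBG.hHat hs TBG.kappa l = lam₀ * γ → 0 < θ → θ ≤ lam₁ * γ →
      ∀ (d : TBG.Plane) (f₀ : TBG.Envelope) (f : ℝ → TBG.Envelope),
        (∀ i σ, TBG.sobolevNorm 8 (f₀ i σ) < ⊤) →
        TBG.IsBMSolution lam₀ γ θ d f₀ f →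
      ∀ τ : ℝ, 0 ≤ τ →
        TBG.stateNorm (TBG.residual hs l γ θ d f τ) ≤
          ENNReal.ofReal (C * γ ^ (1 + c)) * TBG.envelopeNorm 8 (f (γ * τ)) := by
  obtain ⟨C, hC, h⟩ := TBG.exists_stateNorm_residual_le hh hlam₀ hlam₁
  -- No smallness beyond γ ≤ 1 is needed: it bounds the dual coordinates and makes powers of γ
  -- decrease with the exponent.
  exact ⟨1, C, TBG.rate D₁ D₂, one_pos, hC, hh.ratio_bounds.1,
    fun γ l θ hγ hγ1 hl hk hθ hθ1 d f₀ f _ hf τ hτ =>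
      h γ l θ hγ hγ1 hl hk hθ hθ1 d f₀ f hf τ hτ⟩
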